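/- Let $p,q\ge 3$ be integers with $p+q$ even, and let $m\ge 0$ be an integer with $m+3\le (p+q)/2$. **The $\mathfrak g$-action.** Let $\mathfrak g=\mathfrak o(p,q)\otimes\mathbb C$ be the Lie algebra of complex $(p+q)\times(p+q)$ matrices $X$ with ${}^tX I_{p,q}+I_{p,q}X=0$, $I_{p,q}=\mathrm{diag}(1_p,-1_q)$. It acts on formal power series in $x_1,\dots,x_p,y_1,\dots,y_q$ through the representation $\pi$ with $$\pi(E_{i,j}-E_{j,i})=x_i\partial_{x_j}-x_j\partial_{x_i}\ (i,j\le p),\qquad \pi(E_{p+i,p+j}-E_{p+j,p+i})=y_i\partial_{y_j}-y_j\partial_{y_i}\ (i,j\le q),$$ $$\pi(E_{i,p+j}+E_{p+j,i})=\sqrt{-1}\,(x_iy_j+\partial_{x_i}\partial_{y_j})\ (i\le p,\ j\le q).$$ **The commuting $\mathfrak{sl}_2$.** Put $r_x^2=\sum_i x_i^2$, $r_y^2=\sum_j y_j^2$, $\Delta_x=\sum_i\partial_{x_i}^2$, $\Delta_y=\sum_j\partial_{y_j}^2$, and $$H=-\sum_i x_i\partial_{x_i}-\tfrac p2+\sum_j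 y_j\partial_{y_j}+\tfrac q2,\qquad X^+=-\tfrac12(\Delta_x+r_y^2),\qquad X^-=\tfrac12(r_x^2+\Delta_y).$$ **The modules.** For $\alpha\in\mathbb C\setminus\{0,-1,-2,\dots\}$ let $\psi_\alpha=\sum_{n\ge0}\frac{(-1)^n}{n!\,\alpha(\alpha+1)\cdots(\alpha+n-1)}\left(\frac{r_x^2r_y^2}{4}\right)^n$. Let $\mathscr E$ be the complex span of all $h_1(x)h_2(y)(r_x^2/2)^a(r_y^2/2)^b\psi_\alpha$ with $h_1,h_2$ complex homogeneous harmonic polynomials on $\mathbb R^p$, $\mathbb R^q$, $a,b\in\mathbb N$ and such $\alpha$. Let $M^{\pm}_m$ consist of $0$ and of all $f\in\mathscr E$ with $$Hf=\pm m f,\quad X^{\pm}f=0,\quad (X^{\mp})^jf\ne0\ (1\le j\le m),\quad (X^{\mp})^{m+1}f=0.$$ **Gelfand–Kirillov dimension and Bernstein degree.** For a finitely generated $U(\mathfrak g)$-module $V$ and a finite-dimensional subspace $V_0$ generating $V$, one considers the polynomial $P$ with $\dim U_n(\mathfrak g)V_0=P(n)$ for all large $n$, where $U_n(\mathfrak g)$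 is spanned by the products of at most $n$ elements of $\mathfrak g$. If $P$ has leading term $\frac{c}{d!}n^d$, then $d$ is the Gelfand–Kirillov dimension and $c$ the Bernstein degree of $V$; they do not depend on $V_0$. **Statement.** $M^+_m$ and $M^-_m$ are finitely generated $\mathfrak g$-submodules; each has Gelfand–Kirillov dimension $p+q-3$ and Bernstein degree $$\frac{4(m+1)\,(p+q-4)!}{(p-2)!\,(q-2)!},$$ that is, $(m+1)$ times the Bernstein degree of $M^{\pm}_0$ (the minimal representation). -/

import Mathlib

noncomputable section

open Matrix

/-! ### Quadratic expressions in operators with canonical commutation relations -/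

section Quadratic

variable {ι A : Type*} [Fintype ι] [Ring A] [Algebra ℂ A]

/-- `∑ M_{ab} x_a y_b`. -/
def quadForm (x y : ι → A) (M : Matrix ι ι ℂ) : A := ∑ a, ∑ b, M a b • (x a * y b)

variable {x y : ι → A} {s : ι → ℂ}

theorem quadForm_sub (M N : Matrix ι ι ℂ) :
    quadForm x y (M - N) = quadForm x y M - quadForm x y N := by
  simp only [quadForm, Matrix.sub_apply, sub_smul, Finset.sum_sub_distrib]

theorem quadForm_mul [DecidableEq ι]
    (hyx : ∀ a b, y a * x b = x b * y a - (if a = b then Complex.I * s a else 0) • (1 : A))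
    (M N : Matrix ι ι ℂ) :
    quadForm x y M * quadForm x y N =
      (∑ a, ∑ b, ∑ c, ∑ d, (M a b * N c d) • (x a * x c * (y b * y d)))
        - Complex.I • quadForm x y (M * Matrix.diagonal s * N) := by
  have h0 : ∀ a b c d, x a * y b * (x c * y d) = x a * x c * (y b * y d)
      - (if b = c then Complex.I * s b else 0) • (x a * y d) := fun a b c d => by
    calc x a * y b * (x c * y d) = x a * (y b * x c) * y d := by simp only [mul_assoc]
      _ = _ := by
        rw [hyx]
        simp only [mul_sub, sub_mul, mul_assoc, smul_mul_assoc, mul_smul_comm, one_mul]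
  have h1 : quadForm x y M * quadForm x y N =
      ∑ a, ∑ b, ∑ c, ∑ d, (M a b * N c d) • (x a * y b * (x c * y d)) := by
    simp_rw [quadForm, Finset.sum_mul, Finset.mul_sum, smul_mul_assoc, mul_smul_comm, smul_smul]
  have h2 : ∑ a, ∑ b, ∑ c, ∑ d, (M a b * N c d) •
        ((if b = c then Complex.I * s b else 0) • (x a * y d)) =
      Complex.I • quadForm x y (M * Matrix.diagonal s * N) := by
    simp_rw [quadForm, Finset.smul_sum, Matrix.mul_apply (M := M * Matrix.diagonal s),
      Matrix.mul_diagonal, Finset.sum_smul, Finset.smul_sum, smul_smul]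
    refine Finset.sum_congr rfl fun a _ => ?_
    refine Eq.trans ?_ Finset.sum_comm
    refine Finset.sum_congr rfl fun b _ => ?_
    rw [Finset.sum_comm]
    refine Finset.sum_congr rfl fun d _ => ?_
    simp only [mul_ite, mul_zero, ite_smul, zero_smul, Finset.sum_ite_eq, Finset.mem_univ, if_true]
    congr 1
    ring
  rw [h1, ← h2]
  simp_rw [h0, smul_sub, Finset.sum_sub_distrib]

theorem quadForm_commutator [DecidableEq ι] (hx : ∀ a b, x a * x b = x b * x a)
    (hy : ∀ a b, y a * y b = y b * y a)
    (hyx : ∀ a b, y a * x b = x b * y a - (if a = b then Complex.I * s a else 0) • (1 : A))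
    (M N : Matrix ι ι ℂ) :
    quadForm x y M * quadForm x y N - quadForm x y N * quadForm x y M =
      Complex.I • quadForm x y (N * Matrix.diagonal s * M - M * Matrix.diagonal s * N) := by
  have h : ∑ a, ∑ b, ∑ c, ∑ d, (N a b * M c d) • (x a * x c * (y b * y d)) =
      ∑ a, ∑ b, ∑ c, ∑ d, (M a b * N c d) • (x a * x c * (y b * y d)) := by
    calc _ = ∑ a, ∑ c, ∑ b, ∑ d, (N a b * M c d) • (x a * x c * (y b * y d)) :=
          Finset.sum_congr rfl fun a _ => Finset.sum_comm
      _ = ∑ c, ∑ a, ∑ d, ∑ b, (N a b * M c d) • (x a * x c * (y b * y d)) := by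
          rw [Finset.sum_comm]
          exact Finset.sum_congr rfl fun c _ => Finset.sum_congr rfl fun a _ => Finset.sum_comm
      _ = ∑ c, ∑ d, ∑ a, ∑ b, (N a b * M c d) • (x a * x c * (y b * y d)) :=
          Finset.sum_congr rfl fun c _ => Finset.sum_comm
      _ = _ := by
          refine Finset.sum_congr rfl fun c _ => Finset.sum_congr rfl fun d _ =>
            Finset.sum_congr rfl fun a _ => Finset.sum_congr rfl fun b _ => ?_
          rw [hx a c, hy b d, mul_comm (N a b)]
  rw [quadForm_mul hyx, quadForm_mul hyx, h, quadForm_sub, smul_sub]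
  abel

theorem smul_quadForm_commutator [DecidableEq ι] (hs : ∀ a, s a * s a = 1)
    (hx : ∀ a b, x a * x b = x b * x a) (hy : ∀ a b, y a * y b = y b * y a)
    (hyx : ∀ a b, y a * x b = x b * y a - (if a = b then Complex.I * s a else 0) • (1 : A))
    (X Y : Matrix ι ι ℂ) :
    Complex.I • quadForm x y (Matrix.diagonal s * (X * Y - Y * X)) =
      (Complex.I • quadForm x y (Matrix.diagonal s * X)) *
          (Complex.I • quadForm x y (Matrix.diagonal s * Y)) -
        (Complex.I • quadForm x y (Matrix.diagonal s * Y)) *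
          (Complex.I • quadForm x y (Matrix.diagonal s * X)) := by
  have h1 : Matrix.diagonal s * Matrix.diagonal s = (1 : Matrix ι ι ℂ) := by
    rw [Matrix.diagonal_mul_diagonal, ← Matrix.diagonal_one]
    simp only [hs]
  have h2 : ∀ Z W : Matrix ι ι ℂ,
      Matrix.diagonal s * Z * Matrix.diagonal s * (Matrix.diagonal s * W) =
        Matrix.diagonal s * (Z * W) := fun Z W => by
    rw [mul_assoc (_ * Z), ← mul_assoc (Matrix.diagonal s) _ W, h1, one_mul, mul_assoc]
  have h := quadForm_commutator hx hy hyx (Matrix.diagonal s * X) (Matrix.diagonal s * Y)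
  rw [h2, h2, quadForm_sub] at h
  simp only [smul_mul_assoc, mul_smul_comm]
  rw [← smul_sub, ← smul_sub, h, smul_smul Complex.I Complex.I, Complex.I_mul_I, mul_sub,
    quadForm_sub]
  module

/-- For `S` antisymmetric, the trace pairing with the moment matrix `-x yᵀ + y xᵀ` is a
quadratic form. -/
theorem sum_moment_eq [DecidableEq ι]
    (hyx : ∀ a b, y a * x b = x b * y a - (if a = b then Complex.I * s a else 0) • (1 : A))
    {S : Matrix ι ι ℂ} (hS : ∀ a b, S a b = -S b a) :
    ∑ a, ∑ b, S b a • (-(x a * y b) + y a * x b) = (2 : ℂ) • quadForm x y S := by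
  have h0 : ∀ a, S a a = 0 := fun a => by linear_combination (1 / 2) * hS a a
  have h1 : ∑ a, ∑ b, S b a • (-(x a * y b) + y a * x b) =
      ∑ a, ∑ b, (S a b • (x a * y b) + S b a • (x b * y a)) := by
    refine Finset.sum_congr rfl fun a _ => Finset.sum_congr rfl fun b _ => ?_
    rw [hyx, hS a b]
    split_ifs with h
    · subst h
      simp [h0]
    · simp
  have h2 : ∑ a, ∑ b, S b a • (x b * y a) = quadForm x y S := Finset.sum_comm
  rw [h1]
  simp only [Finset.sum_add_distrib]
  rw [h2, two_smul, quadForm]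

end Quadratic

attribute [local instance 100] LieRing.ofAssociativeRing

/-! ### Gelfand–Kirillov dimension and Bernstein degree of a module over a Lie algebra -/

section Growth

variable (L : Type*) [LieRing L] [LieAlgebra ℂ L]

/-- `U_n(L)`: the subspace of the enveloping algebra spanned by the products of at most `n`
elements of `L`. -/
def envFiltration (n : ℕ) : Submodule ℂ (UniversalEnvelopingAlgebra ℂ L) :=
  Submodule.span ℂ {u | ∃ l : List L, l.length ≤ n ∧
    u = (l.map (UniversalEnvelopingAlgebra.ι ℂ)).prod}

variable (V : Type*) [AddCommGroup V] [Module ℂ V] [LieRingModule L V] [LieModule ℂ L V]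

/-- The action of the enveloping algebra `U(L)` on an `L`-module `V`. -/
def envAction : UniversalEnvelopingAlgebra ℂ L →ₐ[ℂ] Module.End ℂ V :=
  UniversalEnvelopingAlgebra.lift ℂ (LieModule.toEnd ℂ L V)

variable {V}

/-- `U_n(L) V₀`: the span of all `u v` with `u ∈ U_n(L)` and `v ∈ V₀`. -/
def growthFiltration (V₀ : Submodule ℂ V) (n : ℕ) : Submodule ℂ V :=
  Submodule.span ℂ {w | ∃ u ∈ envFiltration L n, ∃ v ∈ V₀, w = envAction L V u v}

/-- `U(L) V₀ = V`. -/
def IsGeneratingSubspace (V₀ : Submodule ℂ V) : Prop :=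
  Submodule.span ℂ {w | ∃ u, ∃ v ∈ V₀, w = envAction L V u v} = ⊤

variable (V)

/-- `P` is a Hilbert polynomial of the `U(L)`-module `V`: for some finite-dimensional generating
subspace `V₀`, one has `dim U_n(L) V₀ = P(n)` for all sufficiently large `n`. -/
def IsHilbertPolynomial (P : Polynomial ℚ) : Prop :=
  ∃ V₀ : Submodule ℂ V, FiniteDimensional ℂ V₀ ∧ IsGeneratingSubspace L V₀ ∧
    ∀ᶠ n : ℕ in Filter.atTop,
      (Module.finrank ℂ (growthFiltration L V₀ n) : ℚ) = P.eval (n : ℚ)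

/-- The Gelfand–Kirillov dimension of the finitely generated `U(L)`-module `V` is `d`:
`V` has Hilbert polynomials, and all of them, whatever the generating subspace, have degree `d`. -/
def HasGKDim (d : ℕ) : Prop :=
  (∃ P, IsHilbertPolynomial L V P) ∧ ∀ P, IsHilbertPolynomial L V P → P.natDegree = d

/-- The Bernstein degree of the finitely generated `U(L)`-module `V` is `c`: `V` has Hilbert
polynomials, and all of them, whatever the generating subspace, have leading term
`(c / d!) n ^ d`, where `d` is the degree. -/
def HasBernsteinDegree (c : ℚ) : Prop :=
  (∃ P, IsHilbertPolynomial L V P) ∧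
    ∀ P, IsHilbertPolynomial L V P → P.leadingCoeff = c / (P.natDegree.factorial : ℚ)

end Growth

/-! ### The representation `π` of `𝔬(p,q) ⊗ ℂ` by differential operators -/

section Oscillator

variable (p q : ℕ)

/-- The complexification `𝔤` of `𝔬(p,q)`: complex matrices `X` with `Xᵀ I_{p,q} + I_{p,q} X = 0`. -/
abbrev OrthLie : LieSubalgebra ℂ (Matrix (Fin p ⊕ Fin q) (Fin p ⊕ Fin q) ℂ) :=
  LieAlgebra.Orthogonal.so' (Fin p) (Fin q) ℂ

/-- Formal power series in `x_1, …, x_p` (the variables `inl i`) and `y_1, …, y_q`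
(the variables `inr j`). -/
abbrev FormalFn : Type := MvPowerSeries (Fin p ⊕ Fin q) ℂ

variable {p q}

/-- Multiplication by the coordinate `a`. -/
def mulOp (a : Fin p ⊕ Fin q) : Module.End ℂ (FormalFn p q) :=
  LinearMap.mulLeft ℂ (MvPowerSeries.X a)

/-- Partial derivative with respect to the coordinate `a`. -/
def derivOp (a : Fin p ⊕ Fin q) : Module.End ℂ (FormalFn p q) :=
  (MvPowerSeries.pderiv ℂ a).toLinearMap

/-- The signs `ε_a` of `I_{p,q}`. -/
def sgn : Fin p ⊕ Fin q → ℂ := Sum.elim (fun _ => 1) (fun _ => -1)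

/-- The quantized coordinates `x̂ = (x, -i ∂_y)`. -/
def xHat : Fin p ⊕ Fin q → Module.End ℂ (FormalFn p q)
  | .inl i => mulOp (.inl i)
  | .inr j => -Complex.I • derivOp (.inr j)

/-- The quantized coordinates `ŷ = (-i ∂_x, y)`. -/
def yHat : Fin p ⊕ Fin q → Module.End ℂ (FormalFn p q)
  | .inl i => -Complex.I • derivOp (.inl i)
  | .inr j => mulOp (.inr j)

/-- The quantized moment map `μ̂ = (-x̂ ŷᵀ + ŷ x̂ᵀ) I_{p,q}`. -/
def muHat (a b : Fin p ⊕ Fin q) : Module.End ℂ (FormalFn p q) :=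
  sgn b • (-(xHat a * yHat b) + yHat a * xHat b)

/-- `π(X) = i ⟨μ̂, X⟩`, the pairing being `⟨Y, X⟩ = ½ tr (Y X)`. -/
def piOp (X : Matrix (Fin p ⊕ Fin q) (Fin p ⊕ Fin q) ℂ) : Module.End ℂ (FormalFn p q) :=
  (Complex.I / 2) • ∑ a, ∑ b, X b a • muHat a b

theorem mulOp_comm (a b : Fin p ⊕ Fin q) : mulOp a * mulOp b = mulOp b * mulOp a := by
  ext1 f
  simp only [mulOp, Module.End.mul_apply, LinearMap.mulLeft_apply]
  ring

theorem derivOp_comm (a b : Fin p ⊕ Fin q) :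
    derivOp a * derivOp b = derivOp b * derivOp a := by
  ext1 f
  ext n
  simp only [derivOp, Module.End.mul_apply, Derivation.coeFn_coe,
    MvPowerSeries.coeff_pderiv]
  rcases eq_or_ne a b with rfl | h
  · rfl
  · simp only [Finsupp.add_apply, Finsupp.single_eq_of_ne h, Finsupp.single_eq_of_ne h.symm]
    rw [add_right_comm]
    push_cast
    ring

theorem derivOp_mulOp (a b : Fin p ⊕ Fin q) :
    derivOp a * mulOp b = mulOp b * derivOp a + (if a = b then (1 : ℂ) else 0) • 1 := by
  ext1 f
  simp only [mulOp, derivOp, Module.End.mul_apply, LinearMap.mulLeft_apply,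
    Derivation.coeFn_coe, Derivation.leibniz, LinearMap.add_apply,
    LinearMap.smul_apply, Module.End.one_apply, MvPowerSeries.pderiv_X, smul_eq_mul]
  split_ifs with h <;> simp_all [eq_comm]

theorem xHat_comm (a b : Fin p ⊕ Fin q) : xHat a * xHat b = xHat b * xHat a := by
  rcases a with a | a <;> rcases b with b | b <;>
    first
    | simp [xHat, derivOp_mulOp]; done
    | simp [xHat, mulOp_comm (Sum.inl a)]; done
    | simp [xHat, derivOp_comm (Sum.inr a)]

theorem yHat_comm (a b : Fin p ⊕ Fin q) : yHat a * yHat b = yHat b * yHat a := by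
  rcases a with a | a <;> rcases b with b | b <;>
    first
    | simp [yHat, derivOp_mulOp]; done
    | simp [yHat, mulOp_comm (Sum.inr a)]; done
    | simp [yHat, derivOp_comm (Sum.inl a)]

theorem yHat_xHat (a b : Fin p ⊕ Fin q) :
    yHat a * xHat b = xHat b * yHat a - (if a = b then Complex.I * sgn a else 0) • 1 := by
  rcases a with a | a <;> rcases b with b | b
  · by_cases h : a = b <;> simp [xHat, yHat, derivOp_mulOp, sgn, h, sub_eq_add_neg]
  · simp [xHat, yHat, derivOp_comm (Sum.inl a)]
  · simp [xHat, yHat, mulOp_comm (Sum.inr a)]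
  · by_cases h : a = b
    · simp only [h, if_true, xHat, yHat, sgn, Sum.elim_inr, mul_smul_comm, smul_mul_assoc,
        derivOp_mulOp, smul_add, smul_smul]
      module
    · simp [xHat, yHat, derivOp_mulOp, h, Ne.symm h]

theorem orthLie_skew {X : Matrix (Fin p ⊕ Fin q) (Fin p ⊕ Fin q) ℂ} (hX : X ∈ OrthLie p q)
    (a b : Fin p ⊕ Fin q) : sgn a * X a b = -(sgn b * X b a) := by
  have h := hX
  rw [OrthLie, LieAlgebra.Orthogonal.so', mem_skewAdjointMatricesLieSubalgebra,
    mem_skewAdjointMatricesSubmodule, Matrix.IsSkewAdjoint, Matrix.IsAdjointPair] at h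
  have h2 := congrFun (congrFun h b) a
  simp only [LieAlgebra.Orthogonal.indefiniteDiagonal, mul_diagonal, diagonal_mul,
    transpose_apply, Matrix.neg_apply] at h2
  simp only [sgn]
  linear_combination h2

theorem piOp_eq_quadForm {X : Matrix (Fin p ⊕ Fin q) (Fin p ⊕ Fin q) ℂ} (hX : X ∈ OrthLie p q) :
    piOp X = Complex.I • quadForm xHat yHat (Matrix.diagonal sgn * X) := by
  have h := sum_moment_eq yHat_xHat (S := Matrix.diagonal sgn * X) fun a b => by
    simpa only [diagonal_mul] using orthLie_skew hX a b
  simp only [piOp, muHat, smul_smul]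
  simp only [diagonal_mul] at h
  simp only [mul_comm (X _ _)]
  rw [h, smul_smul]
  congr 1
  ring

variable (p q)

/-- The Lie algebra homomorphism `π : 𝔤 → End`. -/
def piHom : OrthLie p q →ₗ⁅ℂ⁆ Module.End ℂ (FormalFn p q) where
  toFun X := piOp X.1
  map_add' X Y := by
    simp [piOp, add_smul, Finset.sum_add_distrib]
  map_smul' c X := by
    simp only [piOp, RingHom.id_apply, Finset.smul_sum, smul_smul]
    refine Finset.sum_congr rfl fun a _ => Finset.sum_congr rfl fun b _ => ?_
    congr 1
    simp
    ring
  map_lie' {X Y} := by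
    rw [LieRing.of_associative_ring_bracket, piOp_eq_quadForm X.2, piOp_eq_quadForm Y.2,
      piOp_eq_quadForm (⁅X, Y⁆ : OrthLie p q).2]
    exact smul_quadForm_commutator (by rintro (a | a) <;> simp [sgn]) xHat_comm yHat_comm
      yHat_xHat X.1 Y.1

/-- The `𝔤`-module structure given by `π`. -/
instance instLieRingModuleFormalFn : LieRingModule (OrthLie p q) (FormalFn p q) :=
  LieRingModule.compLieHom (FormalFn p q) (piHom p q)

instance instLieModuleFormalFn : LieModule ℂ (OrthLie p q) (FormalFn p q) :=
  LieModule.compLieHom (FormalFn p q) (piHom p q)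

/-! ### The commuting `𝔰𝔩₂` -/

/-- `r_x² = ∑ x_i²`. -/
def rxSq : FormalFn p q := ∑ i : Fin p, MvPowerSeries.X (.inl i) ^ 2

/-- `r_y² = ∑ y_j²`. -/
def rySq : FormalFn p q := ∑ j : Fin q, MvPowerSeries.X (.inr j) ^ 2

/-- `H = -E_x - p/2 + E_y + q/2`. -/
def opH : Module.End ℂ (FormalFn p q) :=
  -(∑ i : Fin p, mulOp (.inl i) * derivOp (.inl i)) - ((p : ℂ) / 2) • 1
    + (∑ j : Fin q, mulOp (.inr j) * derivOp (.inr j)) + ((q : ℂ) / 2) • 1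

/-- `X⁺ = -½ (Δ_x + r_y²)`. -/
def opXplus : Module.End ℂ (FormalFn p q) :=
  (-(1 / 2) : ℂ) • ((∑ i : Fin p, derivOp (.inl i) ^ 2) + LinearMap.mulLeft ℂ (rySq p q))

/-- `X⁻ = ½ (r_x² + Δ_y)`. -/
def opXminus : Module.End ℂ (FormalFn p q) :=
  (1 / 2 : ℂ) • (LinearMap.mulLeft ℂ (rxSq p q) + ∑ j : Fin q, derivOp (.inr j) ^ 2)

/-! ### The function space `𝓔` and the modules `M^±_m` -/

/-- `ℋ^d(ℝⁿ)`: complex homogeneous harmonic polynomials of degree `d` in `n` variables. -/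
def harmonicPoly (n d : ℕ) : Submodule ℂ (MvPolynomial (Fin n) ℂ) :=
  MvPolynomial.homogeneousSubmodule (Fin n) ℂ d ⊓
    LinearMap.ker (∑ i : Fin n, (MvPolynomial.pderiv i).toLinearMap ^ 2 :
      Module.End ℂ (MvPolynomial (Fin n) ℂ))

/-- `Ψ_α(u) = ∑ (-1)^n / (n! (α)_n) u^n`, with `(α)_n` the rising factorial. -/
def besselSeries (α : ℂ) : PowerSeries ℂ :=
  PowerSeries.mk fun n => (-1) ^ n / ((n.factorial : ℂ) * (ascPochhammer ℂ n).eval α)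

/-- `ψ_α = Ψ_α(r_x² r_y² / 4)`. -/
def psi (α : ℂ) : FormalFn p q :=
  PowerSeries.subst ((1 / 4 : ℂ) • (rxSq p q * rySq p q)) (besselSeries α)

/-- The series `r_x² r_y² / 4` has no constant term, so it can be substituted in `Ψ_α`. -/
theorem hasSubst_rxSq_mul_rySq :
    PowerSeries.HasSubst ((1 / 4 : ℂ) • (rxSq p q * rySq p q)) :=
  PowerSeries.HasSubst.of_constantCoeff_zero (by simp [rxSq, rySq])

/-- The space `𝓔`, spanned by the `h₁(x) h₂(y) ρ_x^a ρ_y^b ψ_α` with `h₁`, `h₂` homogeneous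
harmonic, `a, b ∈ ℕ`, `α ∉ {0, -1, -2, …}`, where `ρ_x = r_x²/2` and `ρ_y = r_y²/2`. -/
def spaceE : Submodule ℂ (FormalFn p q) :=
  Submodule.span ℂ {f | ∃ k l : ℕ, ∃ h₁ ∈ harmonicPoly p k, ∃ h₂ ∈ harmonicPoly q l,
    ∃ a b : ℕ, ∃ α : ℂ, (∀ n : ℕ, α ≠ -(n : ℂ)) ∧
      f = (MvPolynomial.rename Sum.inl h₁ : MvPolynomial (Fin p ⊕ Fin q) ℂ) *
        (MvPolynomial.rename Sum.inr h₂ : MvPolynomial (Fin p ⊕ Fin q) ℂ) *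
        ((1 / 2 : ℂ) • rxSq p q) ^ a * ((1 / 2 : ℂ) • rySq p q) ^ b * psi p q α}

/-- The highest weight vectors in `𝓔` that generate an `(m+1)`-dimensional `𝔰𝔩₂`-module. -/
def plusVectors (m : ℕ) : Set (FormalFn p q) :=
  {f | f ∈ spaceE p q ∧ opH p q f = (m : ℂ) • f ∧ opXplus p q f = 0 ∧
    (∀ j, 1 ≤ j → j ≤ m → (opXminus p q ^ j) f ≠ 0) ∧ (opXminus p q ^ (m + 1)) f = 0}

/-- The lowest weight vectors in `𝓔` that generate an `(m+1)`-dimensional `𝔰𝔩₂`-module. -/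
def minusVectors (m : ℕ) : Set (FormalFn p q) :=
  {f | f ∈ spaceE p q ∧ opH p q f = (-(m : ℂ)) • f ∧ opXminus p q f = 0 ∧
    (∀ j, 1 ≤ j → j ≤ m → (opXplus p q ^ j) f ≠ 0) ∧ (opXplus p q ^ (m + 1)) f = 0}

/-- The `𝔤`-module `M⁺_m`. -/
def Mplus (m : ℕ) : LieSubmodule ℂ (OrthLie p q) (FormalFn p q) :=
  LieSubmodule.lieSpan ℂ (OrthLie p q) (plusVectors p q m)

/-- The `𝔤`-module `M⁻_m`. -/
def Mminus (m : ℕ) : LieSubmodule ℂ (OrthLie p q) (FormalFn p q) :=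
  LieSubmodule.lieSpan ℂ (OrthLie p q) (minusVectors p q m)

end Oscillator

end

/-! The modules are decomposed under the rotations in `x` and in `y`. Call a function of `𝓔` built
on harmonic polynomials of degrees `k` and `l` of type `(k, l)`. If `X⁺` kills it, then `Δ_x f =
-r_y² f`, and the Casimir eigenvalue equation in `x` becomes a recursion on the degree `d` in `x`
with indicial factor `d(d + p - 2) - k(k + p - 2)`. This is nonzero for `d > k`, so `f` is
determined by its part of degree `k` in `x` (`eq_zero_of_opXplus_of_cas`). Hence `f` is a
combination of functions `h₁ h₂ r_y^{2s} ψ_{k + p/2}`. The `H`-weight `m` fixes `s` through `4s + 2l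
+ q = 2m + 2k + p`, and comparison of lowest terms shows that `(X⁻)^(m+1)` kills such a function
exactly when `s ≤ m`. So the types of `M⁺_m` have multiplicity one and lie on the `m + 1` parallel
half-lines `l - k = m + (p - q)/2 - 2s`, `0 ≤ s ≤ m` (`highestFil_eq_iSup`). The action of `𝔤`
preserves `M⁺_m` because it commutes with `𝔰𝔩₂` and preserves `𝓔`.

Filter by `k + l`. From some level on, raising the level by two adds exactly one type on each
half-line (`finrank_highestFil_add_two`). Since `dim ℋ^k(ℝⁿ)` is eventually a polynomial in `k` with
leading term `2 k^(n-2) / (n-2)!`, the increments have leading term `4 (m+1) n^(p+q-4) / ((p-2)!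
(q-2)!)`. Summation gives degree `p + q - 3` and the stated Bernstein degree.

To use this filtration for the growth of the module, each step must be produced by one application
of `𝔤`. An explicit combination of noncompact elements carries type `(k, l)` to `(k + 1, l + 1)` on
the same half-line, with a scalar that is nonzero far enough out (`sum_noncompact_lie`). The
finitely many low types are put into the generating subspace. Any two generating subspaces give
filtrations interlaced up to a shift, hence the same degree and leading coefficient
(`natDegree_and_leadingCoeff_of_isHilbertPolynomial`). Finally `(X⁻)^m` identifies `M⁺_m` with
`M⁻_m` (`MplusEquivMminus`). -/

noncomputable section

open Matrix

/-! ### Growth filtrations and their independence of the generating subspace -/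

section Growth

variable {L : Type*} [LieRing L] [LieAlgebra ℂ L]
  {V : Type*} [AddCommGroup V] [Module ℂ V] [LieRingModule L V] [LieModule ℂ L V]

theorem envAction_ι (x : L) (v : V) :
    envAction L V (UniversalEnvelopingAlgebra.ι ℂ x) v = ⁅x, v⁆ := by
  simp [envAction]

/-- Allows statements about the enveloping algebra to be proved by induction in the tensor algebra.
-/
theorem UniversalEnvelopingAlgebra.mkAlgHom_surjective :
    Function.Surjective (UniversalEnvelopingAlgebra.mkAlgHom ℂ L) :=
  RingCon.mk'_surjective _

/-- A subspace stable under `L` is stable under the enveloping algebra. -/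
theorem envAction_mem {K : Submodule ℂ V} (hK : ∀ (x : L), ∀ v ∈ K, ⁅x, v⁆ ∈ K)
    (u : UniversalEnvelopingAlgebra ℂ L) : ∀ v ∈ K, envAction L V u v ∈ K := by
  obtain ⟨t, rfl⟩ := UniversalEnvelopingAlgebra.mkAlgHom_surjective u
  induction t using TensorAlgebra.induction with
  | algebraMap r =>
    intro v hv
    simpa [Module.algebraMap_end_apply] using K.smul_mem r hv
  | ι x =>
    intro v hv
    have := envAction_ι x v
    rw [UniversalEnvelopingAlgebra.ι_apply] at this
    exact this ▸ hK x v hv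
  | mul a b ha hb =>
    intro v hv
    rw [map_mul, map_mul]
    exact ha _ (hb v hv)
  | add a b ha hb =>
    intro v hv
    rw [map_add, map_add]
    exact K.add_mem (ha v hv) (hb v hv)

/-- Minimality of the growth filtration: a product of `r` elements of `L` moves `V₀ ≤ F 0` up by at
most `r` steps, one factor at a time. -/
theorem growthFiltration_le {V₀ : Submodule ℂ V} {F : ℕ → Submodule ℂ V} (hF : Monotone F)
    (h0 : V₀ ≤ F 0) (hs : ∀ n, ∀ (x : L), ∀ v ∈ F n, ⁅x, v⁆ ∈ F (n + 1)) (n : ℕ) :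
    growthFiltration L V₀ n ≤ F n := by
  refine Submodule.span_le.2 ?_
  rintro _ ⟨u, hu, v, hv, rfl⟩
  have key : ∀ l : List L, envAction L V (l.map (UniversalEnvelopingAlgebra.ι ℂ)).prod v
      ∈ F l.length := by
    intro l
    induction l with
    | nil => simpa using h0 hv
    | cons x l ih =>
      rw [List.map_cons, List.prod_cons, map_mul, Module.End.mul_apply, envAction_ι]
      exact hs _ _ _ ih
  have h2 : envFiltration L n ≤ (F n).comap ((LinearMap.applyₗ v).comp
      (envAction L V).toLinearMap) := by
    refine Submodule.span_le.2 ?_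
    rintro _ ⟨l, hl, rfl⟩
    exact hF hl (key l)
  exact h2 hu

theorem growthFiltration_mono (V₀ : Submodule ℂ V) : Monotone (growthFiltration L V₀) := by
  intro a b hab
  refine Submodule.span_mono ?_
  rintro _ ⟨u, hu, v, hv, rfl⟩
  refine ⟨u, Submodule.span_mono ?_ hu, v, hv, rfl⟩
  rintro _ ⟨l, hl, rfl⟩
  exact ⟨l, hl.trans hab, rfl⟩

theorem le_growthFiltration_zero (V₀ : Submodule ℂ V) : V₀ ≤ growthFiltration L V₀ 0 := fun v hv =>
  Submodule.subset_span ⟨1, Submodule.subset_span ⟨[], by simp, by simp⟩, v, hv, by simp⟩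

theorem lie_mem_growthFiltration {V₀ : Submodule ℂ V} {n : ℕ} (x : L) {v : V}
    (hv : v ∈ growthFiltration L V₀ n) : ⁅x, v⁆ ∈ growthFiltration L V₀ (n + 1) := by
  have : growthFiltration L V₀ n ≤
      (growthFiltration L V₀ (n + 1)).comap (LieModule.toEnd ℂ L V x) := by
    refine Submodule.span_le.2 ?_
    rintro _ ⟨u, hu, w, hw, rfl⟩
    refine Submodule.subset_span ⟨UniversalEnvelopingAlgebra.ι ℂ x * u, ?_, w, hw, ?_⟩
    · have h2 : envFiltration L n ≤ (envFiltration L (n + 1)).comap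
          (LinearMap.mulLeft ℂ (UniversalEnvelopingAlgebra.ι ℂ x)) := by
        refine Submodule.span_le.2 ?_
        rintro _ ⟨l, hl, rfl⟩
        exact Submodule.subset_span ⟨x :: l, by simpa using hl, by simp⟩
      exact h2 hu
    · rw [map_mul, Module.End.mul_apply, envAction_ι]
      rfl
  exact this hv

/-- The union contains `V₀` and is stable under `L`, hence under the enveloping algebra. -/
theorem iSup_growthFiltration {V₀ : Submodule ℂ V} (h : IsGeneratingSubspace L V₀) :
    ⨆ n, growthFiltration L V₀ n = ⊤ := by
  rw [eq_top_iff, ← h]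
  refine Submodule.span_le.2 ?_
  rintro _ ⟨u, v, hv, rfl⟩
  refine envAction_mem ?_ u v (Submodule.mem_iSup_of_mem 0 (le_growthFiltration_zero V₀ hv))
  intro x w hw
  rw [Submodule.mem_iSup_of_directed _ (growthFiltration_mono V₀).directed_le] at hw
  obtain ⟨n, hn⟩ := hw
  exact Submodule.mem_iSup_of_mem (n + 1) (lie_mem_growthFiltration x hn)

theorem isGeneratingSubspace_of_iSup {V₀ : Submodule ℂ V}
    (h : ⨆ n, growthFiltration L V₀ n = ⊤) : IsGeneratingSubspace L V₀ := by
  rw [IsGeneratingSubspace, eq_top_iff, ← h]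
  refine iSup_le fun n => Submodule.span_mono ?_
  rintro _ ⟨u, _, v, hv, rfl⟩
  exact ⟨u, v, hv, rfl⟩

/-- The growth filtrations of two generating subspaces are comparable up to a shift. -/
theorem exists_growthFiltration_le {V₀ V₁ : Submodule ℂ V} [FiniteDimensional ℂ V₀]
    (h : IsGeneratingSubspace L V₁) :
    ∃ r, ∀ n, growthFiltration L V₀ n ≤ growthFiltration L V₁ (n + r) := by
  -- A finitely generated subspace is a compact element of the lattice of subspaces, so `V₀` already
  -- lies in a single step of the exhausting filtration of `V₁`.
  have hc : IsCompactElement V₀ :=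
    (Submodule.fg_iff_compact _).1 (Module.Finite.iff_fg.1 inferInstance)
  obtain ⟨_, ⟨r, rfl⟩, hr⟩ := (CompleteLattice.isCompactElement_iff_le_of_directed_sSup_le _ _).1 hc
    (Set.range (growthFiltration L V₁)) (Set.range_nonempty _)
    (growthFiltration_mono V₁).directed_le.directedOn_range
    (by rw [sSup_range, iSup_growthFiltration h]; exact le_top)
  refine ⟨r, growthFiltration_le (F := fun n => growthFiltration L V₁ (n + r)) ?_ (by simpa) ?_⟩
  · intro a b hab
    exact growthFiltration_mono V₁ (by omega)
  · intro n x v hv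
    have := lie_mem_growthFiltration x hv
    rwa [add_right_comm] at this

/-- A polynomial that is eventually nonnegative on `ℕ` has nonnegative leading coefficient. -/
theorem Polynomial.leadingCoeff_nonneg_of_eventually {A : Polynomial ℚ}
    (h : ∀ᶠ n : ℕ in Filter.atTop, 0 ≤ A.eval (n : ℚ)) : 0 ≤ A.leadingCoeff := by
  by_contra! hlt
  have h2 : ∀ᶠ n : ℕ in Filter.atTop, A.eval (n : ℚ) < 0 := by
    rcases le_or_gt A.degree 0 with hd | hd
    · rw [Polynomial.eq_C_of_degree_le_zero hd] at hlt ⊢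
      exact .of_forall fun n => by simpa using hlt
    · exact ((Polynomial.tendsto_atBot_of_leadingCoeff_nonpos A hd hlt.le).comp
        tendsto_natCast_atTop_atTop).eventually_lt_atBot 0
  obtain ⟨n, h1, h2⟩ := (h.and h2).exists
  exact absurd h1 (not_le.2 h2)

theorem Polynomial.natDegree_le_and_leadingCoeff_le_of_eventually_le {A B : Polynomial ℚ}
    (h0 : ∀ᶠ n : ℕ in Filter.atTop, 0 ≤ A.eval (n : ℚ))
    (h : ∀ᶠ n : ℕ in Filter.atTop, A.eval (n : ℚ) ≤ B.eval (n : ℚ)) :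
    A.natDegree ≤ B.natDegree ∧
      (A.natDegree = B.natDegree → A.leadingCoeff ≤ B.leadingCoeff) := by
  have hA := Polynomial.leadingCoeff_nonneg_of_eventually h0
  have hBA : 0 ≤ (B - A).leadingCoeff := by
    refine Polynomial.leadingCoeff_nonneg_of_eventually ?_
    filter_upwards [h] with n hn
    simpa using hn
  rcases eq_or_ne A 0 with rfl | hA0
  · refine ⟨by simp, fun _ => ?_⟩
    simpa using hBA
  constructor
  · by_contra! hlt
    rw [Polynomial.leadingCoeff_sub_of_degree_lt' (Polynomial.degree_lt_degree hlt)] at hBA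
    exact hA0 (Polynomial.leadingCoeff_eq_zero.1 (by linarith))
  · intro hd
    by_contra! hlt
    have h1 : (B - A).coeff B.natDegree = B.leadingCoeff - A.leadingCoeff := by
      rw [Polynomial.coeff_sub, Polynomial.leadingCoeff, Polynomial.leadingCoeff, hd]
    have h2 : (B - A).natDegree = B.natDegree := by
      refine le_antisymm ((Polynomial.natDegree_sub_le _ _).trans (by simp [hd])) ?_
      exact Polynomial.le_natDegree_of_ne_zero (by rw [h1]; linarith)
    rw [Polynomial.leadingCoeff, h2, h1] at hBA
    linarith

/-- A Hilbert polynomial computed from one generating subspace determines the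
degree and leading coefficient of all Hilbert polynomials. -/
theorem natDegree_and_leadingCoeff_of_isHilbertPolynomial {V₁ : Submodule ℂ V} {P Q : Polynomial ℚ}
    (hgen : IsGeneratingSubspace L V₁) (hfin : ∀ n, FiniteDimensional ℂ (growthFiltration L V₁ n))
    (hP : ∀ᶠ n : ℕ in Filter.atTop,
      (Module.finrank ℂ (growthFiltration L V₁ n) : ℚ) = P.eval (n : ℚ))
    (hQ : IsHilbertPolynomial L V Q) :
    Q.natDegree = P.natDegree ∧ Q.leadingCoeff = P.leadingCoeff := by
  obtain ⟨V₀, hV₀, hgen₀, hQ⟩ := hQ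
  have : FiniteDimensional ℂ V₁ :=
    Submodule.finiteDimensional_of_le (le_growthFiltration_zero (L := L) V₁)
  obtain ⟨r, hr⟩ := exists_growthFiltration_le (V₀ := V₀) hgen
  obtain ⟨t, ht⟩ := exists_growthFiltration_le (V₀ := V₁) hgen₀
  have hfin₀ : ∀ n, FiniteDimensional ℂ (growthFiltration L V₀ n) := fun n =>
    Submodule.finiteDimensional_of_le (hr n)
  -- The two inclusions give `Q(n) ≤ P(n + r)` and `P(n) ≤ Q(n + t)` for large `n`; a shift of the
  -- variable changes neither degree nor leading coefficient.
  have hdeg : ∀ (A : Polynomial ℚ) (k : ℕ),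
      (A.comp (.X + .C (k : ℚ))).natDegree = A.natDegree := fun A k => by
    rw [Polynomial.natDegree_comp, Polynomial.natDegree_X_add_C, mul_one]
  have hlead : ∀ (A : Polynomial ℚ) (k : ℕ),
      (A.comp (.X + .C (k : ℚ))).leadingCoeff = A.leadingCoeff := fun A k => by
    rw [Polynomial.leadingCoeff_comp (by rw [Polynomial.natDegree_X_add_C]; simp),
      Polynomial.leadingCoeff_X_add_C, one_pow, mul_one]
  have h1 : ∀ᶠ n : ℕ in Filter.atTop, Q.eval (n : ℚ) ≤ (P.comp (.X + .C (r : ℚ))).eval (n : ℚ) := by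
    filter_upwards [hQ, (Filter.tendsto_add_atTop_nat r).eventually hP] with n h1 h2
    have h3 : ((n + r : ℕ) : ℚ) = n + r := by push_cast; ring
    rw [← h1, Polynomial.eval_comp, Polynomial.eval_add, Polynomial.eval_X, Polynomial.eval_C,
      ← h3, ← h2]
    exact_mod_cast Submodule.finrank_mono (hr n)
  have h2 : ∀ᶠ n : ℕ in Filter.atTop, P.eval (n : ℚ) ≤ (Q.comp (.X + .C (t : ℚ))).eval (n : ℚ) := by
    filter_upwards [hP, (Filter.tendsto_add_atTop_nat t).eventually hQ] with n h1 h2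
    have h3 : ((n + t : ℕ) : ℚ) = n + t := by push_cast; ring
    rw [← h1, Polynomial.eval_comp, Polynomial.eval_add, Polynomial.eval_X, Polynomial.eval_C,
      ← h3, ← h2]
    exact_mod_cast Submodule.finrank_mono (ht n)
  have hQ0 : ∀ᶠ n : ℕ in Filter.atTop, 0 ≤ Q.eval (n : ℚ) := by
    filter_upwards [hQ] with n hn using hn ▸ Nat.cast_nonneg _
  have hP0 : ∀ᶠ n : ℕ in Filter.atTop, 0 ≤ P.eval (n : ℚ) := by
    filter_upwards [hP] with n hn using hn ▸ Nat.cast_nonneg _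
  have k1 := Polynomial.natDegree_le_and_leadingCoeff_le_of_eventually_le hQ0 h1
  have k2 := Polynomial.natDegree_le_and_leadingCoeff_le_of_eventually_le hP0 h2
  rw [hdeg, hlead] at k1 k2
  have hd := le_antisymm k1.1 k2.1
  exact ⟨hd, le_antisymm (k1.2 hd) (k2.2 hd.symm)⟩

/-- Gelfand–Kirillov dimension and Bernstein degree from a filtration that grows polynomially and
is generated in one step. -/
theorem hasGKDim_and_hasBernsteinDegree {F : ℕ → Submodule ℂ V} (hF : Monotone F)
    (htop : ∀ v, ∃ n, v ∈ F n) (hfin : ∀ n, FiniteDimensional ℂ (F n))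
    (hs : ∀ n, ∀ (x : L), ∀ v ∈ F n, ⁅x, v⁆ ∈ F (n + 1))
    (hgen : ∀ n, F (n + 1) ≤ F n ⊔ Submodule.span ℂ {w | ∃ x : L, ∃ v ∈ F n, w = ⁅x, v⁆})
    {P : Polynomial ℚ} (hP : ∀ n : ℕ, (Module.finrank ℂ (F n) : ℚ) = P.eval (n : ℚ))
    {c : ℚ} (hc : P.leadingCoeff = c / (P.natDegree.factorial : ℚ)) :
    HasGKDim L V P.natDegree ∧ HasBernsteinDegree L V c := by
  -- One-step generation makes `F` the growth filtration of its own first term.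
  have heq : ∀ n, growthFiltration L (F 0) n = F n := fun n => by
    refine le_antisymm (growthFiltration_le hF le_rfl hs n) ?_
    induction n with
    | zero => exact le_growthFiltration_zero _
    | succ n ih =>
      refine (hgen n).trans (sup_le (ih.trans (growthFiltration_mono _ n.le_succ)) ?_)
      refine Submodule.span_le.2 ?_
      rintro _ ⟨x, v, hv, rfl⟩
      exact lie_mem_growthFiltration x (ih hv)
  have hg : IsGeneratingSubspace L (F 0) := by
    refine isGeneratingSubspace_of_iSup (eq_top_iff.2 fun v _ => ?_)
    obtain ⟨n, hn⟩ := htop v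
    exact Submodule.mem_iSup_of_mem n (by rwa [heq])
  have hP' : ∀ᶠ n : ℕ in Filter.atTop,
      (Module.finrank ℂ (growthFiltration L (F 0) n) : ℚ) = P.eval (n : ℚ) :=
    .of_forall fun n => by rw [heq, hP]
  have hex : IsHilbertPolynomial L V P := ⟨F 0, hfin 0, hg, hP'⟩
  have hall : ∀ Q, IsHilbertPolynomial L V Q → _ := fun Q hQ =>
    natDegree_and_leadingCoeff_of_isHilbertPolynomial hg (fun n => by rw [heq]; exact hfin n) hP' hQ
  exact ⟨⟨⟨P, hex⟩, fun Q hQ => (hall Q hQ).1⟩,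
    ⟨P, hex⟩, fun Q hQ => by rw [(hall Q hQ).2, hc, (hall Q hQ).1]⟩

theorem HasBernsteinDegree.unique {c c' : ℚ} (h : HasBernsteinDegree L V c)
    (h' : HasBernsteinDegree L V c') : c = c' := by
  obtain ⟨⟨P, hP⟩, h⟩ := h
  have := (h P hP).symm.trans (h'.2 P hP)
  have hf : ((P.natDegree.factorial : ℕ) : ℚ) ≠ 0 := by positivity
  field_simp at this
  exact this

section Equiv

variable {W : Type*} [AddCommGroup W] [Module ℂ W] [LieRingModule L W] [LieModule ℂ L W]

theorem envAction_equiv (e : V ≃ₗ⁅ℂ,L⁆ W) (u : UniversalEnvelopingAlgebra ℂ L) (v : V) :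
    e (envAction L V u v) = envAction L W u (e v) := by
  obtain ⟨t, rfl⟩ := UniversalEnvelopingAlgebra.mkAlgHom_surjective u
  induction t using TensorAlgebra.induction generalizing v with
  | algebraMap r =>
    simp only [AlgHom.commutes, Module.algebraMap_end_apply]
    exact map_smul (e : V →ₗ⁅ℂ,L⁆ W) r v
  | ι x =>
    have h1 := envAction_ι x v
    have h2 := envAction_ι x (e v)
    rw [UniversalEnvelopingAlgebra.ι_apply] at h1 h2
    rw [h1, h2]
    exact LieModuleHom.map_lie (e : V →ₗ⁅ℂ,L⁆ W) x v
  | mul a b ha hb =>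
    rw [map_mul, map_mul, map_mul, Module.End.mul_apply, Module.End.mul_apply, ha, hb]
  | add a b ha hb =>
    rw [map_add, map_add, map_add, LinearMap.add_apply, LinearMap.add_apply, ← ha, ← hb]
    exact map_add (e : V →ₗ⁅ℂ,L⁆ W) _ _

theorem IsHilbertPolynomial.of_equiv (e : V ≃ₗ⁅ℂ,L⁆ W) {P : Polynomial ℚ}
    (h : IsHilbertPolynomial L V P) : IsHilbertPolynomial L W P := by
  obtain ⟨V₀, hfin, hgen, hP⟩ := h
  have himg : ∀ s : Set (UniversalEnvelopingAlgebra ℂ L),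
      Submodule.span ℂ {w | ∃ u ∈ s, ∃ v ∈ V₀.map e.toLinearEquiv.toLinearMap,
          w = envAction L W u v} =
        (Submodule.span ℂ {w | ∃ u ∈ s, ∃ v ∈ V₀, w = envAction L V u v}).map
          e.toLinearEquiv.toLinearMap := by
    intro s
    rw [Submodule.map_span]
    congr 1
    ext w
    constructor
    · rintro ⟨u, hu, _, ⟨v, hv, rfl⟩, rfl⟩
      exact ⟨_, ⟨u, hu, v, hv, rfl⟩, envAction_equiv e u v⟩
    · rintro ⟨_, ⟨u, hu, v, hv, rfl⟩, rfl⟩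
      exact ⟨u, hu, _, ⟨v, hv, rfl⟩, envAction_equiv e u v⟩
  refine ⟨V₀.map e.toLinearEquiv.toLinearMap, inferInstance, ?_, ?_⟩
  · have := himg Set.univ
    simp only [Set.mem_univ, true_and] at this
    rw [IsGeneratingSubspace] at hgen ⊢
    rw [this, hgen, Submodule.map_top, LinearEquiv.range]
  · filter_upwards [hP] with n hn
    rw [← hn]
    have := himg (envFiltration L n)
    rw [growthFiltration]
    simp only [SetLike.mem_coe] at this
    rw [this]
    exact congrArg _ (LinearEquiv.finrank_map_eq e.toLinearEquiv _)

theorem isHilbertPolynomial_congr (e : V ≃ₗ⁅ℂ,L⁆ W) (P : Polynomial ℚ) :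
    IsHilbertPolynomial L V P ↔ IsHilbertPolynomial L W P :=
  ⟨.of_equiv e, .of_equiv e.symm⟩

theorem hasGKDim_congr (e : V ≃ₗ⁅ℂ,L⁆ W) (d : ℕ) : HasGKDim L V d ↔ HasGKDim L W d := by
  simp only [HasGKDim, isHilbertPolynomial_congr e]

theorem hasBernsteinDegree_congr (e : V ≃ₗ⁅ℂ,L⁆ W) (c : ℚ) :
    HasBernsteinDegree L V c ↔ HasBernsteinDegree L W c := by
  simp only [HasBernsteinDegree, isHilbertPolynomial_congr e]

end Equiv

end Growth

/-- Coordinates `X a` and commuting derivations `D a` with `D a (X b) = δ_{ab}` on a commutative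
`ℂ`-algebra. -/
structure WeylData (σ R : Type*) [DecidableEq σ] [CommRing R] [Algebra ℂ R] where
  X : σ → R
  D : σ → Derivation ℂ R R
  D_X : ∀ a b, D a (X b) = if a = b then 1 else 0
  D_comm : ∀ a b f, D a (D b f) = D b (D a f)

/-! ### Laplacian, Euler operator and rotation Casimir, for polynomials and power series alike -/

namespace WeylData

variable {σ R : Type*} [DecidableEq σ] [CommRing R] [Algebra ℂ R] (w : WeylData σ R)
  (s t : Finset σ)

/-- The Laplacian in the variables `s`. -/
def lap : R →ₗ[ℂ] R := ∑ a ∈ s, (w.D a).toLinearMap ∘ₗ (w.D a).toLinearMap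

/-- The Euler operator in the variables `s`. -/
def eul : R →ₗ[ℂ] R := ∑ a ∈ s, LinearMap.mulLeft ℂ (w.X a) ∘ₗ (w.D a).toLinearMap

/-- The squared radius in the variables `s`. -/
def rsq : R := ∑ a ∈ s, w.X a ^ 2

/-- The Casimir operator of the rotations in the variables `s`. -/
def cas : R →ₗ[ℂ] R :=
  LinearMap.mulLeft ℂ (w.rsq s) ∘ₗ w.lap s - w.eul s ∘ₗ w.eul s - ((s.card : ℂ) - 2) • w.eul s

theorem lap_apply (f : R) : w.lap s f = ∑ a ∈ s, w.D a (w.D a f) := by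
  simp [lap, LinearMap.sum_apply]

theorem eul_apply (f : R) : w.eul s f = ∑ a ∈ s, w.X a * w.D a f := by
  simp [eul, LinearMap.sum_apply]

theorem cas_apply (f : R) : w.cas s f =
    w.rsq s * w.lap s f - w.eul s (w.eul s f) - ((s.card : ℂ) - 2) • w.eul s f := rfl

variable {s t}

theorem D_rsq (a : σ) : w.D a (w.rsq s) = if a ∈ s then 2 * w.X a else 0 := by
  simp only [rsq, map_sum, Derivation.leibniz_pow, w.D_X]
  simp

theorem D_mul (a : σ) (f g : R) : w.D a (f * g) = w.D a f * g + f * w.D a g := by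
  rw [Derivation.leibniz, smul_eq_mul, smul_eq_mul]
  ring

theorem eul_mul (f g : R) : w.eul s (f * g) = w.eul s f * g + f * w.eul s g := by
  simp only [eul_apply, D_mul, Finset.sum_mul, Finset.mul_sum, ← Finset.sum_add_distrib]
  exact Finset.sum_congr rfl fun a _ => by ring

theorem lap_mul (f g : R) : w.lap s (f * g) =
    w.lap s f * g + 2 * ∑ a ∈ s, w.D a f * w.D a g + f * w.lap s g := by
  simp only [lap_apply, D_mul, map_add, Finset.sum_mul, Finset.mul_sum, ← Finset.sum_add_distrib]
  exact Finset.sum_congr rfl fun a _ => by ring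

theorem two_smul_eq (f : R) : (2 : ℂ) • f = 2 * f := by rw [two_smul, two_mul]

theorem eul_rsq : w.eul s (w.rsq s) = (2 : ℂ) • w.rsq s := by
  rw [two_smul_eq]
  rw [eul_apply, rsq, Finset.mul_sum]
  refine Finset.sum_congr rfl fun a ha => ?_
  rw [← rsq, w.D_rsq, if_pos ha]
  ring

theorem eul_rsq_of_disjoint (h : Disjoint s t) : w.eul s (w.rsq t) = 0 := by
  rw [eul_apply]
  refine Finset.sum_eq_zero fun a ha => ?_
  rw [w.D_rsq, if_neg (Finset.disjoint_left.1 h ha), mul_zero]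

theorem lap_rsq : w.lap s (w.rsq s) = 2 * (s.card : R) := by
  rw [lap_apply, Finset.card_eq_sum_ones, Nat.cast_sum, Finset.mul_sum]
  refine Finset.sum_congr rfl fun a ha => ?_
  rw [w.D_rsq, if_pos ha, D_mul, w.D_X, if_pos rfl, show (2 : R) = ((2 : ℕ) : R) by norm_num,
    Derivation.map_natCast]
  simp

/-- The commutator `[Δ, r²] = 4E + 2 |s|`, from which the `𝔰𝔩₂` relations and the invariance of the
Casimir operator follow. -/
theorem lap_rsq_mul (f : R) : w.lap s (w.rsq s * f) =
    w.rsq s * w.lap s f + (4 : ℂ) • w.eul s f + (2 * (s.card : ℂ)) • f := by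
  rw [lap_mul, lap_rsq]
  have : ∑ a ∈ s, w.D a (w.rsq s) * w.D a f = 2 * w.eul s f := by
    rw [eul_apply, Finset.mul_sum]
    refine Finset.sum_congr rfl fun a ha => ?_
    rw [w.D_rsq, if_pos ha]
    ring
  rw [this]
  simp only [Algebra.smul_def, map_mul, map_natCast, map_ofNat]
  ring

theorem lap_rsq_mul_of_disjoint (h : Disjoint s t) (f : R) :
    w.lap s (w.rsq t * f) = w.rsq t * w.lap s f := by
  have h0 : ∀ a ∈ s, w.D a (w.rsq t) = 0 := fun a ha => by
    rw [w.D_rsq, if_neg (Finset.disjoint_left.1 h ha)]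
  simp only [lap_apply, Finset.mul_sum]
  refine Finset.sum_congr rfl fun a ha => ?_
  rw [D_mul, h0 a ha, zero_mul, zero_add, D_mul, h0 a ha, zero_mul, zero_add]

theorem D_X_mul (a b : σ) (f : R) :
    w.D a (w.X b * f) = w.X b * w.D a f + if a = b then f else 0 := by
  rw [D_mul, w.D_X]
  split_ifs <;> ring

theorem lap_D (a : σ) (f : R) : w.lap s (w.D a f) = w.D a (w.lap s f) := by
  simp only [lap_apply, map_sum]
  refine Finset.sum_congr rfl fun b _ => ?_
  rw [w.D_comm b a f, w.D_comm b a]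

theorem lap_X_mul {a : σ} (ha : a ∈ s) (f : R) :
    w.lap s (w.X a * f) = w.X a * w.lap s f + (2 : ℂ) • w.D a f := by
  rw [two_smul_eq]
  have h : ∀ b ∈ s, w.D b (w.D b (w.X a * f)) =
      w.X a * w.D b (w.D b f) + if b = a then 2 * w.D a f else 0 := fun b _ => by
    rw [D_X_mul, map_add, D_X_mul]
    split_ifs with h
    · rw [h]; ring
    · rw [map_zero]; ring
  rw [lap_apply, Finset.sum_congr rfl h, Finset.sum_add_distrib, Finset.sum_ite_eq', if_pos ha,
    lap_apply, Finset.mul_sum]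

theorem lap_X_mul_of_notMem {a : σ} (ha : a ∉ s) (f : R) :
    w.lap s (w.X a * f) = w.X a * w.lap s f := by
  simp only [lap_apply, Finset.mul_sum]
  refine Finset.sum_congr rfl fun b hb => ?_
  have : b ≠ a := fun h => ha (h ▸ hb)
  rw [D_X_mul, if_neg this, add_zero, D_X_mul, if_neg this, add_zero]

theorem lap_lap (f : R) : w.lap s (w.lap t f) = w.lap t (w.lap s f) := by
  rw [w.lap_apply t, w.lap_apply t, map_sum]
  refine Finset.sum_congr rfl fun a _ => ?_
  rw [lap_D, lap_D]

theorem eul_D {a : σ} (ha : a ∈ s) (f : R) :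
    w.eul s (w.D a f) = w.D a (w.eul s f) - w.D a f := by
  have : ∀ b ∈ s, w.X b * w.D b (w.D a f) =
      w.D a (w.X b * w.D b f) - if a = b then w.D a f else 0 := fun b _ => by
    rw [D_X_mul, w.D_comm a b]
    split_ifs with h
    · rw [h]; ring
    · ring
  rw [eul_apply, Finset.sum_congr rfl this, Finset.sum_sub_distrib, Finset.sum_ite_eq, if_pos ha,
    ← map_sum, ← eul_apply]

theorem eul_D_of_notMem {a : σ} (ha : a ∉ s) (f : R) :
    w.eul s (w.D a f) = w.D a (w.eul s f) := by
  rw [eul_apply, eul_apply, map_sum]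
  refine Finset.sum_congr rfl fun b hb => ?_
  have : a ≠ b := fun h => ha (h ▸ hb)
  rw [D_X_mul, w.D_comm a b, if_neg this, add_zero]

theorem eul_lap (f : R) : w.eul s (w.lap s f) = w.lap s (w.eul s f) - (2 : ℂ) • w.lap s f := by
  rw [two_smul_eq, w.lap_apply s f, w.lap_apply s (w.eul s f), map_sum, Finset.mul_sum,
    ← Finset.sum_sub_distrib]
  refine Finset.sum_congr rfl fun a ha => ?_
  rw [w.eul_D ha, w.eul_D ha, map_sub]
  ring

theorem eul_lap_of_disjoint (h : Disjoint s t) (f : R) :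
    w.eul s (w.lap t f) = w.lap t (w.eul s f) := by
  rw [w.lap_apply t f, w.lap_apply t (w.eul s f), map_sum]
  refine Finset.sum_congr rfl fun a ha => ?_
  have := Finset.disjoint_right.1 h ha
  rw [w.eul_D_of_notMem this, w.eul_D_of_notMem this]

/-- The Casimir operator is the sum of the squares of the rotations `x_a ∂_b - x_b ∂_a`, so it
commutes with the rotation-invariant `r²` and `Δ`. The proof uses only the commutators of `r²`, `Δ`
and `E`. -/
theorem cas_rsq_mul (f : R) : w.cas s (w.rsq s * f) = w.rsq s * w.cas s f := by
  simp only [cas_apply, lap_rsq_mul, eul_mul, eul_rsq, map_add, map_smul, smul_mul_assoc]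
  simp only [Algebra.smul_def, map_sub, map_mul, map_natCast, map_ofNat]
  ring

theorem cas_lap (f : R) : w.cas s (w.lap s f) = w.lap s (w.cas s f) := by
  simp only [cas_apply, map_sub, map_smul, lap_rsq_mul, eul_lap]
  module

theorem cas_rsq_mul_of_disjoint (h : Disjoint s t) (f : R) :
    w.cas s (w.rsq t * f) = w.rsq t * w.cas s f := by
  simp only [cas_apply, w.lap_rsq_mul_of_disjoint h, eul_mul, w.eul_rsq_of_disjoint h, zero_mul,
    zero_add, mul_sub, mul_smul_comm]
  ring

theorem cas_lap_of_disjoint (h : Disjoint s t) (f : R) :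
    w.cas s (w.lap t f) = w.lap t (w.cas s f) := by
  simp only [cas_apply, w.lap_lap (s := s), w.eul_lap_of_disjoint h, map_sub, map_smul,
    w.lap_rsq_mul_of_disjoint h.symm]

theorem eul_D_of_eul {a : σ} (ha : a ∈ s) {f : R} {k : ℂ} (hk : w.eul s f = k • f) :
    w.eul s (w.D a f) = (k - 1) • w.D a f := by
  rw [w.eul_D ha, hk, Derivation.map_smul]
  module

/-- The harmonic projection of `x_a f`. -/
theorem lap_X_mul_sub {a : σ} (ha : a ∈ s) {f : R} {k : ℂ} (h0 : w.lap s f = 0)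
    (hk : w.eul s f = k • f) :
    w.lap s ((2 * k + s.card - 2) • (w.X a * f) - w.rsq s * w.D a f) = 0 := by
  rw [map_sub, map_smul, w.lap_X_mul ha, h0, w.lap_rsq_mul, w.lap_D, h0, w.eul_D_of_eul ha hk]
  rw [map_zero, mul_zero, mul_zero]
  module

end WeylData

/-! ### Highest weight vectors of `𝔰𝔩₂` -/

section SlTwo

variable {V : Type*} [AddCommGroup V] [Module ℂ V] {h e f : Module.End ℂ V}

theorem slTwo_h_pow (hhf : ∀ v, h (f v) = f (h v) - (2 : ℂ) • f v) {v : V} {μ : ℂ}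
    (hv : h v = μ • v) (n : ℕ) : h ((f ^ n) v) = (μ - 2 * n) • (f ^ n) v := by
  induction n with
  | zero => simp [hv]
  | succ n ih =>
    rw [pow_succ', Module.End.mul_apply, hhf, ih, map_smul]
    push_cast
    module

theorem slTwo_e_pow (hef : ∀ v, e (f v) = f (e v) + h v)
    (hhf : ∀ v, h (f v) = f (h v) - (2 : ℂ) • f v) {v : V} {μ : ℂ} (hv : h v = μ • v)
    (he : e v = 0) (n : ℕ) : e ((f ^ (n + 1)) v) = ((n + 1) * (μ - n)) • (f ^ n) v := by
  induction n with
  | zero => simp [hef, he, hv]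
  | succ n ih =>
    rw [pow_succ', Module.End.mul_apply, hef, ih, slTwo_h_pow hhf hv, map_smul,
      ← Module.End.mul_apply f, ← pow_succ']
    push_cast
    module

theorem slTwo_e_pow_f_pow (hef : ∀ v, e (f v) = f (e v) + h v)
    (hhf : ∀ v, h (f v) = f (h v) - (2 : ℂ) • f v) {v : V} {μ : ℂ} (hv : h v = μ • v)
    (he : e v = 0) (n : ℕ) :
    (e ^ n) ((f ^ n) v) = (∏ i ∈ Finset.range n, (((i : ℂ) + 1) * (μ - i))) • v := by
  induction n with
  | zero => simp
  | succ n ih =>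
    rw [pow_succ e, Module.End.mul_apply, slTwo_e_pow hef hhf hv he, map_smul, ih, smul_smul,
      Finset.prod_range_succ, mul_comm]

theorem slTwo_prod_ne_zero {m n : ℕ} (h : n ≤ m) :
    ∏ i ∈ Finset.range n, (((i : ℂ) + 1) * ((m : ℂ) - i)) ≠ 0 := by
  refine Finset.prod_ne_zero_iff.2 fun i hi => mul_ne_zero (Nat.cast_add_one_ne_zero i) ?_
  rw [sub_ne_zero, Nat.cast_injective.ne_iff]
  rw [Finset.mem_range] at hi
  omega

end SlTwo

/-! ### The `𝔰𝔩₂` relations and the commutation of `𝔰𝔩₂` with `𝔤` -/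

section Operators

variable (p q : ℕ)

/-- The coordinates and partial derivatives on formal power series. -/
def weylF : WeylData (Fin p ⊕ Fin q) (FormalFn p q) where
  X := MvPowerSeries.X
  D := MvPowerSeries.pderiv ℂ
  D_X a b := by
    rw [MvPowerSeries.pderiv_X, Pi.single_apply]
    simp [eq_comm]
  D_comm a b f := LinearMap.congr_fun (derivOp_comm a b) f

/-- The variables `x`. -/
def xVars : Finset (Fin p ⊕ Fin q) := Finset.univ.map Function.Embedding.inl

/-- The variables `y`. -/
def yVars : Finset (Fin p ⊕ Fin q) := Finset.univ.map Function.Embedding.inr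

theorem disjoint_xVars_yVars : Disjoint (xVars p q) (yVars p q) := by
  rw [Finset.disjoint_left]
  simp [xVars, yVars]

theorem card_xVars : (xVars p q).card = p := by simp [xVars]

theorem card_yVars : (yVars p q).card = q := by simp [yVars]

variable {p q}

theorem inl_mem_xVars (i : Fin p) : (Sum.inl i : Fin p ⊕ Fin q) ∈ xVars p q := by simp [xVars]
theorem inr_mem_yVars (j : Fin q) : (Sum.inr j : Fin p ⊕ Fin q) ∈ yVars p q := by simp [yVars]
theorem inr_notMem_xVars (j : Fin q) : (Sum.inr j : Fin p ⊕ Fin q) ∉ xVars p q := by simp [xVars]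
theorem inl_notMem_yVars (i : Fin p) : (Sum.inl i : Fin p ⊕ Fin q) ∉ yVars p q := by simp [yVars]

theorem rxSq_eq : rxSq p q = (weylF p q).rsq (xVars p q) := by
  simp [rxSq, WeylData.rsq, xVars, weylF]

theorem rySq_eq : rySq p q = (weylF p q).rsq (yVars p q) := by
  simp [rySq, WeylData.rsq, yVars, weylF]

theorem mulOp_apply (a : Fin p ⊕ Fin q) (f : FormalFn p q) : mulOp a f = (weylF p q).X a * f := rfl

theorem derivOp_apply (a : Fin p ⊕ Fin q) (f : FormalFn p q) :
    derivOp a f = (weylF p q).D a f := rfl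

theorem opXplus_apply (f : FormalFn p q) : opXplus p q f = (-(1 / 2) : ℂ) •
    ((weylF p q).lap (xVars p q) f + (weylF p q).rsq (yVars p q) * f) := by
  rw [opXplus, rySq_eq, WeylData.lap_apply]
  simp [xVars, pow_two, derivOp_apply, LinearMap.sum_apply]

theorem opXminus_apply (f : FormalFn p q) : opXminus p q f = (1 / 2 : ℂ) •
    ((weylF p q).rsq (xVars p q) * f + (weylF p q).lap (yVars p q) f) := by
  rw [opXminus, rxSq_eq, WeylData.lap_apply]
  simp [yVars, pow_two, derivOp_apply, LinearMap.sum_apply]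

theorem opH_apply (f : FormalFn p q) : opH p q f = -(weylF p q).eul (xVars p q) f
    - ((p : ℂ) / 2) • f + (weylF p q).eul (yVars p q) f + ((q : ℂ) / 2) • f := by
  rw [opH, WeylData.eul_apply, WeylData.eul_apply]
  simp [yVars, xVars, derivOp_apply, mulOp_apply, LinearMap.sum_apply]

theorem opXplus_opXminus (f : FormalFn p q) :
    opXplus p q (opXminus p q f) = opXminus p q (opXplus p q f) + opH p q f := by
  have hd := disjoint_xVars_yVars p q
  simp only [opXplus_apply, opXminus_apply, opH_apply, map_smul, map_add,
    WeylData.lap_rsq_mul, (weylF p q).lap_lap (s := yVars p q) (t := xVars p q), card_xVars,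
    card_yVars, mul_left_comm (WeylData.rsq _ (xVars p q))]
  module

theorem opH_opXminus (f : FormalFn p q) :
    opH p q (opXminus p q f) = opXminus p q (opH p q f) - (2 : ℂ) • opXminus p q f := by
  have hd := disjoint_xVars_yVars p q
  simp only [opXminus_apply, opH_apply, map_smul, map_add, map_sub, map_neg, WeylData.eul_mul,
    WeylData.eul_rsq, WeylData.eul_lap, (weylF p q).eul_rsq_of_disjoint hd.symm,
    (weylF p q).eul_lap_of_disjoint hd, smul_mul_assoc, zero_mul]
  module

theorem opH_opXplus (f : FormalFn p q) :
    opH p q (opXplus p q f) = opXplus p q (opH p q f) + (2 : ℂ) • opXplus p q f := by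
  have hd := disjoint_xVars_yVars p q
  simp only [opXplus_apply, opH_apply, map_smul, map_add, map_sub, map_neg, WeylData.eul_mul,
    WeylData.eul_rsq, WeylData.eul_lap, (weylF p q).eul_rsq_of_disjoint hd,
    (weylF p q).eul_lap_of_disjoint hd.symm, smul_mul_assoc, zero_mul]
  module

/-- This relation and the next three say that `𝔰𝔩₂` acts by brackets on each pair `(x̂_a, ŷ_a)` as
on its two-dimensional representation, with the same matrices for all `a`. -/
theorem xHat_opXplus (a : Fin p ⊕ Fin q) (f : FormalFn p q) :
    opXplus p q (xHat a f) = xHat a (opXplus p q f) - Complex.I • yHat a f := by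
  rcases a with i | j
  · simp only [xHat, yHat, mulOp_apply, derivOp_apply, opXplus_apply, LinearMap.smul_apply,
      WeylData.lap_X_mul _ (inl_mem_xVars i), mul_smul_comm, mul_add,
      mul_left_comm (WeylData.X _ _)]
    match_scalars <;> first | ring1 | linear_combination -Complex.I_sq
  · simp only [xHat, yHat, mulOp_apply, derivOp_apply, opXplus_apply, LinearMap.smul_apply,
      map_smul, WeylData.lap_D, map_add, WeylData.D_mul, WeylData.D_rsq,
      if_pos (inr_mem_yVars _), ← WeylData.two_smul_eq, smul_mul_assoc]
    module

theorem yHat_opXplus (a : Fin p ⊕ Fin q) (f : FormalFn p q) :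
    opXplus p q (yHat a f) = yHat a (opXplus p q f) := by
  rcases a with i | j
  · simp only [yHat, derivOp_apply, opXplus_apply, LinearMap.smul_apply,
      map_smul, WeylData.lap_D, map_add, WeylData.D_mul, WeylData.D_rsq,
      if_neg (inl_notMem_yVars _), zero_mul]
    module
  · simp only [yHat, mulOp_apply, opXplus_apply, 
      WeylData.lap_X_mul_of_notMem _ (inr_notMem_xVars j), mul_smul_comm, mul_add,
      mul_left_comm (WeylData.X _ _)]

theorem xHat_opXminus (a : Fin p ⊕ Fin q) (f : FormalFn p q) :
    opXminus p q (xHat a f) = xHat a (opXminus p q f) := by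
  rcases a with i | j
  · simp only [xHat, mulOp_apply, opXminus_apply, 
      WeylData.lap_X_mul_of_notMem _ (inl_notMem_yVars i), mul_smul_comm, mul_add,
      mul_left_comm (WeylData.X _ _)]
  · simp only [xHat, derivOp_apply, opXminus_apply, LinearMap.smul_apply,
      map_smul, WeylData.lap_D, map_add, WeylData.D_mul, WeylData.D_rsq,
      if_neg (inr_notMem_xVars _), zero_mul]
    module

theorem yHat_opXminus (a : Fin p ⊕ Fin q) (f : FormalFn p q) :
    opXminus p q (yHat a f) = yHat a (opXminus p q f) + Complex.I • xHat a f := by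
  rcases a with i | j
  · simp only [xHat, yHat, mulOp_apply, derivOp_apply, opXminus_apply, LinearMap.smul_apply,
      map_smul, WeylData.lap_D, map_add, WeylData.D_mul, WeylData.D_rsq,
      if_pos (inl_mem_xVars _), ← WeylData.two_smul_eq, smul_mul_assoc]
    module
  · simp only [xHat, yHat, mulOp_apply, derivOp_apply, opXminus_apply, LinearMap.smul_apply,
      WeylData.lap_X_mul _ (inr_mem_yVars j), mul_smul_comm, mul_add,
      mul_left_comm (WeylData.X _ _)]
    match_scalars <;> first | ring1 | linear_combination Complex.I_sq

theorem sum_skew_smul_eq_zero {ι M : Type*} [Fintype ι] [AddCommGroup M] [Module ℂ M]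
    {S : Matrix ι ι ℂ} (hS : ∀ a b, S a b = -S b a) {g : ι → ι → M} (hg : ∀ a b, g a b = g b a) :
    ∑ a, ∑ b, S a b • g a b = 0 := by
  have h : ∑ a, ∑ b, S a b • g a b = -∑ a, ∑ b, S a b • g a b := by
    conv_rhs => rw [Finset.sum_comm]
    simp only [← Finset.sum_neg_distrib]
    refine Finset.sum_congr rfl fun a _ => Finset.sum_congr rfl fun b _ => ?_
    rw [hS a b, hg a b, neg_smul]
  have h2 : (2 : ℂ) • ∑ a, ∑ b, S a b • g a b = 0 := by
    rw [two_smul]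
    nth_rewrite 1 [h]
    rw [neg_add_cancel]
  exact (smul_eq_zero.1 h2).resolve_left two_ne_zero

theorem quadForm_apply (M : Matrix (Fin p ⊕ Fin q) (Fin p ⊕ Fin q) ℂ) (f : FormalFn p q) :
    quadForm xHat yHat M f = ∑ a, ∑ b, M a b • xHat a (yHat b f) := by
  simp [quadForm, LinearMap.sum_apply]

theorem lie_eq_quadForm (X : OrthLie p q) (f : FormalFn p q) :
    ⁅X, f⁆ = Complex.I • quadForm xHat yHat (Matrix.diagonal sgn * X.1) f := by
  change piOp X.1 f = _
  rw [piOp_eq_quadForm X.2, LinearMap.smul_apply]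

theorem diagonal_sgn_mul_skew (X : OrthLie p q) (a b : Fin p ⊕ Fin q) :
    (Matrix.diagonal sgn * X.1 : Matrix _ _ ℂ) a b =
      -(Matrix.diagonal sgn * X.1 : Matrix _ _ ℂ) b a := by
  simpa only [diagonal_mul] using orthLie_skew X.2 a b

/-- The bracket of `X⁺` with `∑ S_ab x̂_a ŷ_b` is a multiple of `∑ S_ab ŷ_a ŷ_b`, which vanishes
since `S` is skew and the `ŷ_a` commute. -/
theorem opXplus_lie (X : OrthLie p q) (f : FormalFn p q) :
    opXplus p q ⁅X, f⁆ = ⁅X, opXplus p q f⁆ := by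
  simp only [lie_eq_quadForm, quadForm_apply, map_smul, map_sum, xHat_opXplus, yHat_opXplus,
    smul_sub, Finset.sum_sub_distrib]
  rw [sub_eq_self]
  exact smul_eq_zero_of_right _ (sum_skew_smul_eq_zero (diagonal_sgn_mul_skew X) fun a b =>
    congrArg (Complex.I • ·) (LinearMap.congr_fun (yHat_comm a b) f))

theorem opXminus_lie (X : OrthLie p q) (f : FormalFn p q) :
    opXminus p q ⁅X, f⁆ = ⁅X, opXminus p q f⁆ := by
  simp only [lie_eq_quadForm, quadForm_apply, map_smul, map_sum, xHat_opXminus, yHat_opXminus,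
    smul_add, map_add, Finset.sum_add_distrib]
  rw [add_eq_left]
  exact smul_eq_zero_of_right _ (sum_skew_smul_eq_zero (diagonal_sgn_mul_skew X) fun a b =>
    congrArg (Complex.I • ·) (LinearMap.congr_fun (xHat_comm a b) f))

theorem opH_eq_commutator (f : FormalFn p q) :
    opH p q f = opXplus p q (opXminus p q f) - opXminus p q (opXplus p q f) := by
  rw [opXplus_opXminus, add_sub_cancel_left]

theorem opH_lie (X : OrthLie p q) (f : FormalFn p q) : opH p q ⁅X, f⁆ = ⁅X, opH p q f⁆ := by
  simp only [opH_eq_commutator, opXplus_lie, opXminus_lie, lie_sub]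

theorem opXminus_pow_lie (n : ℕ) (X : OrthLie p q) (f : FormalFn p q) :
    (opXminus p q ^ n) ⁅X, f⁆ = ⁅X, (opXminus p q ^ n) f⁆ := by
  induction n with
  | zero => simp
  | succ n ih => simp only [pow_succ', Module.End.mul_apply, ih, opXminus_lie]

theorem opXplus_pow_lie (n : ℕ) (X : OrthLie p q) (f : FormalFn p q) :
    (opXplus p q ^ n) ⁅X, f⁆ = ⁅X, (opXplus p q ^ n) f⁆ := by
  induction n with
  | zero => simp
  | succ n ih => simp only [pow_succ', Module.End.mul_apply, ih, opXplus_lie]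

end Operators

/-! ### The chain rule for substitution in a formal power series -/

section ChainRule

variable {σ : Type*}

theorem MvPowerSeries.eq_zero_of_forall_pow_dvd {u f : MvPowerSeries σ ℂ}
    (hu : u.constantCoeff = 0) (h : ∀ N : ℕ, u ^ N ∣ f) : f = 0 := by
  ext d
  obtain ⟨g, hg⟩ := h (d.degree + 1)
  rw [hg, MvPowerSeries.coeff_zero]
  refine MvPowerSeries.coeff_of_lt_order (lt_of_lt_of_le ?_ MvPowerSeries.le_order_mul)
  refine lt_of_lt_of_le ?_ (le_add_right
    (MvPowerSeries.le_order_pow_of_constantCoeff_eq_zero (d.degree + 1) hu))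
  exact_mod_cast Nat.lt_succ_self _

/-- Chain rule for the substitution of a multivariate power series in a power series. -/
theorem PowerSeries.pderiv_subst {u : MvPowerSeries σ ℂ} (hu : u.constantCoeff = 0) (a : σ)
    (φ : PowerSeries ℂ) : MvPowerSeries.pderiv ℂ a (PowerSeries.subst u φ) =
      MvPowerSeries.pderiv ℂ a u * PowerSeries.subst u (PowerSeries.derivative ℂ φ) := by
  have hs : PowerSeries.HasSubst u := PowerSeries.HasSubst.of_constantCoeff_zero hu
  rw [← sub_eq_zero]
  refine MvPowerSeries.eq_zero_of_forall_pow_dvd hu fun N => ?_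
  induction N generalizing φ with
  | zero => simp
  | succ N ih =>
    -- By the Leibniz rule, the defect of the chain rule for `Xψ + c` is `u` times the defect for
    -- `ψ`. Thus every induction step gains a factor `u`, and a series divisible by all powers of
    -- `u` is zero.
    obtain ⟨ψ, c, hφ⟩ : ∃ ψ c, φ = PowerSeries.X * ψ + PowerSeries.C c :=
      ⟨_, _, PowerSeries.eq_X_mul_shift_add_const φ⟩
    obtain ⟨g, hg⟩ := ih ψ
    refine ⟨g, ?_⟩
    rw [pow_succ', mul_assoc, ← hg, hφ]
    simp only [PowerSeries.subst_add hs, PowerSeries.subst_mul hs, PowerSeries.subst_X hs,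
      PowerSeries.subst_C, map_add, Derivation.leibniz, smul_eq_mul, PowerSeries.derivative_X,
      PowerSeries.derivative_C, MvPowerSeries.pderiv_C, mul_one, add_zero]
    ring

end ChainRule

/-! ### Power series in `u = r_x² r_y² / 4` -/

section Radial

variable (p q : ℕ)

/-- `r_x² r_y² / 4`. -/
def radialVar : FormalFn p q := (1 / 4 : ℂ) • (rxSq p q * rySq p q)

/-- The series `∑ c_n (r_x² r_y² / 4)^n`. -/
def radial (c : ℕ → ℂ) : FormalFn p q := PowerSeries.subst (radialVar p q) (PowerSeries.mk c)

/-- The coefficients of the Bessel series. -/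
def besselCoeff (α : ℂ) (n : ℕ) : ℂ :=
  (-1) ^ n / ((n.factorial : ℂ) * (ascPochhammer ℂ n).eval α)

theorem psi_eq_radial (α : ℂ) : psi p q α = radial p q (besselCoeff α) := rfl

variable {p q}

theorem hasSubst_radialVar : PowerSeries.HasSubst (radialVar p q) := hasSubst_rxSq_mul_rySq p q

theorem radial_add (c d : ℕ → ℂ) : radial p q (c + d) = radial p q c + radial p q d := by
  rw [radial, radial, radial, ← PowerSeries.subst_add hasSubst_radialVar]
  rfl

theorem radial_sub (c d : ℕ → ℂ) : radial p q (c - d) = radial p q c - radial p q d := by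
  rw [radial, radial, radial, ← PowerSeries.subst_sub hasSubst_radialVar]
  rfl

theorem radial_smul (r : ℂ) (c : ℕ → ℂ) : radial p q (r • c) = r • radial p q c := by
  rw [radial, radial, ← PowerSeries.subst_smul hasSubst_radialVar]
  rfl

theorem radialVar_mul_radial (c : ℕ → ℂ) :
    radialVar p q * radial p q c = radial p q fun n => Nat.casesOn n 0 c := by
  have : PowerSeries.mk (fun n => Nat.casesOn n 0 c : ℕ → ℂ) =
      PowerSeries.X * PowerSeries.mk c := by
    ext n
    cases n with
    | zero => simp
    | succ n => rw [PowerSeries.coeff_succ_X_mul]; simp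
  rw [radial, radial, this, PowerSeries.subst_mul hasSubst_radialVar,
    PowerSeries.subst_X hasSubst_radialVar]

theorem D_radial (a : Fin p ⊕ Fin q) (c : ℕ → ℂ) : (weylF p q).D a (radial p q c) =
    (weylF p q).D a (radialVar p q) * radial p q fun n => (n + 1) * c (n + 1) := by
  have : PowerSeries.derivative ℂ (PowerSeries.mk c) =
      PowerSeries.mk fun n => ((n : ℂ) + 1) * c (n + 1) := by
    ext n
    rw [PowerSeries.coeff_derivative, PowerSeries.coeff_mk, PowerSeries.coeff_mk, mul_comm]
  rw [radial, radial, ← this]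
  exact PowerSeries.pderiv_subst (by simp [radialVar, rxSq, rySq]) a _

variable (p q) in
/-- `s` and `t` are the two groups of variables, in either order. -/
def IsSplit (s t : Finset (Fin p ⊕ Fin q)) : Prop :=
  (s = xVars p q ∧ t = yVars p q) ∨ (s = yVars p q ∧ t = xVars p q)

variable {s t : Finset (Fin p ⊕ Fin q)}

theorem IsSplit.disjoint (h : IsSplit p q s t) : Disjoint s t := by
  rcases h with ⟨rfl, rfl⟩ | ⟨rfl, rfl⟩
  exacts [disjoint_xVars_yVars p q, (disjoint_xVars_yVars p q).symm]

theorem isSplit_xy : IsSplit p q (xVars p q) (yVars p q) := .inl ⟨rfl, rfl⟩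

theorem isSplit_yx : IsSplit p q (yVars p q) (xVars p q) := .inr ⟨rfl, rfl⟩

theorem IsSplit.radialVar_eq (h : IsSplit p q s t) :
    radialVar p q = (1 / 4 : ℂ) • ((weylF p q).rsq s * (weylF p q).rsq t) := by
  rcases h with ⟨rfl, rfl⟩ | ⟨rfl, rfl⟩
  · rw [radialVar, rxSq_eq, rySq_eq]
  · rw [radialVar, rxSq_eq, rySq_eq, mul_comm]

theorem IsSplit.D_radial (h : IsSplit p q s t) {a : Fin p ⊕ Fin q} (ha : a ∈ s) (c : ℕ → ℂ) :
    (weylF p q).D a (radial p q c) = (1 / 2 : ℂ) • ((weylF p q).X a * (weylF p q).rsq t *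
      radial p q fun n => (n + 1) * c (n + 1)) := by
  rw [_root_.D_radial, h.radialVar_eq, Derivation.map_smul, WeylData.D_mul, WeylData.D_rsq,
    WeylData.D_rsq, if_pos ha, if_neg (Finset.disjoint_left.1 h.disjoint ha), mul_zero, add_zero,
    mul_assoc, ← WeylData.two_smul_eq, smul_smul, smul_mul_assoc]
  norm_num

/-- The variable `u` is homogeneous of degree two in each group of variables, so `E` acts on `u^n`
by `2n`. -/
theorem IsSplit.eul_radial (h : IsSplit p q s t) (c : ℕ → ℂ) :
    (weylF p q).eul s (radial p q c) = radial p q fun n => 2 * n * c n := by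
  have h1 : (weylF p q).eul s (radial p q c) = (2 : ℂ) • (radialVar p q *
      radial p q fun n => (n + 1) * c (n + 1)) := by
    rw [WeylData.eul_apply, h.radialVar_eq, WeylData.rsq, Finset.sum_mul, Finset.smul_sum,
      Finset.sum_mul, Finset.smul_sum]
    refine Finset.sum_congr rfl fun a ha => ?_
    rw [h.D_radial ha, mul_smul_comm, smul_mul_assoc, smul_smul,
      show (2 : ℂ) * (1 / 4) = 1 / 2 by norm_num]
    congr 1
    ring
  rw [h1, radialVar_mul_radial, ← radial_smul]
  congr 1
  ext n
  cases n with
  | zero => simp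
  | succ n => simp; ring

/-- The Laplacian of a harmonic function times a radial series. -/
theorem IsSplit.lap_mul_radial (h : IsSplit p q s t) {f : FormalFn p q} {k : ℂ}
    (h0 : (weylF p q).lap s f = 0) (hk : (weylF p q).eul s f = k • f) (c : ℕ → ℂ) :
    (weylF p q).lap s (f * radial p q c) = (weylF p q).rsq t * (f *
      radial p q fun n => (n + 1) * (n + k + s.card / 2) * c (n + 1)) := by
  set d : ℕ → ℂ := fun n => (n + 1) * c (n + 1) with hd
  have h1 : ∑ a ∈ s, (weylF p q).D a f * (weylF p q).D a (radial p q c) =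
      (k / 2) • ((weylF p q).rsq t * (f * radial p q d)) := by
    have : (k / 2) • ((weylF p q).rsq t * (f * radial p q d)) =
        (1 / 2 : ℂ) • ((weylF p q).rsq t * ((weylF p q).eul s f * radial p q d)) := by
      rw [hk, smul_mul_assoc, mul_smul_comm, smul_smul]
      congr 1
      ring
    rw [this, WeylData.eul_apply, Finset.sum_mul, Finset.mul_sum, Finset.smul_sum]
    refine Finset.sum_congr rfl fun a ha => ?_
    rw [h.D_radial ha, mul_smul_comm]
    congr 1
    ring
  have h2 : (weylF p q).lap s (radial p q c) =
      (1 / 2 : ℂ) • ((weylF p q).rsq t * ((s.card : ℂ) • radial p q d +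
        (weylF p q).eul s (radial p q d))) := by
    have h3 : ((s.card : ℂ) • radial p q d) = ∑ a ∈ s, radial p q d := by
      rw [Finset.sum_const, Nat.cast_smul_eq_nsmul]
    rw [h3, WeylData.eul_apply, WeylData.lap_apply, ← Finset.sum_add_distrib, Finset.mul_sum,
      Finset.smul_sum]
    refine Finset.sum_congr rfl fun a ha => ?_
    rw [h.D_radial ha, Derivation.map_smul, mul_assoc, WeylData.D_X_mul, if_pos rfl,
      WeylData.D_mul, WeylData.D_rsq, if_neg (Finset.disjoint_left.1 h.disjoint ha)]
    congr 1
    ring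
  -- These are the coefficients of `u R'' + (k + |s|/2) R'`, where `R = ∑ c_n u^n` and `d` gives
  -- `R'`.
  have h4 : (radial p q fun n => (n + 1) * (n + k + s.card / 2) * c (n + 1)) =
      k • radial p q d + (1 / 2 : ℂ) • ((s.card : ℂ) • radial p q d +
        (weylF p q).eul s (radial p q d)) := by
    rw [h.eul_radial]
    simp only [← radial_smul, ← radial_add]
    congr 1
    ext n
    simp [hd]
    ring
  rw [WeylData.lap_mul, h0, h1, h2, h4, zero_mul, zero_add, ← WeylData.two_smul_eq]
  simp only [mul_add, mul_smul_comm, mul_left_comm f]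
  module

theorem IsSplit.eul_mul_radial (h : IsSplit p q s t) {f : FormalFn p q} {k : ℂ}
    (hk : (weylF p q).eul s f = k • f) (c : ℕ → ℂ) :
    (weylF p q).eul s (f * radial p q c) = f * radial p q fun n => (k + 2 * n) * c n := by
  have : (radial p q fun n => (k + 2 * n) * c n) =
      k • radial p q c + radial p q fun n => 2 * n * c n := by
    rw [← radial_smul, ← radial_add]
    congr 1
    ext n
    simp
    ring
  rw [WeylData.eul_mul, hk, h.eul_radial, this, mul_add, smul_mul_assoc, mul_smul_comm]

/-- The Casimir operator acts on `f R`, with `f` harmonic and `R` radial, through `f`. -/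
theorem IsSplit.cas_mul_radial (h : IsSplit p q s t) {f : FormalFn p q} {k : ℂ}
    (h0 : (weylF p q).lap s f = 0) (hk : (weylF p q).eul s f = k • f) (c : ℕ → ℂ) :
    (weylF p q).cas s (f * radial p q c) = -(k * (k + s.card - 2)) • (f * radial p q c) := by
  have h1 : ∀ d : ℕ → ℂ, (weylF p q).rsq s * ((weylF p q).rsq t * (f * radial p q d)) =
      f * radial p q (fun n => Nat.casesOn n 0 fun n => 4 * d n) := fun d => by
    have h2 : (radial p q (fun n => Nat.casesOn n 0 fun n => 4 * d n)) =
        (4 : ℂ) • (radialVar p q * radial p q d) := by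
      rw [radialVar_mul_radial, ← radial_smul]
      congr 1
      ext n
      cases n <;> simp
    rw [h2, h.radialVar_eq, smul_mul_assoc, smul_smul]
    norm_num
    ring
  rw [WeylData.cas_apply, h.lap_mul_radial h0 hk, h.eul_mul_radial hk, h.eul_mul_radial hk, h1]
  simp only [← mul_smul_comm, ← radial_smul, ← mul_sub, ← radial_sub]
  -- On coefficients, with `d = |s|`: `4n(n - 1 + k + d/2) - (k + 2n)² - (d - 2)(k + 2n) = -k(k + d
  -- - 2)`. All terms in `n` cancel, so the Bessel equation plays no role.
  congr 2
  ext n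
  cases n with
  | zero => simp; ring
  | succ n => simp; ring

end Radial

/-! ### The Bessel series `Ψ_α`: differential equation and derivative -/

section Bessel

theorem ascPochhammer_eval_ne_zero {α : ℂ} (hα : ∀ n : ℕ, α ≠ -(n : ℂ)) (n : ℕ) :
    (ascPochhammer ℂ n).eval α ≠ 0 := by
  induction n with
  | zero => simp
  | succ n ih =>
    rw [ascPochhammer_succ_eval]
    exact mul_ne_zero ih fun h => hα n (by linear_combination h)

/-- Coefficient form of the differential equation `u Ψ_α'' + α Ψ_α' + Ψ_α = 0`. -/
theorem besselCoeff_succ {α : ℂ} (hα : ∀ n : ℕ, α ≠ -(n : ℂ)) (n : ℕ) :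
    (n + 1) * (n + α) * besselCoeff α (n + 1) = -besselCoeff α n := by
  have h1 := ascPochhammer_eval_ne_zero hα n
  have h2 : α + n ≠ 0 := fun h => hα n (by linear_combination h)
  have h3 : (n.factorial : ℂ) ≠ 0 := by exact_mod_cast n.factorial_ne_zero
  have h4 : (n : ℂ) + 1 ≠ 0 := Nat.cast_add_one_ne_zero n
  rw [besselCoeff, besselCoeff, ascPochhammer_succ_eval, Nat.factorial_succ]
  push_cast
  field_simp
  ring

theorem besselCoeff_add_one {α : ℂ} (hα : ∀ n : ℕ, α ≠ -(n : ℂ)) (n : ℕ) :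
    (α + n) * besselCoeff (α + 1) n = α * besselCoeff α n := by
  have h0 : α ≠ 0 := by simpa using hα 0
  have h1 := ascPochhammer_eval_ne_zero hα n
  have h2 : α + n ≠ 0 := fun h => hα n (by linear_combination h)
  have h5 : ∀ n : ℕ, α + 1 ≠ -(n : ℂ) := fun n h => hα (n + 1) (by
    push_cast; linear_combination h)
  have h1' := ascPochhammer_eval_ne_zero h5 n
  have h3 : (n.factorial : ℂ) ≠ 0 := by exact_mod_cast n.factorial_ne_zero
  have h4 : (ascPochhammer ℂ n).eval α * (α + n) = α * (ascPochhammer ℂ n).eval (α + 1) := by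
    rw [← ascPochhammer_succ_eval, ascPochhammer_succ_left]
    simp [Polynomial.eval_comp]
  rw [besselCoeff, besselCoeff]
  field_simp
  linear_combination h4

theorem ne_neg_natCast_of_add_one {α : ℂ} (hα : ∀ n : ℕ, α ≠ -(n : ℂ)) (n : ℕ) :
    α + 1 ≠ -(n : ℂ) := fun h => hα (n + 1) (by push_cast; linear_combination h)

variable {p q : ℕ}

/-- The relation `Ψ_α' = -(1/α) Ψ_{α+1}`: differentiation stays within the Bessel family. -/
theorem radial_deriv_bessel {α : ℂ} (hα : ∀ n : ℕ, α ≠ -(n : ℂ)) :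
    (radial p q fun n => (n + 1) * besselCoeff α (n + 1)) = (-(1 / α)) • psi p q (α + 1) := by
  rw [psi_eq_radial, ← radial_smul]
  congr 1
  ext n
  have h0 : α ≠ 0 := by simpa using hα 0
  have h2 : α + n ≠ 0 := fun h => hα n (by linear_combination h)
  have h3 := besselCoeff_succ hα n
  have h4 := besselCoeff_add_one hα n
  refine mul_left_cancel₀ h2 ?_
  have h5 : 1 / α * α = 1 := by field_simp
  rw [Pi.smul_apply, smul_eq_mul]
  linear_combination h3 + (1 / α) * h4 + besselCoeff α n * h5

theorem IsSplit.D_psi {s t : Finset (Fin p ⊕ Fin q)} (h : IsSplit p q s t) {a : Fin p ⊕ Fin q}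
    (ha : a ∈ s) {α : ℂ} (hα : ∀ n : ℕ, α ≠ -(n : ℂ)) : (weylF p q).D a (psi p q α) =
      (-(1 / (2 * α))) • ((weylF p q).X a * ((weylF p q).rsq t * psi p q (α + 1))) := by
  rw [psi_eq_radial, h.D_radial ha, radial_deriv_bessel hα, mul_smul_comm, smul_smul, mul_assoc]
  congr 1
  field_simp

/-- For `f` harmonic of degree `k`, the function `f ψ_{k + d/2}` is an eigenfunction-like solution
of `Δ = -r²`. -/
theorem IsSplit.lap_mul_psi {s t : Finset (Fin p ⊕ Fin q)} (h : IsSplit p q s t)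
    {f : FormalFn p q} {k : ℂ} (h0 : (weylF p q).lap s f = 0)
    (hk : (weylF p q).eul s f = k • f) {α : ℂ} (hα : ∀ n : ℕ, α ≠ -(n : ℂ))
    (hαk : α = k + s.card / 2) :
    (weylF p q).lap s (f * psi p q α) = -((weylF p q).rsq t * (f * psi p q α)) := by
  rw [psi_eq_radial, h.lap_mul_radial h0 hk]
  have : (radial p q fun n => (n + 1) * (n + k + s.card / 2) * besselCoeff α (n + 1)) =
      (-1 : ℂ) • radial p q (besselCoeff α) := by
    rw [← radial_smul]
    congr 1
    ext n
    have := besselCoeff_succ hα n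
    rw [Pi.smul_apply, smul_eq_mul, neg_one_mul, ← this, hαk]
    ring
  rw [this, mul_smul_comm, mul_smul_comm, neg_one_smul]

end Bessel

/-! ### Harmonic polynomials under derivatives and coordinates -/

section Harmonic

/-- The coordinates and partial derivatives on polynomials. -/
def weylP (n : ℕ) : WeylData (Fin n) (MvPolynomial (Fin n) ℂ) where
  X := MvPolynomial.X
  D := MvPolynomial.pderiv
  D_X a b := by
    rw [MvPolynomial.pderiv_X, Pi.single_apply]
    simp [eq_comm]
  D_comm a b f := by
    let d (a : Fin n) : Derivation ℂ (MvPolynomial (Fin n) ℂ) (MvPolynomial (Fin n) ℂ) :=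
      MvPolynomial.pderiv a
    have h : ⁅d a, d b⁆ = 0 := by
      refine MvPolynomial.derivation_ext fun i => ?_
      simp only [d]
      rw [Derivation.commutator_apply, MvPolynomial.pderiv_X, MvPolynomial.pderiv_X,
        Pi.single_apply, Pi.single_apply]
      split_ifs <;> simp
    have h2 := congrArg (fun D => D f) h
    simpa [d, Derivation.commutator_apply, sub_eq_zero] using h2

variable {n k : ℕ}

theorem mem_harmonicPoly_iff {h : MvPolynomial (Fin n) ℂ} :
    h ∈ harmonicPoly n k ↔ h.IsHomogeneous k ∧ (weylP n).lap Finset.univ h = 0 := by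
  rw [harmonicPoly, Submodule.mem_inf, MvPolynomial.mem_homogeneousSubmodule, LinearMap.mem_ker,
    WeylData.lap_apply]
  simp [LinearMap.sum_apply, pow_two, weylP]

theorem MvPolynomial.IsHomogeneous.eul {h : MvPolynomial (Fin n) ℂ} (hh : h.IsHomogeneous k) :
    (weylP n).eul Finset.univ h = (k : ℂ) • h := by
  rw [WeylData.eul_apply, Nat.cast_smul_eq_nsmul, ← hh.sum_X_mul_pderiv]
  rfl

/-- Partial derivatives commute with `Δ`. For `k = 0` the derivative is zero, so the truncated
degree is harmless. -/
theorem pderiv_mem_harmonicPoly {h : MvPolynomial (Fin n) ℂ} (hh : h ∈ harmonicPoly n k)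
    (i : Fin n) : MvPolynomial.pderiv i h ∈ harmonicPoly n (k - 1) := by
  rw [mem_harmonicPoly_iff] at hh ⊢
  refine ⟨hh.1.pderiv, ?_⟩
  rw [show MvPolynomial.pderiv i h = (weylP n).D i h from rfl, WeylData.lap_D, hh.2, map_zero]

theorem MvPolynomial.IsHomogeneous.rsq_mul {h : MvPolynomial (Fin n) ℂ} (hh : h.IsHomogeneous k) :
    ((weylP n).rsq Finset.univ * h).IsHomogeneous (k + 2) := by
  rw [add_comm]
  refine MvPolynomial.IsHomogeneous.mul ?_ hh
  exact MvPolynomial.IsHomogeneous.sum _ _ _ fun i _ => (MvPolynomial.isHomogeneous_X ℂ i).pow 2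

/-- `x_i h` is a harmonic polynomial plus a multiple of `r² ∂_i h`. -/
theorem exists_X_mul_eq_of_mem_harmonicPoly (hn : 3 ≤ n) {h : MvPolynomial (Fin n) ℂ}
    (hh : h ∈ harmonicPoly n k) (i : Fin n) : ∃ h' ∈ harmonicPoly n (k + 1), ∃ c : ℂ,
      MvPolynomial.X i * h = h' + c • ((weylP n).rsq Finset.univ * MvPolynomial.pderiv i h) := by
  have hne : (2 * k + n - 2 : ℂ) ≠ 0 := by
    obtain ⟨r, rfl⟩ := Nat.exists_eq_add_of_le hn
    have : ((2 * k + r + 1 : ℕ) : ℂ) ≠ 0 := Nat.cast_ne_zero.2 (by omega)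
    push_cast at this ⊢
    intro h
    exact this (by linear_combination h)
  have hh' := mem_harmonicPoly_iff.1 hh
  refine ⟨MvPolynomial.X i * h - (1 / (2 * k + n - 2) : ℂ) •
    ((weylP n).rsq Finset.univ * MvPolynomial.pderiv i h), ?_, 1 / (2 * k + n - 2), by ring⟩
  rw [mem_harmonicPoly_iff]
  constructor
  · rw [add_comm k]
    refine ((MvPolynomial.isHomogeneous_X ℂ i).mul hh'.1).sub ?_
    rw [← MvPolynomial.mem_homogeneousSubmodule]
    refine Submodule.smul_mem _ _ ?_
    rw [MvPolynomial.mem_homogeneousSubmodule]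
    -- Degree zero is separate because `k - 1 + 2` would then not be `k + 1`; the derivative of a
    -- constant vanishes anyway.
    rcases k with _ | k
    · have : MvPolynomial.pderiv i h = 0 := by
        rw [MvPolynomial.totalDegree_eq_zero_iff_eq_C.1
          (Nat.le_zero.1 hh'.1.totalDegree_le), MvPolynomial.pderiv_C]
      rw [this, mul_zero]
      exact MvPolynomial.isHomogeneous_zero _ _ _
    · have := (hh'.1.pderiv (i := i)).rsq_mul
      rwa [show k + 1 - 1 + 2 = 1 + (k + 1) by omega] at this
  · have := (weylP n).lap_X_mul_sub (Finset.mem_univ i) hh'.2 hh'.1.eul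
    rw [Finset.card_univ, Fintype.card_fin] at this
    refine (smul_eq_zero.1 ?_).resolve_left hne
    rw [← map_smul, smul_sub, smul_smul, mul_one_div_cancel hne, one_smul]
    exact this

end Harmonic

/-! ### Polynomials in one group of variables as power series -/

section Embedding

variable {p q n : ℕ}

/-- Polynomials in a group of variables as formal power series. -/
def polyIn (e : Fin n ↪ Fin p ⊕ Fin q) : MvPolynomial (Fin n) ℂ →ₐ[ℂ] FormalFn p q :=
  AlgHom.comp { MvPolynomial.coeToMvPowerSeries.ringHom with
    commutes' := fun _ => MvPolynomial.coe_C _ } (MvPolynomial.rename e)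

variable (e : Fin n ↪ Fin p ⊕ Fin q)

theorem polyIn_apply (h : MvPolynomial (Fin n) ℂ) :
    polyIn e h = (MvPolynomial.rename e h : MvPolynomial (Fin p ⊕ Fin q) ℂ) := rfl

theorem polyIn_X (i : Fin n) : polyIn e (MvPolynomial.X i) = (weylF p q).X (e i) := by
  rw [polyIn_apply, MvPolynomial.rename_X, MvPolynomial.coe_X]
  rfl

theorem D_polyIn (i : Fin n) (h : MvPolynomial (Fin n) ℂ) :
    (weylF p q).D (e i) (polyIn e h) = polyIn e (MvPolynomial.pderiv i h) := by
  rw [polyIn_apply, polyIn_apply, ← MvPolynomial.pderiv_rename e.injective]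
  exact MvPowerSeries.pderiv_coe _

theorem D_polyIn_of_notMem {a : Fin p ⊕ Fin q} (ha : a ∉ Finset.univ.map e)
    (h : MvPolynomial (Fin n) ℂ) : (weylF p q).D a (polyIn e h) = 0 := by
  have : MvPolynomial.pderiv a (MvPolynomial.rename e h) = 0 := by
    refine MvPolynomial.pderiv_eq_zero_of_notMem_vars fun h2 => ha ?_
    have := MvPolynomial.vars_rename e h h2
    obtain ⟨i, _, rfl⟩ := Finset.mem_image.1 this
    simp
  rw [polyIn_apply]
  refine (MvPowerSeries.pderiv_coe _).trans ?_
  rw [this, MvPolynomial.coe_zero]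

theorem polyIn_rsq : polyIn e ((weylP n).rsq Finset.univ) =
    (weylF p q).rsq (Finset.univ.map e) := by
  simp only [WeylData.rsq, map_sum, map_pow, Finset.sum_map]
  exact Finset.sum_congr rfl fun i _ => by rw [← polyIn_X]; rfl

theorem lap_polyIn (h : MvPolynomial (Fin n) ℂ) : (weylF p q).lap (Finset.univ.map e) (polyIn e h) =
    polyIn e ((weylP n).lap Finset.univ h) := by
  simp only [WeylData.lap_apply, map_sum, Finset.sum_map, D_polyIn]
  rfl

theorem eul_polyIn (h : MvPolynomial (Fin n) ℂ) : (weylF p q).eul (Finset.univ.map e) (polyIn e h) =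
    polyIn e ((weylP n).eul Finset.univ h) := by
  simp only [WeylData.eul_apply, map_sum, Finset.sum_map, D_polyIn, map_mul, ← polyIn_X]
  rfl

variable {e} {s : Finset (Fin p ⊕ Fin q)}

theorem eul_polyIn_mul_of_disjoint (hs : Disjoint s (Finset.univ.map e))
    (h : MvPolynomial (Fin n) ℂ) (f : FormalFn p q) :
    (weylF p q).eul s (polyIn e h * f) = polyIn e h * (weylF p q).eul s f := by
  rw [WeylData.eul_apply, WeylData.eul_apply, Finset.mul_sum]
  refine Finset.sum_congr rfl fun a ha => ?_
  rw [WeylData.D_mul, D_polyIn_of_notMem e (Finset.disjoint_left.1 hs ha)]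
  ring

theorem lap_polyIn_mul_of_disjoint (hs : Disjoint s (Finset.univ.map e))
    (h : MvPolynomial (Fin n) ℂ) (f : FormalFn p q) :
    (weylF p q).lap s (polyIn e h * f) = polyIn e h * (weylF p q).lap s f := by
  rw [WeylData.lap_apply, WeylData.lap_apply, Finset.mul_sum]
  refine Finset.sum_congr rfl fun a ha => ?_
  have := D_polyIn_of_notMem e (Finset.disjoint_left.1 hs ha) h
  rw [WeylData.D_mul, this, zero_mul, zero_add, WeylData.D_mul, this, zero_mul, zero_add]

end Embedding

/-! ### Products of harmonic polynomials in `x` and in `y` -/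

section Biharmonic

variable {p q : ℕ}

variable (p q) in
/-- Polynomials in `x` as formal power series. -/
abbrev inX : MvPolynomial (Fin p) ℂ →ₐ[ℂ] FormalFn p q := polyIn Function.Embedding.inl

variable (p q) in
/-- Polynomials in `y` as formal power series. -/
abbrev inY : MvPolynomial (Fin q) ℂ →ₐ[ℂ] FormalFn p q := polyIn Function.Embedding.inr

/-- Formal power series that are harmonic and homogeneous of degrees `k` in `x` and `l` in `y`. -/
structure IsBiharmonic (k l : ℕ) (f : FormalFn p q) : Prop where
  lap_x : (weylF p q).lap (xVars p q) f = 0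
  lap_y : (weylF p q).lap (yVars p q) f = 0
  eul_x : (weylF p q).eul (xVars p q) f = (k : ℂ) • f
  eul_y : (weylF p q).eul (yVars p q) f = (l : ℂ) • f

variable (p q) in
/-- The span of the products `h₁(x) h₂(y)` of harmonic polynomials of degrees `k` and `l`. -/
def typePoly (k l : ℕ) : Submodule ℂ (FormalFn p q) :=
  Submodule.span ℂ {f | ∃ h₁ ∈ harmonicPoly p k, ∃ h₂ ∈ harmonicPoly q l,
    f = inX p q h₁ * inY p q h₂}

theorem isBiharmonic_mul {k l : ℕ} {h₁ : MvPolynomial (Fin p) ℂ} (hh₁ : h₁ ∈ harmonicPoly p k)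
    {h₂ : MvPolynomial (Fin q) ℂ} (hh₂ : h₂ ∈ harmonicPoly q l) :
    IsBiharmonic k l (inX p q h₁ * inY p q h₂) := by
  rw [mem_harmonicPoly_iff] at hh₁ hh₂
  have hd := disjoint_xVars_yVars p q
  constructor
  · rw [mul_comm, lap_polyIn_mul_of_disjoint hd, xVars, lap_polyIn, hh₁.2, map_zero, mul_zero]
  · rw [lap_polyIn_mul_of_disjoint hd.symm, yVars, lap_polyIn, hh₂.2, map_zero, mul_zero]
  · rw [mul_comm, eul_polyIn_mul_of_disjoint hd, xVars, eul_polyIn, hh₁.1.eul, map_smul,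
      mul_smul_comm]
  · rw [eul_polyIn_mul_of_disjoint hd.symm, yVars, eul_polyIn, hh₂.1.eul, map_smul, mul_smul_comm]

theorem isBiharmonic_of_mem_typePoly {k l : ℕ} {f : FormalFn p q} (hf : f ∈ typePoly p q k l) :
    IsBiharmonic k l f := by
  induction hf using Submodule.span_induction with
  | mem f hf =>
    obtain ⟨h₁, hh₁, h₂, hh₂, rfl⟩ := hf
    exact isBiharmonic_mul hh₁ hh₂
  | zero => constructor <;> simp
  | add f g _ _ hf hg =>
    constructor
    · rw [map_add, hf.lap_x, hg.lap_x, add_zero]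
    · rw [map_add, hf.lap_y, hg.lap_y, add_zero]
    · rw [map_add, hf.eul_x, hg.eul_x, smul_add]
    · rw [map_add, hf.eul_y, hg.eul_y, smul_add]
  | smul c f _ hf =>
    constructor
    · rw [map_smul, hf.lap_x, smul_zero]
    · rw [map_smul, hf.lap_y, smul_zero]
    · rw [map_smul, hf.eul_x, smul_comm]
    · rw [map_smul, hf.eul_y, smul_comm]

end Biharmonic

/-! ### Stability of `𝓔` under coordinates and derivatives -/

section SpaceE

variable (p q : ℕ)

/-- The part of `𝓔` of type `(k, l)`. -/
def typeSpace (k l : ℕ) : Submodule ℂ (FormalFn p q) :=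
  Submodule.span ℂ {f | ∃ h₁ ∈ harmonicPoly p k, ∃ h₂ ∈ harmonicPoly q l,
    ∃ a b : ℕ, ∃ α : ℂ, (∀ n : ℕ, α ≠ -(n : ℂ)) ∧ f = inX p q h₁ * (inY p q h₂ *
      ((weylF p q).rsq (xVars p q) ^ a * ((weylF p q).rsq (yVars p q) ^ b * psi p q α)))}

/-- The part of `𝓔` of the types `(k, l)` with `k + l ≤ N`. -/
def spaceEFil (N : ℕ) : Submodule ℂ (FormalFn p q) :=
  ⨆ kl : {kl : ℕ × ℕ // kl.1 + kl.2 ≤ N}, typeSpace p q kl.1.1 kl.1.2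

variable {p q}

theorem typeSpace_le_spaceEFil {k l N : ℕ} (h : k + l ≤ N) :
    typeSpace p q k l ≤ spaceEFil p q N :=
  le_iSup (fun kl : {kl : ℕ × ℕ // kl.1 + kl.2 ≤ N} => typeSpace p q kl.1.1 kl.1.2) ⟨(k, l), h⟩

theorem spaceEFil_mono : Monotone (spaceEFil p q) := fun _ _ h =>
  iSup_le fun kl => typeSpace_le_spaceEFil (kl.2.trans h)

theorem gen_mem_typeSpace {k l : ℕ} {h₁ : MvPolynomial (Fin p) ℂ} (hh₁ : h₁ ∈ harmonicPoly p k)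
    {h₂ : MvPolynomial (Fin q) ℂ} (hh₂ : h₂ ∈ harmonicPoly q l) (a b : ℕ) {α : ℂ}
    (hα : ∀ n : ℕ, α ≠ -(n : ℂ)) : inX p q h₁ * (inY p q h₂ * ((weylF p q).rsq (xVars p q) ^ a *
      ((weylF p q).rsq (yVars p q) ^ b * psi p q α))) ∈ typeSpace p q k l :=
  Submodule.subset_span ⟨h₁, hh₁, h₂, hh₂, a, b, α, hα, rfl⟩

theorem typeSpace_le_spaceE (k l : ℕ) : typeSpace p q k l ≤ spaceE p q := by
  refine Submodule.span_le.2 ?_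
  rintro _ ⟨h₁, hh₁, h₂, hh₂, a, b, α, hα, rfl⟩
  have : inX p q h₁ * (inY p q h₂ * ((weylF p q).rsq (xVars p q) ^ a *
      ((weylF p q).rsq (yVars p q) ^ b * psi p q α))) = ((2 : ℂ) ^ a * 2 ^ b) •
      (inX p q h₁ * inY p q h₂ * ((1 / 2 : ℂ) • rxSq p q) ^ a * ((1 / 2 : ℂ) • rySq p q) ^ b *
        psi p q α) := by
    rw [rxSq_eq, rySq_eq, smul_pow, smul_pow]
    simp only [mul_smul_comm, smul_mul_assoc, smul_smul]
    rw [show (2 : ℂ) ^ a * 2 ^ b * ((1 / 2) ^ b * (1 / 2) ^ a) = 1 by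
      rw [one_div, inv_pow, inv_pow]; field_simp, one_smul]
    ring
  rw [SetLike.mem_coe, this]
  exact Submodule.smul_mem _ _
    (Submodule.subset_span ⟨k, l, h₁, hh₁, h₂, hh₂, a, b, α, hα, rfl⟩)

theorem spaceEFil_le_spaceE (N : ℕ) : spaceEFil p q N ≤ spaceE p q :=
  iSup_le fun _ => typeSpace_le_spaceE _ _

theorem exists_mem_spaceEFil {f : FormalFn p q} (hf : f ∈ spaceE p q) :
    ∃ N, f ∈ spaceEFil p q N := by
  induction hf using Submodule.span_induction with
  | mem f hf =>
    obtain ⟨k, l, h₁, hh₁, h₂, hh₂, a, b, α, hα, rfl⟩ := hf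
    refine ⟨k + l, typeSpace_le_spaceEFil le_rfl ?_⟩
    convert Submodule.smul_mem _ ((1 / 2 : ℂ) ^ a * (1 / 2) ^ b) (gen_mem_typeSpace hh₁ hh₂ a b hα)
      using 1
    rw [rxSq_eq, rySq_eq, smul_pow, smul_pow]
    simp only [mul_smul_comm, smul_mul_assoc, smul_smul]
    rw [mul_comm ((1 / 2 : ℂ) ^ b)]
    congr 1
    simp only [mul_assoc]
    rfl
  | zero => exact ⟨0, Submodule.zero_mem _⟩
  | add f g _ _ hf hg =>
    obtain ⟨N, hN⟩ := hf
    obtain ⟨N', hN'⟩ := hg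
    exact ⟨max N N', Submodule.add_mem _ (spaceEFil_mono (le_max_left _ _) hN)
      (spaceEFil_mono (le_max_right _ _) hN')⟩
  | smul c f _ hf =>
    obtain ⟨N, hN⟩ := hf
    exact ⟨N, Submodule.smul_mem _ c hN⟩

theorem map_spaceEFil_le {T : Module.End ℂ (FormalFn p q)} {d : ℕ}
    (h : ∀ k l : ℕ, ∀ h₁ ∈ harmonicPoly p k, ∀ h₂ ∈ harmonicPoly q l, ∀ a b : ℕ, ∀ α : ℂ,
      (∀ n : ℕ, α ≠ -(n : ℂ)) → T (inX p q h₁ * (inY p q h₂ * ((weylF p q).rsq (xVars p q) ^ a *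
        ((weylF p q).rsq (yVars p q) ^ b * psi p q α)))) ∈ spaceEFil p q (k + l + d))
    {N : ℕ} {f : FormalFn p q} (hf : f ∈ spaceEFil p q N) : T f ∈ spaceEFil p q (N + d) := by
  have : spaceEFil p q N ≤ (spaceEFil p q (N + d)).comap T := by
    refine iSup_le fun ⟨⟨k, l⟩, hkl⟩ => Submodule.span_le.2 ?_
    rintro _ ⟨h₁, hh₁, h₂, hh₂, a, b, α, hα, rfl⟩
    exact spaceEFil_mono (Nat.add_le_add_right hkl d) (h k l h₁ hh₁ h₂ hh₂ a b α hα)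
  exact this hf

/-- Splitting `x_i h₁` into a harmonic polynomial of degree `k + 1` and a multiple of `r_x² ∂_i h₁`
gives types `(k ± 1, l)`; the extra `r_x²` is absorbed in the exponent `a`. -/
theorem X_inl_mul_mem (hp : 3 ≤ p) (i : Fin p) {N : ℕ} {f : FormalFn p q}
    (hf : f ∈ spaceEFil p q N) : (weylF p q).X (.inl i) * f ∈ spaceEFil p q (N + 1) := by
  refine map_spaceEFil_le (T := LinearMap.mulLeft ℂ ((weylF p q).X (.inl i))) ?_ hf
  intro k l h₁ hh₁ h₂ hh₂ a b α hα
  obtain ⟨h', hh', c, hc⟩ := exists_X_mul_eq_of_mem_harmonicPoly hp hh₁ i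
  have h3 : (weylF p q).X (.inl i) * inX p q h₁ = inX p q h' +
      c • ((weylF p q).rsq (xVars p q) * inX p q (MvPolynomial.pderiv i h₁)) := by
    have := congrArg (inX p q) hc
    rw [map_mul, map_add, map_smul, map_mul, polyIn_rsq, polyIn_X] at this
    exact this
  rw [LinearMap.mulLeft_apply, ← mul_assoc, h3, add_mul, smul_mul_assoc]
  refine Submodule.add_mem _ (typeSpace_le_spaceEFil (by omega) (gen_mem_typeSpace hh' hh₂ a b hα))
    (Submodule.smul_mem _ _ (typeSpace_le_spaceEFil (k := k - 1) (l := l) (by omega) ?_))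
  convert gen_mem_typeSpace (pderiv_mem_harmonicPoly hh₁ i) hh₂ (a + 1) b hα using 1
  ring

theorem X_inr_mul_mem (hq : 3 ≤ q) (i : Fin q) {N : ℕ} {f : FormalFn p q}
    (hf : f ∈ spaceEFil p q N) : (weylF p q).X (.inr i) * f ∈ spaceEFil p q (N + 1) := by
  refine map_spaceEFil_le (T := LinearMap.mulLeft ℂ ((weylF p q).X (.inr i))) ?_ hf
  intro k l h₁ hh₁ h₂ hh₂ a b α hα
  obtain ⟨h', hh', c, hc⟩ := exists_X_mul_eq_of_mem_harmonicPoly hq hh₂ i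
  have h3 : (weylF p q).X (.inr i) * inY p q h₂ = inY p q h' +
      c • ((weylF p q).rsq (yVars p q) * inY p q (MvPolynomial.pderiv i h₂)) := by
    have := congrArg (inY p q) hc
    rw [map_mul, map_add, map_smul, map_mul, polyIn_rsq, polyIn_X] at this
    exact this
  rw [LinearMap.mulLeft_apply, mul_left_comm, ← mul_assoc _ (inY p q h₂), h3, add_mul,
    smul_mul_assoc, mul_add, mul_smul_comm]
  refine Submodule.add_mem _ (typeSpace_le_spaceEFil (by omega) (gen_mem_typeSpace hh₁ hh' a b hα))
    (Submodule.smul_mem _ _ (typeSpace_le_spaceEFil (k := k) (l := l - 1) (by omega) ?_))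
  convert gen_mem_typeSpace hh₁ (pderiv_mem_harmonicPoly hh₂ i) a (b + 1) hα using 1
  ring

theorem D_rsq_pow (s : Finset (Fin p ⊕ Fin q)) (c : Fin p ⊕ Fin q) (a : ℕ) :
    (weylF p q).D c ((weylF p q).rsq s ^ a) =
      if c ∈ s then (2 * a : ℂ) • ((weylF p q).X c * (weylF p q).rsq s ^ (a - 1)) else 0 := by
  rw [Derivation.leibniz_pow, WeylData.D_rsq]
  split_ifs with h
  · rw [smul_eq_mul, ← WeylData.two_smul_eq, mul_smul_comm, ← Nat.cast_smul_eq_nsmul ℂ, smul_smul,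
      mul_comm (2 : ℂ), mul_comm (WeylData.X _ _)]
  · simp

/-- The derivative may fall on `h₁`, on `r_x^{2a}` or on `ψ_α`. The last two cases produce a factor
`x_i`, which `X_inl_mul_mem` handles; the last one also replaces `α` by `α + 1`, a parameter that
`𝓔` admits as well. -/
theorem D_inl_mem (hp : 3 ≤ p) (i : Fin p) {N : ℕ} {f : FormalFn p q}
    (hf : f ∈ spaceEFil p q N) : (weylF p q).D (.inl i) f ∈ spaceEFil p q (N + 1) := by
  refine map_spaceEFil_le (T := ((weylF p q).D (.inl i)).toLinearMap) ?_ hf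
  intro k l h₁ hh₁ h₂ hh₂ a b α hα
  have e1 : (weylF p q).D (.inl i) (inX p q h₁) = inX p q (MvPolynomial.pderiv i h₁) :=
    D_polyIn Function.Embedding.inl i h₁
  have e2 : (weylF p q).D (.inl i) (inY p q h₂) = 0 :=
    D_polyIn_of_notMem _ (inl_notMem_yVars i) h₂
  rw [Derivation.coeFn_coe, WeylData.D_mul, WeylData.D_mul, WeylData.D_mul, WeylData.D_mul, e1, e2,
    D_rsq_pow, D_rsq_pow, if_pos (inl_mem_xVars i), if_neg (inl_notMem_yVars i),
    isSplit_xy.D_psi (inl_mem_xVars i) hα, zero_mul, zero_mul, zero_add, zero_add, mul_add, mul_add]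
  refine Submodule.add_mem _ (typeSpace_le_spaceEFil (by omega)
    (gen_mem_typeSpace (pderiv_mem_harmonicPoly hh₁ i) hh₂ a b hα)) (Submodule.add_mem _ ?_ ?_)
  · have := X_inl_mul_mem hp i (typeSpace_le_spaceEFil le_rfl
      (gen_mem_typeSpace hh₁ hh₂ (a - 1) b hα))
    convert Submodule.smul_mem _ (2 * a : ℂ) this using 1
    simp only [smul_mul_assoc, mul_smul_comm]
    congr 1
    ring
  · have := X_inl_mul_mem hp i (typeSpace_le_spaceEFil le_rfl
      (gen_mem_typeSpace hh₁ hh₂ a (b + 1) (ne_neg_natCast_of_add_one hα)))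
    convert Submodule.smul_mem _ (-(1 / (2 * α)) : ℂ) this using 1
    simp only [mul_smul_comm]
    congr 1
    ring

theorem D_inr_mem (hq : 3 ≤ q) (i : Fin q) {N : ℕ} {f : FormalFn p q}
    (hf : f ∈ spaceEFil p q N) : (weylF p q).D (.inr i) f ∈ spaceEFil p q (N + 1) := by
  refine map_spaceEFil_le (T := ((weylF p q).D (.inr i)).toLinearMap) ?_ hf
  intro k l h₁ hh₁ h₂ hh₂ a b α hα
  have e1 : (weylF p q).D (.inr i) (inX p q h₁) = 0 :=
    D_polyIn_of_notMem _ (inr_notMem_xVars i) h₁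
  have e2 : (weylF p q).D (.inr i) (inY p q h₂) = inY p q (MvPolynomial.pderiv i h₂) :=
    D_polyIn Function.Embedding.inr i h₂
  rw [Derivation.coeFn_coe, WeylData.D_mul, WeylData.D_mul, WeylData.D_mul, WeylData.D_mul, e1, e2,
    D_rsq_pow, D_rsq_pow, if_neg (inr_notMem_xVars i), if_pos (inr_mem_yVars i),
    isSplit_yx.D_psi (inr_mem_yVars i) hα, zero_mul, zero_mul, zero_add, zero_add, mul_add, mul_add,
    mul_add, mul_add]
  refine Submodule.add_mem _ (typeSpace_le_spaceEFil (by omega)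
    (gen_mem_typeSpace hh₁ (pderiv_mem_harmonicPoly hh₂ i) a b hα)) (Submodule.add_mem _ ?_ ?_)
  · have := X_inr_mul_mem hq i (typeSpace_le_spaceEFil le_rfl
      (gen_mem_typeSpace hh₁ hh₂ a (b - 1) hα))
    convert Submodule.smul_mem _ (2 * b : ℂ) this using 1
    simp only [smul_mul_assoc, mul_smul_comm]
    congr 1
    ring
  · have := X_inr_mul_mem hq i (typeSpace_le_spaceEFil le_rfl
      (gen_mem_typeSpace hh₁ hh₂ (a + 1) b (ne_neg_natCast_of_add_one hα)))
    convert Submodule.smul_mem _ (-(1 / (2 * α)) : ℂ) this using 1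
    simp only [mul_smul_comm]
    congr 1
    ring

end SpaceE

/-! ### `M⁺_m` and `M⁻_m` as isomorphic `𝔤`-submodules of `𝓔` -/

section Modules

variable {p q : ℕ}

theorem xHat_mem (hp : 3 ≤ p) (hq : 3 ≤ q) (a : Fin p ⊕ Fin q) {N : ℕ} {f : FormalFn p q}
    (hf : f ∈ spaceEFil p q N) : xHat a f ∈ spaceEFil p q (N + 1) := by
  rcases a with i | j
  · exact X_inl_mul_mem hp i hf
  · exact Submodule.smul_mem _ _ (D_inr_mem hq j hf)

theorem yHat_mem (hp : 3 ≤ p) (hq : 3 ≤ q) (a : Fin p ⊕ Fin q) {N : ℕ} {f : FormalFn p q}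
    (hf : f ∈ spaceEFil p q N) : yHat a f ∈ spaceEFil p q (N + 1) := by
  rcases a with i | j
  · exact Submodule.smul_mem _ _ (D_inl_mem hp i hf)
  · exact X_inr_mul_mem hq j hf

theorem lie_mem_spaceEFil (hp : 3 ≤ p) (hq : 3 ≤ q) (X : OrthLie p q) {N : ℕ} {f : FormalFn p q}
    (hf : f ∈ spaceEFil p q N) : ⁅X, f⁆ ∈ spaceEFil p q (N + 2) := by
  rw [lie_eq_quadForm, quadForm_apply]
  exact Submodule.smul_mem _ _ (Submodule.sum_mem _ fun a _ => Submodule.sum_mem _ fun b _ =>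
    Submodule.smul_mem _ _ (xHat_mem hp hq a (yHat_mem hp hq b hf)))

theorem lie_mem_spaceE (hp : 3 ≤ p) (hq : 3 ≤ q) (X : OrthLie p q) {f : FormalFn p q}
    (hf : f ∈ spaceE p q) : ⁅X, f⁆ ∈ spaceE p q := by
  obtain ⟨N, hN⟩ := exists_mem_spaceEFil hf
  exact spaceEFil_le_spaceE _ (lie_mem_spaceEFil hp hq X hN)

theorem opXplus_mem_spaceE (hp : 3 ≤ p) (hq : 3 ≤ q) {f : FormalFn p q}
    (hf : f ∈ spaceE p q) : opXplus p q f ∈ spaceE p q := by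
  obtain ⟨N, hN⟩ := exists_mem_spaceEFil hf
  refine spaceEFil_le_spaceE (N + 2) ?_
  rw [opXplus_apply, WeylData.lap_apply, WeylData.rsq, Finset.sum_mul, xVars, yVars,
    Finset.sum_map, Finset.sum_map]
  refine Submodule.smul_mem _ _ (Submodule.add_mem _ (Submodule.sum_mem _ fun i _ => ?_)
    (Submodule.sum_mem _ fun i _ => ?_))
  · exact D_inl_mem hp i (D_inl_mem hp i hN)
  · rw [pow_two, mul_assoc]
    exact X_inr_mul_mem hq i (X_inr_mul_mem hq i hN)

theorem opXminus_mem_spaceE (hp : 3 ≤ p) (hq : 3 ≤ q) {f : FormalFn p q}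
    (hf : f ∈ spaceE p q) : opXminus p q f ∈ spaceE p q := by
  obtain ⟨N, hN⟩ := exists_mem_spaceEFil hf
  refine spaceEFil_le_spaceE (N + 2) ?_
  rw [opXminus_apply, WeylData.lap_apply, WeylData.rsq, Finset.sum_mul, xVars, yVars,
    Finset.sum_map, Finset.sum_map]
  refine Submodule.smul_mem _ _ (Submodule.add_mem _ (Submodule.sum_mem _ fun i _ => ?_)
    (Submodule.sum_mem _ fun i _ => ?_))
  · rw [pow_two, mul_assoc]
    exact X_inl_mul_mem hp i (X_inl_mul_mem hp i hN)
  · exact D_inr_mem hq i (D_inr_mem hq i hN)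

theorem opXplus_pow_mem_spaceE (hp : 3 ≤ p) (hq : 3 ≤ q) {f : FormalFn p q}
    (hf : f ∈ spaceE p q) (n : ℕ) : (opXplus p q ^ n) f ∈ spaceE p q := by
  induction n with
  | zero => exact hf
  | succ n ih =>
    rw [pow_succ', Module.End.mul_apply]
    exact opXplus_mem_spaceE hp hq ih

theorem opXminus_pow_mem_spaceE (hp : 3 ≤ p) (hq : 3 ≤ q) {f : FormalFn p q}
    (hf : f ∈ spaceE p q) (n : ℕ) : (opXminus p q ^ n) f ∈ spaceE p q := by
  induction n with
  | zero => exact hf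
  | succ n ih =>
    rw [pow_succ', Module.End.mul_apply]
    exact opXminus_mem_spaceE hp hq ih

variable (p q) in
/-- The subspace of `𝓔` on which `H = m`, `X⁺ = 0` and `(X⁻)^(m+1) = 0`. -/
def highestSub (m : ℕ) : Submodule ℂ (FormalFn p q) :=
  spaceE p q ⊓ (opH p q).eigenspace m ⊓ LinearMap.ker (opXplus p q) ⊓
    LinearMap.ker (opXminus p q ^ (m + 1))

variable (p q) in
/-- The subspace of `𝓔` on which `H = -m`, `X⁻ = 0` and `(X⁺)^(m+1) = 0`. -/
def lowestSub (m : ℕ) : Submodule ℂ (FormalFn p q) :=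
  spaceE p q ⊓ (opH p q).eigenspace (-m) ⊓ LinearMap.ker (opXminus p q) ⊓
    LinearMap.ker (opXplus p q ^ (m + 1))

theorem mem_highestSub {m : ℕ} {f : FormalFn p q} : f ∈ highestSub p q m ↔ f ∈ spaceE p q ∧
    opH p q f = (m : ℂ) • f ∧ opXplus p q f = 0 ∧ (opXminus p q ^ (m + 1)) f = 0 := by
  simp only [highestSub, Submodule.mem_inf, Module.End.mem_eigenspace_iff, LinearMap.mem_ker,
    and_assoc]

theorem mem_lowestSub {m : ℕ} {f : FormalFn p q} : f ∈ lowestSub p q m ↔ f ∈ spaceE p q ∧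
    opH p q f = (-(m : ℂ)) • f ∧ opXminus p q f = 0 ∧ (opXplus p q ^ (m + 1)) f = 0 := by
  simp only [lowestSub, Submodule.mem_inf, Module.End.mem_eigenspace_iff, LinearMap.mem_ker,
    and_assoc]

theorem neg_opH_opXplus (f : FormalFn p q) :
    (-opH p q) (opXplus p q f) = opXplus p q ((-opH p q) f) - (2 : ℂ) • opXplus p q f := by
  rw [LinearMap.neg_apply, LinearMap.neg_apply, opH_opXplus, map_neg]
  abel

theorem opXminus_opXplus (f : FormalFn p q) :
    opXminus p q (opXplus p q f) = opXplus p q (opXminus p q f) + (-opH p q) f := by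
  rw [opXplus_opXminus, LinearMap.neg_apply]
  abel

theorem neg_opH_of_eq {m : ℕ} {f : FormalFn p q} (h : opH p q f = (-(m : ℂ)) • f) :
    (-opH p q) f = (m : ℂ) • f := by
  rw [LinearMap.neg_apply, h, neg_smul, neg_neg]

/-- The nonvanishing of `(X⁻)^j f` for `j ≤ m` is automatic when `f ≠ 0`, since `(X⁺)^j (X⁻)^j f` is
a nonzero multiple of `f`. Hence the defining conditions are linear once zero is added. -/
theorem coe_highestSub (m : ℕ) :
    (highestSub p q m : Set (FormalFn p q)) = insert 0 (plusVectors p q m) := by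
  ext f
  rw [SetLike.mem_coe, Set.mem_insert_iff]
  constructor
  · intro hf
    refine or_iff_not_imp_left.2 fun h0 => ?_
    obtain ⟨h1, h2, h3, h4⟩ := mem_highestSub.1 hf
    refine ⟨h1, h2, h3, fun j _ hj hz => h0 ?_, h4⟩
    have := slTwo_e_pow_f_pow opXplus_opXminus opH_opXminus h2 h3 j
    rw [hz, map_zero] at this
    exact (smul_eq_zero.1 this.symm).resolve_left (slTwo_prod_ne_zero hj)
  · rintro (rfl | ⟨h1, h2, h3, _, h4⟩)
    · exact Submodule.zero_mem _
    · exact mem_highestSub.2 ⟨h1, h2, h3, h4⟩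

theorem coe_lowestSub (m : ℕ) :
    (lowestSub p q m : Set (FormalFn p q)) = insert 0 (minusVectors p q m) := by
  ext f
  rw [SetLike.mem_coe, Set.mem_insert_iff]
  constructor
  · intro hf
    refine or_iff_not_imp_left.2 fun h0 => ?_
    obtain ⟨h1, h2, h3, h4⟩ := mem_lowestSub.1 hf
    refine ⟨h1, h2, h3, fun j _ hj hz => h0 ?_, h4⟩
    have := slTwo_e_pow_f_pow opXminus_opXplus neg_opH_opXplus (neg_opH_of_eq h2) h3 j
    rw [hz, map_zero] at this
    exact (smul_eq_zero.1 this.symm).resolve_left (slTwo_prod_ne_zero hj)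
  · rintro (rfl | ⟨h1, h2, h3, _, h4⟩)
    · exact Submodule.zero_mem _
    · exact mem_lowestSub.2 ⟨h1, h2, h3, h4⟩

theorem lie_mem_highestSub (hp : 3 ≤ p) (hq : 3 ≤ q) {m : ℕ} (X : OrthLie p q) {f : FormalFn p q}
    (hf : f ∈ highestSub p q m) : ⁅X, f⁆ ∈ highestSub p q m := by
  obtain ⟨h1, h2, h3, h4⟩ := mem_highestSub.1 hf
  exact mem_highestSub.2 ⟨lie_mem_spaceE hp hq X h1, by rw [opH_lie, h2, lie_smul],
    by rw [opXplus_lie, h3, lie_zero], by rw [opXminus_pow_lie, h4, lie_zero]⟩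

theorem lie_mem_lowestSub (hp : 3 ≤ p) (hq : 3 ≤ q) {m : ℕ} (X : OrthLie p q) {f : FormalFn p q}
    (hf : f ∈ lowestSub p q m) : ⁅X, f⁆ ∈ lowestSub p q m := by
  obtain ⟨h1, h2, h3, h4⟩ := mem_lowestSub.1 hf
  exact mem_lowestSub.2 ⟨lie_mem_spaceE hp hq X h1, by rw [opH_lie, h2, lie_smul],
    by rw [opXminus_lie, h3, lie_zero], by rw [opXplus_pow_lie, h4, lie_zero]⟩

/-- Shows that passing to the generated `𝔤`-submodule adds nothing but zero to the defining vectors.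
-/
theorem toSubmodule_lieSpan_eq {M : Submodule ℂ (FormalFn p q)} {S : Set (FormalFn p q)}
    (hM : (M : Set (FormalFn p q)) = insert 0 S)
    (hlie : ∀ (X : OrthLie p q), ∀ f ∈ M, ⁅X, f⁆ ∈ M) :
    (LieSubmodule.lieSpan ℂ (OrthLie p q) S : Set (FormalFn p q)) = M := by
  refine Set.Subset.antisymm ?_ ?_
  · let M' : LieSubmodule ℂ (OrthLie p q) (FormalFn p q) := { M with lie_mem := hlie _ _ }
    have : LieSubmodule.lieSpan ℂ (OrthLie p q) S ≤ M' :=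
      LieSubmodule.lieSpan_le.2 fun f hf => by
        change f ∈ (M : Set (FormalFn p q))
        rw [hM]
        exact Set.mem_insert_of_mem _ hf
    exact this
  · rw [hM, Set.insert_subset_iff]
    exact ⟨LieSubmodule.zero_mem _, LieSubmodule.subset_lieSpan⟩

theorem mem_Mplus_iff (hp : 3 ≤ p) (hq : 3 ≤ q) {m : ℕ} {f : FormalFn p q} :
    f ∈ Mplus p q m ↔ f ∈ highestSub p q m := by
  have := toSubmodule_lieSpan_eq (coe_highestSub (p := p) (q := q) m)
    fun X f hf => lie_mem_highestSub hp hq X hf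
  exact Set.ext_iff.1 this f

theorem mem_Mminus_iff (hp : 3 ≤ p) (hq : 3 ≤ q) {m : ℕ} {f : FormalFn p q} :
    f ∈ Mminus p q m ↔ f ∈ lowestSub p q m := by
  have := toSubmodule_lieSpan_eq (coe_lowestSub (p := p) (q := q) m)
    fun X f hf => lie_mem_lowestSub hp hq X hf
  exact Set.ext_iff.1 this f

theorem opXminus_pow_mem_lowestSub (hp : 3 ≤ p) (hq : 3 ≤ q) {m : ℕ} {f : FormalFn p q}
    (hf : f ∈ highestSub p q m) : (opXminus p q ^ m) f ∈ lowestSub p q m := by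
  obtain ⟨h1, h2, h3, h4⟩ := mem_highestSub.1 hf
  refine mem_lowestSub.2 ⟨opXminus_pow_mem_spaceE hp hq h1 m, ?_, ?_, ?_⟩
  · rw [slTwo_h_pow opH_opXminus h2]
    congr 1
    ring
  · rwa [← Module.End.mul_apply, ← pow_succ']
  · rw [pow_succ', Module.End.mul_apply, slTwo_e_pow_f_pow opXplus_opXminus opH_opXminus h2 h3,
      map_smul, h3, smul_zero]

theorem opXplus_pow_mem_highestSub (hp : 3 ≤ p) (hq : 3 ≤ q) {m : ℕ} {f : FormalFn p q}
    (hf : f ∈ lowestSub p q m) : (opXplus p q ^ m) f ∈ highestSub p q m := by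
  obtain ⟨h1, h2, h3, h4⟩ := mem_lowestSub.1 hf
  have h2' := neg_opH_of_eq h2
  refine mem_highestSub.2 ⟨opXplus_pow_mem_spaceE hp hq h1 m, ?_, ?_, ?_⟩
  · have := slTwo_h_pow neg_opH_opXplus h2' m
    rw [LinearMap.neg_apply, neg_eq_iff_eq_neg] at this
    rw [this, ← neg_smul]
    congr 1
    ring
  · rwa [← Module.End.mul_apply, ← pow_succ']
  · rw [pow_succ', Module.End.mul_apply, slTwo_e_pow_f_pow opXminus_opXplus neg_opH_opXplus h2' h3,
      map_smul, h3, smul_zero]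

/-- The `𝔤`-modules `M⁺_m` and `M⁻_m` are isomorphic through `(X⁻)^m`. -/
def MplusEquivMminus (hp : 3 ≤ p) (hq : 3 ≤ q) (m : ℕ) :
    Mplus p q m ≃ₗ⁅ℂ,OrthLie p q⁆ Mminus p q m :=
  { toFun := fun f => ⟨(opXminus p q ^ m) f.1,
      (mem_Mminus_iff hp hq).2 (opXminus_pow_mem_lowestSub hp hq ((mem_Mplus_iff hp hq).1 f.2))⟩
    map_add' := fun f g => Subtype.ext (map_add _ _ _)
    map_smul' := fun c f => Subtype.ext (map_smul _ _ _)
    map_lie' := fun {X f} => Subtype.ext (opXminus_pow_lie m X f.1)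
    -- The product is `(m!)²`, the scalar by which `(X⁺)^m (X⁻)^m` acts on highest weight vectors of
    -- weight `m`.
    invFun := fun f => ⟨(∏ i ∈ Finset.range m, (((i : ℂ) + 1) * ((m : ℂ) - i)))⁻¹ •
        (opXplus p q ^ m) f.1, (mem_Mplus_iff hp hq).2 (Submodule.smul_mem _ _
          (opXplus_pow_mem_highestSub hp hq ((mem_Mminus_iff hp hq).1 f.2)))⟩
    left_inv := fun f => Subtype.ext <| by
      obtain ⟨_, h2, h3, _⟩ := mem_highestSub.1 ((mem_Mplus_iff hp hq).1 f.2)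
      change _ • (opXplus p q ^ m) ((opXminus p q ^ m) f.1) = f.1
      rw [slTwo_e_pow_f_pow opXplus_opXminus opH_opXminus h2 h3,
        inv_smul_smul₀ (slTwo_prod_ne_zero le_rfl)]
    right_inv := fun f => Subtype.ext <| by
      obtain ⟨_, h2, h3, _⟩ := mem_lowestSub.1 ((mem_Mminus_iff hp hq).1 f.2)
      change (opXminus p q ^ m) (_ • (opXplus p q ^ m) f.1) = f.1
      rw [map_smul, slTwo_e_pow_f_pow opXminus_opXplus neg_opH_opXplus (neg_opH_of_eq h2) h3,
        inv_smul_smul₀ (slTwo_prod_ne_zero le_rfl)] }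

end Modules

/-! ### Order in the variables `x` and uniqueness from the lowest term -/

section XOrder

variable {p q : ℕ}

/-- The degree in the variables `x` of a monomial. -/
def xDeg (d : Fin p ⊕ Fin q →₀ ℕ) : ℕ := ∑ i : Fin p, d (.inl i)

theorem xDeg_add (d e : Fin p ⊕ Fin q →₀ ℕ) : xDeg (d + e) = xDeg d + xDeg e := by
  simp [xDeg, Finset.sum_add_distrib]

variable (p q) in
/-- The formal power series of order at least `n` in the variables `x`. -/
def xOrd (n : ℕ) : Submodule ℂ (FormalFn p q) where
  carrier := {f | ∀ d, xDeg d < n → MvPowerSeries.coeff d f = 0}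
  add_mem' hf hg d hd := by rw [map_add, hf d hd, hg d hd, add_zero]
  zero_mem' d _ := by simp
  smul_mem' c f hf d hd := by rw [map_smul, hf d hd, smul_zero]

theorem xOrd_anti {m n : ℕ} (h : m ≤ n) : xOrd p q n ≤ xOrd p q m := fun _ hf d hd =>
  hf d (hd.trans_le h)

theorem mul_mem_xOrd {m n : ℕ} {f g : FormalFn p q} (hf : f ∈ xOrd p q m) (hg : g ∈ xOrd p q n) :
    f * g ∈ xOrd p q (m + n) := by
  intro d hd
  rw [MvPowerSeries.coeff_mul]
  refine Finset.sum_eq_zero fun e he => ?_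
  rw [Finset.HasAntidiagonal.mem_antidiagonal] at he
  rw [← he, xDeg_add] at hd
  rcases lt_or_ge (xDeg e.1) m with h | h
  · rw [hf _ h, zero_mul]
  · rw [hg _ (by omega), mul_zero]

theorem mem_xOrd_zero (f : FormalFn p q) : f ∈ xOrd p q 0 := fun _ hd =>
  absurd hd (Nat.not_lt_zero _)

theorem mul_mem_xOrd_right {n : ℕ} (g : FormalFn p q) {f : FormalFn p q} (hf : f ∈ xOrd p q n) :
    g * f ∈ xOrd p q n := by
  simpa using mul_mem_xOrd (mem_xOrd_zero g) hf

theorem mul_mem_xOrd_left {n : ℕ} {f : FormalFn p q} (hf : f ∈ xOrd p q n) (g : FormalFn p q) :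
    f * g ∈ xOrd p q n := mul_mem_xOrd hf (mem_xOrd_zero g)

theorem X_inl_mem_xOrd (i : Fin p) : (weylF p q).X (.inl i) ∈ xOrd p q 1 := by
  intro d hd
  change MvPowerSeries.coeff d (MvPowerSeries.X _) = 0
  classical
  rw [MvPowerSeries.coeff_X, if_neg]
  rintro rfl
  simp [xDeg, Finsupp.single_apply] at hd

theorem rsq_x_mem_xOrd : (weylF p q).rsq (xVars p q) ∈ xOrd p q 2 := by
  rw [WeylData.rsq, xVars, Finset.sum_map]
  refine Submodule.sum_mem _ fun i _ => ?_
  rw [pow_two]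
  exact mul_mem_xOrd (X_inl_mem_xOrd i) (X_inl_mem_xOrd i)

theorem D_inr_mem_xOrd (j : Fin q) {n : ℕ} {f : FormalFn p q} (hf : f ∈ xOrd p q n) :
    (weylF p q).D (.inr j) f ∈ xOrd p q n := by
  intro d hd
  refine (MvPowerSeries.coeff_pderiv f d).trans ?_
  rw [hf, zero_mul]
  rw [xDeg_add]
  simpa [xDeg, Finsupp.single_apply] using hd

theorem lap_y_mem_xOrd {n : ℕ} {f : FormalFn p q} (hf : f ∈ xOrd p q n) :
    (weylF p q).lap (yVars p q) f ∈ xOrd p q n := by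
  rw [WeylData.lap_apply, yVars, Finset.sum_map]
  exact Submodule.sum_mem _ fun j _ => D_inr_mem_xOrd j (D_inr_mem_xOrd j hf)

theorem coeff_X_mul_pderiv {σ : Type*} [DecidableEq σ] (a : σ) (f : MvPowerSeries σ ℂ)
    (d : σ →₀ ℕ) : MvPowerSeries.coeff d (MvPowerSeries.X a * MvPowerSeries.pderiv ℂ a f) =
      d a * MvPowerSeries.coeff d f := by
  rw [MvPowerSeries.X, MvPowerSeries.coeff_monomial_mul]
  split_ifs with h
  · rw [MvPowerSeries.coeff_pderiv, tsub_add_cancel_of_le h, Finsupp.tsub_apply,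
      Finsupp.single_eq_same, one_mul, mul_comm]
    have h1 : 1 ≤ d a := by simpa using h a
    rw [Nat.cast_sub h1]
    simp
  · have : d a = 0 := by
      by_contra h0
      exact h (Finsupp.single_le_iff.2 (Nat.one_le_iff_ne_zero.2 h0))
    simp [this]

theorem coeff_eul_x (f : FormalFn p q) (d : Fin p ⊕ Fin q →₀ ℕ) :
    MvPowerSeries.coeff d ((weylF p q).eul (xVars p q) f) =
      (xDeg d : ℂ) * MvPowerSeries.coeff d f := by
  rw [WeylData.eul_apply, xVars, Finset.sum_map, map_sum, xDeg, Nat.cast_sum, Finset.sum_mul]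
  exact Finset.sum_congr rfl fun i _ => coeff_X_mul_pderiv _ f d

/-- The Euler operator is diagonal on monomials with eigenvalue the degree in `x`, so only monomials
of degree `k` can occur. -/
theorem mem_xOrd_of_eul_x {k : ℕ} {f : FormalFn p q}
    (h : (weylF p q).eul (xVars p q) f = (k : ℂ) • f) : f ∈ xOrd p q k := by
  intro d hd
  have h1 := congrArg (MvPowerSeries.coeff d) h
  rw [coeff_eul_x, map_smul, smul_eq_mul, ← sub_eq_zero, ← sub_mul, mul_eq_zero, sub_eq_zero,
    Nat.cast_inj] at h1
  exact h1.resolve_left hd.ne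

theorem eq_zero_of_eul_x {k : ℕ} {f : FormalFn p q}
    (h : (weylF p q).eul (xVars p q) f = (k : ℂ) • f) (h2 : f ∈ xOrd p q (k + 1)) : f = 0 := by
  ext d
  rcases lt_or_ge (xDeg d) (k + 1) with hd | hd
  · exact h2 d hd
  · have h1 := congrArg (MvPowerSeries.coeff d) h
    rw [coeff_eul_x, map_smul, smul_eq_mul, ← sub_eq_zero, ← sub_mul, mul_eq_zero, sub_eq_zero,
      Nat.cast_inj] at h1
    exact h1.resolve_left (by omega)

/-- A Casimir eigenfunction of degree `k` killed by `X⁺` is determined by its part of degree `k`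
in the variables `x`. -/
theorem eq_zero_of_opXplus_of_cas (hp : 3 ≤ p) {k : ℕ} {f : FormalFn p q} (hX : opXplus p q f = 0)
    (hc : (weylF p q).cas (xVars p q) f = -((k : ℂ) * (k + p - 2)) • f)
    (ho : f ∈ xOrd p q (k + 1)) : f = 0 := by
  have hlap : (weylF p q).lap (xVars p q) f = -((weylF p q).rsq (yVars p q) * f) := by
    rw [opXplus_apply] at hX
    exact eq_neg_of_add_eq_zero_left ((smul_eq_zero.1 hX).resolve_left (by norm_num))
  have key : ∀ n, f ∈ xOrd p q (k + 1 + n) := by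
    intro n
    induction n with
    | zero => exact ho
    | succ n ih =>
      -- Here `r_x² Δ_x f = -r_x² r_y² f` has order two more than `f`, so it does not contribute to
      -- the lowest degree of the Casimir equation.
      have h1 : (weylF p q).rsq (xVars p q) * (weylF p q).lap (xVars p q) f ∈
          xOrd p q (k + 1 + n + 2) := by
        rw [hlap, add_comm (k + 1 + n)]
        exact mul_mem_xOrd rsq_x_mem_xOrd (Submodule.neg_mem _ (mul_mem_xOrd_right _ ih))
      intro d hd
      rcases lt_or_ge (xDeg d) (k + 1 + n) with hd' | hd'
      · exact ih d hd'
      · have hdeg : xDeg d = k + 1 + n := by omega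
        have h2 := congrArg (MvPowerSeries.coeff d) hc
        rw [WeylData.cas_apply, map_sub, map_sub, map_smul, map_smul, h1 d (by omega), coeff_eul_x,
          coeff_eul_x, card_xVars, smul_eq_mul, smul_eq_mul, hdeg] at h2
        -- For `d = k + 1 + n`, the difference `d(d + p - 2) - k(k + p - 2)` factors as `(n + 1)(2k
        -- + n + p - 1)`, which is nonzero.
        have h3 : ((n + 1 : ℕ) : ℂ) * ((2 * k + n + p - 1 : ℕ) : ℂ) *
            MvPowerSeries.coeff d f = 0 := by
          rw [Nat.cast_sub (by omega)]
          push_cast at h2 ⊢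
          linear_combination -h2
        refine (mul_eq_zero.1 h3).resolve_left (mul_ne_zero ?_ ?_) <;>
          exact Nat.cast_ne_zero.2 (by omega)
  ext d
  exact key (xDeg d) d (by omega)

/-- The difference is divisible by `u`, hence by `r_x²`. In particular all `ψ_α` agree with `1` up
to order two in `x`. -/
theorem radial_sub_mem_xOrd {c d : ℕ → ℂ} (h : c 0 = d 0) :
    radial p q c - radial p q d ∈ xOrd p q 2 := by
  have : radial p q c - radial p q d =
      radialVar p q * radial p q fun n => c (n + 1) - d (n + 1) := by
    rw [radialVar_mul_radial, ← radial_sub]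
    congr 1
    ext n
    cases n with
    | zero => simp [h]
    | succ n => simp
  rw [this, isSplit_xy.radialVar_eq]
  exact mul_mem_xOrd_left (Submodule.smul_mem _ _ (mul_mem_xOrd_left rsq_x_mem_xOrd _)) _

theorem radial_single_zero : radial p q (fun n => if n = 0 then 1 else 0) = 1 := by
  have : (PowerSeries.mk fun n => if n = 0 then (1 : ℂ) else 0) = PowerSeries.C 1 := by
    ext n
    rw [PowerSeries.coeff_mk, PowerSeries.coeff_C]
  rw [radial, this, PowerSeries.subst_C, map_one]

theorem psi_sub_psi_mem_xOrd (α β : ℂ) : psi p q α - psi p q β ∈ xOrd p q 2 :=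
  radial_sub_mem_xOrd (by simp)

theorem psi_sub_one_mem_xOrd (α : ℂ) : psi p q α - 1 ∈ xOrd p q 2 := by
  rw [← radial_single_zero]
  exact radial_sub_mem_xOrd (by simp)

end XOrder

/-! ### Separation of eigencomponents -/

section Decomposition

variable {V : Type*} [AddCommGroup V] [Module ℂ V]

/-- Components for distinct eigenvalues of `T` of a vector killed by an operator that commutes with
`T` are killed by that operator. -/
theorem apply_eq_zero_of_sum_eigenvectors {ι : Type*} {T S : Module.End ℂ V}
    (hTS : ∀ v, T (S v) = S (T v)) {μ : ι → ℂ} (hμ : Function.Injective μ) {F : Finset ι}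
    {g : ι → V} (hg : ∀ i ∈ F, T (g i) = μ i • g i) (h : S (∑ i ∈ F, g i) = 0) :
    ∀ i ∈ F, S (g i) = 0 := by
  rw [map_sum] at h
  have := T.eigenspaces_iSupIndep.comp hμ
  rw [iSupIndep_iff_finsetSum_eq_zero_imp_eq_zero] at this
  refine this F (fun i => S (g i)) (fun i hi => ?_) h
  rw [Function.comp_apply, Module.End.mem_eigenspace_iff, hTS, hg i hi, map_smul]

end Decomposition

/-! ### Powers of `r²` -/

section WeylPow

variable {σ R : Type*} [DecidableEq σ] [CommRing R] [Algebra ℂ R] (w : WeylData σ R)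
  {s t : Finset σ}

theorem WeylData.eul_rsq_pow_mul {f : R} {l : ℂ} (hl : w.eul s f = l • f) (b : ℕ) :
    w.eul s (w.rsq s ^ b * f) = (l + 2 * b) • (w.rsq s ^ b * f) := by
  induction b with
  | zero => simp [hl]
  | succ b ih =>
    rw [pow_succ', mul_assoc, w.eul_mul, ih, w.eul_rsq, smul_mul_assoc, mul_smul_comm, ← add_smul]
    push_cast
    congr 1
    ring

theorem WeylData.lap_rsq_pow_mul {f : R} {l : ℂ} (h0 : w.lap s f = 0) (hl : w.eul s f = l • f)
    (b : ℕ) : w.lap s (w.rsq s ^ b * f) =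
      (2 * b * (2 * b + 2 * l + s.card - 2) : ℂ) • (w.rsq s ^ (b - 1) * f) := by
  induction b with
  | zero => simp [h0]
  | succ b ih =>
    rw [pow_succ', mul_assoc, w.lap_rsq_mul, ih, w.eul_rsq_pow_mul hl, mul_smul_comm]
    rcases b with _ | b
    · simp
      module
    · rw [← mul_assoc, ← pow_succ', Nat.add_sub_cancel, Nat.add_sub_cancel]
      push_cast
      module

theorem WeylData.lap_rsq_pow_mul_of_disjoint (h : Disjoint s t) (b : ℕ) (f : R) :
    w.lap s (w.rsq t ^ b * f) = w.rsq t ^ b * w.lap s f := by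
  induction b with
  | zero => simp
  | succ b ih => rw [pow_succ', mul_assoc, w.lap_rsq_mul_of_disjoint h, ih, mul_assoc]

theorem WeylData.eul_rsq_pow_mul_of_disjoint (h : Disjoint s t) (b : ℕ) (f : R) :
    w.eul s (w.rsq t ^ b * f) = w.rsq t ^ b * w.eul s f := by
  induction b with
  | zero => simp
  | succ b ih =>
    rw [pow_succ', mul_assoc, w.eul_mul, w.eul_rsq_of_disjoint h, ih, zero_mul, zero_add, mul_assoc]

theorem WeylData.cas_rsq_pow_mul (b : ℕ) (f : R) :
    w.cas s (w.rsq s ^ b * f) = w.rsq s ^ b * w.cas s f := by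
  induction b with
  | zero => simp
  | succ b ih => rw [pow_succ', mul_assoc, w.cas_rsq_mul, ih, mul_assoc]

theorem WeylData.cas_rsq_pow_mul_of_disjoint (h : Disjoint s t) (b : ℕ) (f : R) :
    w.cas s (w.rsq t ^ b * f) = w.rsq t ^ b * w.cas s f := by
  induction b with
  | zero => simp
  | succ b ih => rw [pow_succ', mul_assoc, w.cas_rsq_mul_of_disjoint h, ih, mul_assoc]

end WeylPow

/-! ### Casimir eigenvalues separate the types -/

section Casimir

variable {p q : ℕ}

variable (p q) in
/-- A combination of the two Casimir operators that separates the types. -/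
def casXY : Module.End ℂ (FormalFn p q) :=
  (weylF p q).cas (xVars p q) + Complex.I • (weylF p q).cas (yVars p q)

variable (p q) in
/-- The eigenvalue of `casXY` on the functions of type `(k, l)`. -/
def casVal (kl : ℕ × ℕ) : ℂ :=
  -((kl.1 : ℂ) * (kl.1 + p - 2)) + Complex.I * -((kl.2 : ℂ) * (kl.2 + q - 2))

/-- The real part determines `k` and the imaginary part `l`, because `a(a + n - 2)` is injective on
`ℕ` for `n ≥ 3`. -/
theorem casVal_injective (hp : 3 ≤ p) (hq : 3 ≤ q) : Function.Injective (casVal p q) := by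
  have aux : ∀ {n : ℕ}, 3 ≤ n → ∀ {a b : ℕ},
      (a : ℝ) * (a + n - 2) = (b : ℝ) * (b + n - 2) → a = b := by
    intro n hn a b h
    have h1 : ((a : ℝ) - b) * (a + b + n - 2) = 0 := by linear_combination h
    have h2 : (a + b + n - 2 : ℝ) ≠ 0 := by
      have : (3 : ℝ) ≤ n := by exact_mod_cast hn
      have h4 : (0 : ℝ) ≤ (a : ℝ) + b := by positivity
      exact ne_of_gt (by linarith)
    have h3 := (mul_eq_zero.1 h1).resolve_right h2
    exact_mod_cast sub_eq_zero.1 h3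
  rintro ⟨k, l⟩ ⟨k', l'⟩ h
  have hre := congrArg Complex.re h
  have him := congrArg Complex.im h
  simp [casVal] at hre him
  rw [aux hp hre, aux hq him]

theorem casXY_opXplus (f : FormalFn p q) :
    casXY p q (opXplus p q f) = opXplus p q (casXY p q f) := by
  have hd := disjoint_xVars_yVars p q
  simp only [casXY, opXplus_apply, LinearMap.add_apply, LinearMap.smul_apply, map_smul, map_add,
    WeylData.cas_lap, (weylF p q).cas_rsq_mul_of_disjoint hd, WeylData.cas_rsq_mul,
    (weylF p q).cas_lap_of_disjoint hd.symm]
  module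

theorem casXY_opXminus (f : FormalFn p q) :
    casXY p q (opXminus p q f) = opXminus p q (casXY p q f) := by
  have hd := disjoint_xVars_yVars p q
  simp only [casXY, opXminus_apply, LinearMap.add_apply, LinearMap.smul_apply, map_smul, map_add,
    WeylData.cas_lap, (weylF p q).cas_rsq_mul_of_disjoint hd.symm, WeylData.cas_rsq_mul,
    (weylF p q).cas_lap_of_disjoint hd]
  module

theorem casXY_opH (f : FormalFn p q) : casXY p q (opH p q f) = opH p q (casXY p q f) := by
  simp only [opH_eq_commutator, map_sub, casXY_opXplus, casXY_opXminus]

theorem cas_x_opXminus (f : FormalFn p q) : (weylF p q).cas (xVars p q) (opXminus p q f) =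
    opXminus p q ((weylF p q).cas (xVars p q) f) := by
  have hd := disjoint_xVars_yVars p q
  simp only [opXminus_apply, map_smul, map_add, WeylData.cas_rsq_mul,
    (weylF p q).cas_lap_of_disjoint hd]

theorem cas_x_opXminus_pow (n : ℕ) (f : FormalFn p q) :
    (weylF p q).cas (xVars p q) ((opXminus p q ^ n) f) =
      (opXminus p q ^ n) ((weylF p q).cas (xVars p q) f) := by
  induction n with
  | zero => rfl
  | succ n ih => rw [pow_succ', Module.End.mul_apply, cas_x_opXminus, ih, Module.End.mul_apply]

theorem casXY_opXminus_pow (n : ℕ) (f : FormalFn p q) :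
    casXY p q ((opXminus p q ^ n) f) = (opXminus p q ^ n) (casXY p q f) := by
  induction n with
  | zero => rfl
  | succ n ih => rw [pow_succ', Module.End.mul_apply, casXY_opXminus, ih, Module.End.mul_apply]

theorem cas_x_gen {k l : ℕ} {f : FormalFn p q} (hf : IsBiharmonic k l f) (a b : ℕ) (α : ℂ) :
    (weylF p q).cas (xVars p q) ((weylF p q).rsq (xVars p q) ^ a *
        ((weylF p q).rsq (yVars p q) ^ b * (f * psi p q α))) = -((k : ℂ) * (k + p - 2)) •
      ((weylF p q).rsq (xVars p q) ^ a *
        ((weylF p q).rsq (yVars p q) ^ b * (f * psi p q α))) := by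
  rw [WeylData.cas_rsq_pow_mul, WeylData.cas_rsq_pow_mul_of_disjoint _ (disjoint_xVars_yVars p q),
    psi_eq_radial, isSplit_xy.cas_mul_radial hf.lap_x hf.eul_x, card_xVars, mul_smul_comm,
    mul_smul_comm]

theorem cas_y_gen {k l : ℕ} {f : FormalFn p q} (hf : IsBiharmonic k l f) (a b : ℕ) (α : ℂ) :
    (weylF p q).cas (yVars p q) ((weylF p q).rsq (xVars p q) ^ a *
        ((weylF p q).rsq (yVars p q) ^ b * (f * psi p q α))) = -((l : ℂ) * (l + q - 2)) •
      ((weylF p q).rsq (xVars p q) ^ a *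
        ((weylF p q).rsq (yVars p q) ^ b * (f * psi p q α))) := by
  rw [WeylData.cas_rsq_pow_mul_of_disjoint _ (disjoint_xVars_yVars p q).symm,
    WeylData.cas_rsq_pow_mul, psi_eq_radial, isSplit_yx.cas_mul_radial hf.lap_y hf.eul_y,
    card_yVars, mul_smul_comm, mul_smul_comm]

theorem gen_eq (h₁ : MvPolynomial (Fin p) ℂ) (h₂ : MvPolynomial (Fin q) ℂ) (a b : ℕ) (α : ℂ) :
    inX p q h₁ * (inY p q h₂ * ((weylF p q).rsq (xVars p q) ^ a *
      ((weylF p q).rsq (yVars p q) ^ b * psi p q α))) = (weylF p q).rsq (xVars p q) ^ a *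
        ((weylF p q).rsq (yVars p q) ^ b * (inX p q h₁ * inY p q h₂ * psi p q α)) := by
  ring

theorem cas_x_of_mem_typeSpace {k l : ℕ} {f : FormalFn p q} (hf : f ∈ typeSpace p q k l) :
    (weylF p q).cas (xVars p q) f = -((k : ℂ) * (k + p - 2)) • f := by
  have : typeSpace p q k l ≤
      Module.End.eigenspace ((weylF p q).cas (xVars p q)) (-((k : ℂ) * (k + p - 2))) := by
    refine Submodule.span_le.2 ?_
    rintro _ ⟨h₁, hh₁, h₂, hh₂, a, b, α, _, rfl⟩
    rw [SetLike.mem_coe, Module.End.mem_eigenspace_iff, gen_eq,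
      cas_x_gen (isBiharmonic_mul hh₁ hh₂)]
  exact Module.End.mem_eigenspace_iff.1 (this hf)

theorem casXY_of_mem_typeSpace {k l : ℕ} {f : FormalFn p q} (hf : f ∈ typeSpace p q k l) :
    casXY p q f = casVal p q (k, l) • f := by
  have : typeSpace p q k l ≤ Module.End.eigenspace (casXY p q) (casVal p q (k, l)) := by
    refine Submodule.span_le.2 ?_
    rintro _ ⟨h₁, hh₁, h₂, hh₂, a, b, α, _, rfl⟩
    rw [SetLike.mem_coe, Module.End.mem_eigenspace_iff, gen_eq, casXY, LinearMap.add_apply,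
      LinearMap.smul_apply, cas_x_gen (isBiharmonic_mul hh₁ hh₂),
      cas_y_gen (isBiharmonic_mul hh₁ hh₂), casVal]
    module
  exact Module.End.mem_eigenspace_iff.1 (this hf)

end Casimir

/-! ### The functions `h₁ h₂ r_y^{2s} ψ_{k + p/2}` under `𝔰𝔩₂` -/

section KTypes

variable {p q : ℕ}

theorem add_half_ne_neg_natCast (hp : 3 ≤ p) (k n : ℕ) : (k : ℂ) + p / 2 ≠ -(n : ℂ) := by
  intro h
  have : ((2 * k + p + 2 * n : ℕ) : ℂ) = 0 := by
    push_cast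
    linear_combination 2 * h
  have := Nat.cast_eq_zero.1 this
  omega

variable (p q) in
/-- The radial factor `r_y^{2s} ψ_{k + p/2}`. -/
def kFactor (k s : ℕ) : FormalFn p q := (weylF p q).rsq (yVars p q) ^ s * psi p q (k + p / 2)

variable (p q) in
/-- The functions `h₁(x) h₂(y) r_y^{2s} ψ_{k + p/2}` of type `(k, l)`. -/
def kType (k l s : ℕ) : Submodule ℂ (FormalFn p q) :=
  (typePoly p q k l).map (LinearMap.mulRight ℂ (kFactor p q k s))

theorem mem_kType {k l s : ℕ} {f : FormalFn p q} :
    f ∈ kType p q k l s ↔ ∃ t ∈ typePoly p q k l, t * kFactor p q k s = f := Iff.rfl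

theorem kType_le_typeSpace (hp : 3 ≤ p) (k l s : ℕ) : kType p q k l s ≤ typeSpace p q k l := by
  refine Submodule.map_le_iff_le_comap.2 (Submodule.span_le.2 ?_)
  rintro _ ⟨h₁, hh₁, h₂, hh₂, rfl⟩
  have := gen_mem_typeSpace hh₁ hh₂ 0 s (add_half_ne_neg_natCast hp k)
  rw [pow_zero, one_mul, ← mul_assoc] at this
  exact this

variable {k l s : ℕ} {t : FormalFn p q}

theorem mul_kFactor_eq : t * kFactor p q k s =
    (weylF p q).rsq (yVars p q) ^ s * t * psi p q (k + p / 2) := by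
  rw [kFactor]; ring

/-- The product `r_y^{2s} t` is harmonic of degree `k` in `x`, and the parameter `k + p/2` is the
one for which the Bessel equation gives `Δ_x = -r_y²`. -/
theorem opXplus_mul_kFactor (hp : 3 ≤ p) (ht : IsBiharmonic k l t) :
    opXplus p q (t * kFactor p q k s) = 0 := by
  have hd := disjoint_xVars_yVars p q
  rw [opXplus_apply, mul_kFactor_eq, isSplit_xy.lap_mul_psi (k := k) ?_ ?_
    (add_half_ne_neg_natCast hp k) (by rw [card_xVars]), neg_add_cancel, smul_zero]
  · rw [WeylData.lap_rsq_pow_mul_of_disjoint _ hd, ht.lap_x, mul_zero]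
  · rw [WeylData.eul_rsq_pow_mul_of_disjoint _ hd, ht.eul_x, mul_smul_comm]

/-- Each `u^n` has equal degrees in `x` and `y`, so `ψ` contributes nothing to the weight. -/
theorem opH_mul_kFactor (ht : IsBiharmonic k l t) : opH p q (t * kFactor p q k s) =
    ((l : ℂ) + 2 * s - k + (q - p) / 2) • (t * kFactor p q k s) := by
  have hd := disjoint_xVars_yVars p q
  have h1 : (weylF p q).eul (xVars p q) ((weylF p q).rsq (yVars p q) ^ s * t) =
      (k : ℂ) • ((weylF p q).rsq (yVars p q) ^ s * t) := by
    rw [WeylData.eul_rsq_pow_mul_of_disjoint _ hd, ht.eul_x, mul_smul_comm]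
  have h2 := (weylF p q).eul_rsq_pow_mul ht.eul_y s
  rw [opH_apply, mul_kFactor_eq, psi_eq_radial, WeylData.eul_mul _ (_ * t),
    WeylData.eul_mul _ (_ * t), h1, h2,
    isSplit_xy.eul_radial, isSplit_yx.eul_radial, smul_mul_assoc, smul_mul_assoc]
  module

theorem mul_kFactor_sub_mem_xOrd (ht : IsBiharmonic k l t) :
    t * kFactor p q k s - t * (weylF p q).rsq (yVars p q) ^ s ∈ xOrd p q (k + 1) := by
  have : t * kFactor p q k s - t * (weylF p q).rsq (yVars p q) ^ s =
      t * ((weylF p q).rsq (yVars p q) ^ s * (psi p q (k + p / 2) - 1)) := by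
    rw [kFactor]; ring
  rw [this]
  exact xOrd_anti (by omega) (mul_mem_xOrd (mem_xOrd_of_eul_x ht.eul_x)
    (mul_mem_xOrd_right _ (psi_sub_one_mem_xOrd _)))

theorem opXminus_mem_xOrd {n : ℕ} {f : FormalFn p q} (hf : f ∈ xOrd p q n) :
    opXminus p q f ∈ xOrd p q n := by
  rw [opXminus_apply]
  exact Submodule.smul_mem _ _ (Submodule.add_mem _ (mul_mem_xOrd_right _ hf) (lap_y_mem_xOrd hf))

/-- The leading term of `(X⁻)^j` on a function of type `(k, l)`. -/
theorem opXminus_pow_mul_kFactor_sub_mem_xOrd (ht : IsBiharmonic k l t) (j : ℕ) :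
    (opXminus p q ^ j) (t * kFactor p q k s) -
      (∏ i ∈ Finset.range j, (((s : ℂ) - i) * (2 * ((s : ℂ) - i) + 2 * l + q - 2))) •
        (t * (weylF p q).rsq (yVars p q) ^ (s - j)) ∈ xOrd p q (k + 1) := by
  induction j with
  | zero => simpa using mul_kFactor_sub_mem_xOrd ht
  | succ j ih =>
    set c := ∏ i ∈ Finset.range j, (((s : ℂ) - i) * (2 * ((s : ℂ) - i) + 2 * l + q - 2)) with hc
    have h1 := opXminus_mem_xOrd ih
    rw [map_sub, map_smul, ← Module.End.mul_apply, ← pow_succ'] at h1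
    have h2 : c • opXminus p q (t * (weylF p q).rsq (yVars p q) ^ (s - j)) -
        (∏ i ∈ Finset.range (j + 1), (((s : ℂ) - i) * (2 * ((s : ℂ) - i) + 2 * l + q - 2))) •
        (t * (weylF p q).rsq (yVars p q) ^ (s - (j + 1))) ∈ xOrd p q (k + 1) := by
      rw [Finset.prod_range_succ, ← hc]
      -- Beyond `j = s` the product already contains the zero factor `i = s`, so the truncated
      -- exponents do not matter. Otherwise `½ Δ_y` lowers the power of `r_y²` with the stated
      -- factor, while `½ r_x²` only adds order in `x`.
      rcases lt_or_ge s j with hj | hj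
      · have : c = 0 := by
          refine Finset.prod_eq_zero (Finset.mem_range.2 hj) ?_
          rw [sub_self, zero_mul]
        simp [this]
      · have h3 := (weylF p q).lap_rsq_pow_mul ht.lap_y ht.eul_y (s - j)
        rw [card_yVars, Nat.cast_sub hj] at h3
        have h4 : opXminus p q (t * (weylF p q).rsq (yVars p q) ^ (s - j)) =
            (((s : ℂ) - j) * (2 * ((s : ℂ) - j) + 2 * l + q - 2)) •
              (t * (weylF p q).rsq (yVars p q) ^ (s - (j + 1))) +
            (1 / 2 : ℂ) • ((weylF p q).rsq (xVars p q) *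
              (t * (weylF p q).rsq (yVars p q) ^ (s - j))) := by
          rw [opXminus_apply, mul_comm t, h3, Nat.sub_sub, mul_comm t]
          module
        rw [h4, smul_add, smul_smul, add_sub_cancel_left]
        refine Submodule.smul_mem _ _ (Submodule.smul_mem _ _ (xOrd_anti (by omega)
          (mul_mem_xOrd rsq_x_mem_xOrd
            (mul_mem_xOrd_left (mem_xOrd_of_eul_x ht.eul_x) _))))
    have := Submodule.add_mem _ h1 h2
    rwa [sub_add_sub_cancel] at this

theorem cas_x_mul_kFactor (ht : IsBiharmonic k l t) :
    (weylF p q).cas (xVars p q) (t * kFactor p q k s) =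
      -((k : ℂ) * (k + p - 2)) • (t * kFactor p q k s) := by
  have := cas_x_gen ht 0 s ((k : ℂ) + p / 2)
  rwa [pow_zero, one_mul, ← mul_assoc, ← mul_kFactor_eq] at this

/-- At weight `m`, the vector `(X⁻)^(m+1) v` is again killed by `X⁺` and has the same Casimir
eigenvalue. For `s ≤ m` its lowest term vanishes, so uniqueness makes it zero. -/
theorem opXminus_pow_mul_kFactor_eq_zero (hp : 3 ≤ p) {m : ℕ} (ht : IsBiharmonic k l t)
    (hH : (l : ℂ) + 2 * s - k + (q - p) / 2 = m) (hs : s ≤ m) :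
    (opXminus p q ^ (m + 1)) (t * kFactor p q k s) = 0 := by
  refine eq_zero_of_opXplus_of_cas hp (k := k) ?_ ?_ ?_
  · have h := opH_mul_kFactor (s := s) ht
    rw [hH] at h
    rw [slTwo_e_pow opXplus_opXminus opH_opXminus h (opXplus_mul_kFactor hp ht), sub_self,
      mul_zero, zero_smul]
  · rw [cas_x_opXminus_pow, cas_x_mul_kFactor ht, map_smul]
  · have := opXminus_pow_mul_kFactor_sub_mem_xOrd (s := s) ht (m + 1)
    rwa [Finset.prod_eq_zero (Finset.mem_range.2 (Nat.lt_succ_of_le hs)) (by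
      rw [sub_self, zero_mul]), zero_smul, sub_zero] at this

theorem rsq_ne_zero (hq : 3 ≤ q) : (weylF p q).rsq (yVars p q) ≠ 0 := by
  intro h
  have h1 := (weylF p q).lap_rsq (s := yVars p q)
  rw [h, map_zero, card_yVars] at h1
  have h2 := congrArg (MvPowerSeries.constantCoeff (σ := Fin p ⊕ Fin q) (R := ℂ)) h1
  rw [map_zero, map_mul, map_natCast, map_ofNat] at h2
  have h3 : (q : ℂ) = 0 := by linear_combination -h2 / 2
  have := Nat.cast_eq_zero.1 h3
  omega

/-- For `s > m` all factors of the leading coefficient are nonzero, so the lowest term `t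
r_y^{2(s-m-1)}` must vanish. -/
theorem eq_zero_of_opXminus_pow_mul_kFactor (hq : 3 ≤ q) {m : ℕ} (ht : IsBiharmonic k l t)
    (hs : m < s) (h : (opXminus p q ^ (m + 1)) (t * kFactor p q k s) = 0) : t = 0 := by
  have h1 := opXminus_pow_mul_kFactor_sub_mem_xOrd (s := s) ht (m + 1)
  rw [h, zero_sub, ← neg_smul] at h1
  have hne : -∏ i ∈ Finset.range (m + 1),
      (((s : ℂ) - i) * (2 * ((s : ℂ) - i) + 2 * l + q - 2)) ≠ 0 := by
    refine neg_ne_zero.2 (Finset.prod_ne_zero_iff.2 fun i hi => ?_)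
    rw [Finset.mem_range] at hi
    obtain ⟨r, rfl⟩ := Nat.exists_eq_add_of_lt (show i < s by omega)
    obtain ⟨u, rfl⟩ := Nat.exists_eq_add_of_le hq
    have e1 : ((i + r + 1 : ℕ) : ℂ) - i = ((r + 1 : ℕ) : ℂ) := by push_cast; ring
    rw [e1]
    refine mul_ne_zero (Nat.cast_ne_zero.2 (by omega)) ?_
    have e2 : 2 * ((r + 1 : ℕ) : ℂ) + 2 * l + ((3 + u : ℕ) : ℂ) - 2 =
        ((2 * r + 2 * l + u + 3 : ℕ) : ℂ) := by push_cast; ring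
    rw [e2]
    exact Nat.cast_ne_zero.2 (by omega)
  have h2 : t * (weylF p q).rsq (yVars p q) ^ (s - (m + 1)) = 0 := by
    refine eq_zero_of_eul_x (k := k) ?_ ((Submodule.smul_mem_iff _ hne).1 h1)
    rw [mul_comm, WeylData.eul_rsq_pow_mul_of_disjoint _ (disjoint_xVars_yVars p q), ht.eul_x,
      mul_smul_comm]
  exact (mul_eq_zero.1 h2).resolve_right (pow_ne_zero _ (rsq_ne_zero hq))

end KTypes

/-! ### Decomposition of `M⁺_m` into types -/

section HighestSub

variable {p q : ℕ}

/-- Up to terms of higher order in `x`, functions of type `(k, l)` are sums of functions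
`t r_y^{2b} ψ_{k + p/2}`. -/
theorem exists_sub_mem_xOrd_of_mem_typeSpace {k l : ℕ} {f : FormalFn p q}
    (hf : f ∈ typeSpace p q k l) : ∃ g ∈ ⨆ b, kType p q k l b, f - g ∈ xOrd p q (k + 1) := by
  induction hf using Submodule.span_induction with
  | mem f hf =>
    obtain ⟨h₁, hh₁, h₂, hh₂, a, b, α, _, rfl⟩ := hf
    have ht := mem_xOrd_of_eul_x (isBiharmonic_mul hh₁ hh₂).eul_x
    rcases a with _ | a
    · refine ⟨inX p q h₁ * inY p q h₂ * kFactor p q k b, Submodule.mem_iSup_of_mem b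
        ⟨_, Submodule.subset_span ⟨h₁, hh₁, h₂, hh₂, rfl⟩, rfl⟩, ?_⟩
      have : inX p q h₁ * (inY p q h₂ * ((weylF p q).rsq (xVars p q) ^ 0 *
          ((weylF p q).rsq (yVars p q) ^ b * psi p q α))) -
          inX p q h₁ * inY p q h₂ * kFactor p q k b = inX p q h₁ * inY p q h₂ *
            ((weylF p q).rsq (yVars p q) ^ b * (psi p q α - psi p q (k + p / 2))) := by
        rw [kFactor]; ring
      rw [this]
      exact xOrd_anti (by omega)
        (mul_mem_xOrd ht (mul_mem_xOrd_right _ (psi_sub_psi_mem_xOrd _ _)))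
    -- A positive power of `r_x²` pushes the whole generator to order at least `k + 2`.
    · refine ⟨0, Submodule.zero_mem _, ?_⟩
      rw [sub_zero, ← mul_assoc, pow_succ', mul_assoc ((weylF p q).rsq (xVars p q))]
      exact xOrd_anti (by omega) (mul_mem_xOrd ht (mul_mem_xOrd_left rsq_x_mem_xOrd _))
  | zero => exact ⟨0, Submodule.zero_mem _, by simp⟩
  | add f f' _ _ hf hf' =>
    obtain ⟨g, hg, h⟩ := hf
    obtain ⟨g', hg', h'⟩ := hf'
    refine ⟨g + g', Submodule.add_mem _ hg hg', ?_⟩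
    rw [add_sub_add_comm]
    exact Submodule.add_mem _ h h'
  | smul c f _ hf =>
    obtain ⟨g, hg, h⟩ := hf
    refine ⟨c • g, Submodule.smul_mem _ c hg, ?_⟩
    rw [← smul_sub]
    exact Submodule.smul_mem _ c h

/-- Subtract the combination `g` with the same lowest term: `f - g` is still killed by `X⁺` and of
type `(k, l)`, so it vanishes by uniqueness. -/
theorem mem_iSup_kType_of_opXplus (hp : 3 ≤ p) {k l : ℕ} {f : FormalFn p q}
    (hf : f ∈ typeSpace p q k l) (hX : opXplus p q f = 0) : f ∈ ⨆ b, kType p q k l b := by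
  obtain ⟨g, hg, h⟩ := exists_sub_mem_xOrd_of_mem_typeSpace hf
  have hg1 : g ∈ typeSpace p q k l := (iSup_le fun b => kType_le_typeSpace hp k l b) hg
  have hg2 : ⨆ b, kType p q k l b ≤ LinearMap.ker (opXplus p q) := by
    refine iSup_le fun b => ?_
    rintro _ ⟨t, ht, rfl⟩
    exact opXplus_mul_kFactor hp (isBiharmonic_of_mem_typePoly ht)
  have h0 : f - g = 0 := eq_zero_of_opXplus_of_cas hp
    (by rw [map_sub, hX, LinearMap.mem_ker.1 (hg2 hg), sub_zero])
    (cas_x_of_mem_typeSpace (Submodule.sub_mem _ hf hg1)) h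
  rwa [sub_eq_zero.1 h0]

/-- The types `(k, l)` occurring in `M⁺_m`, with the power `s` of `r_y²`. -/
def IsKIndex (p q m : ℕ) (i : ℕ × ℕ × ℕ) : Prop :=
  i.2.2 ≤ m ∧ 4 * i.2.2 + 2 * i.2.1 + q = 2 * m + 2 * i.1 + p

/-- Different powers of `r_y²` have different `H`-weights, so only one survives in weight `m`; the
condition on `(X⁻)^(m+1)` then bounds it by `m`. -/
theorem exists_kType_of_mem_typeSpace (hp : 3 ≤ p) (hq : 3 ≤ q) {k l m : ℕ} {f : FormalFn p q}
    (hf : f ∈ typeSpace p q k l) (hH : opH p q f = (m : ℂ) • f) (hX : opXplus p q f = 0)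
    (hm : (opXminus p q ^ (m + 1)) f = 0) :
    f = 0 ∨ ∃ s, IsKIndex p q m (k, l, s) ∧ f ∈ kType p q k l s := by
  refine or_iff_not_imp_left.2 fun hf0 => ?_
  have h1 := mem_iSup_kType_of_opXplus hp hf hX
  obtain ⟨v, hv, hsum⟩ := (Submodule.mem_iSup_iff_exists_finsupp _ _).1 h1
  let μ : ℕ → ℂ := fun b => (l : ℂ) + 2 * b - k + (q - p) / 2
  have hμ : Function.Injective μ := fun a b hab => by
    have : (a : ℂ) = b := by linear_combination hab / 2
    exact_mod_cast this
  have hw : ∀ b, opH p q (v b) = μ b • v b := fun b => by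
    obtain ⟨t, ht, hvt⟩ := mem_kType.1 (hv b)
    rw [← hvt]
    exact opH_mul_kFactor (isBiharmonic_of_mem_typePoly ht)
  have hz := apply_eq_zero_of_sum_eigenvectors (T := opH p q)
    (S := opH p q - (m : ℂ) • (1 : Module.End ℂ (FormalFn p q)))
    (fun v => by simp [map_sub, map_smul]) hμ (F := v.support) (g := v) (fun b _ => hw b) (by
      rw [show ∑ b ∈ v.support, v b = f from hsum]
      simp [hH])
  have hm' : ∀ b ∈ v.support, μ b = m := fun b hb => by
    have h2 := hz b hb
    rw [LinearMap.sub_apply, LinearMap.smul_apply, Module.End.one_apply, hw, ← sub_smul] at h2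
    exact sub_eq_zero.1 ((smul_eq_zero.1 h2).resolve_right (Finsupp.mem_support_iff.1 hb))
  have hne : v.support.Nonempty := by
    rw [Finset.nonempty_iff_ne_empty]
    intro h2
    apply hf0
    rw [← hsum, Finsupp.sum, h2, Finset.sum_empty]
  obtain ⟨s, hs⟩ := hne
  have hfs : f = v s := by
    rw [← hsum, Finsupp.sum]
    refine Finset.sum_eq_single_of_mem s hs fun b hb hbs => ?_
    exact absurd (hμ ((hm' b hb).trans (hm' s hs).symm)) hbs
  refine ⟨s, ⟨?_, ?_⟩, hfs ▸ hv s⟩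
  · by_contra! hlt
    obtain ⟨t, ht, hvt⟩ := mem_kType.1 (hv s)
    rw [hfs, ← hvt] at hm
    rw [eq_zero_of_opXminus_pow_mul_kFactor hq (isBiharmonic_of_mem_typePoly ht) hlt hm,
      zero_mul] at hvt
    exact hf0 (hfs.trans hvt.symm)
  · have h2 : ((4 * s + 2 * l + q : ℕ) : ℂ) = ((2 * m + 2 * k + p : ℕ) : ℂ) := by
      have := hm' s hs
      push_cast
      linear_combination 2 * this
    exact_mod_cast h2

theorem kType_le_highestSub (hp : 3 ≤ p) {k l s m : ℕ} (h : IsKIndex p q m (k, l, s)) :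
    kType p q k l s ≤ highestSub p q m := by
  intro f hf
  have hE := typeSpace_le_spaceE k l (kType_le_typeSpace hp k l s hf)
  obtain ⟨t, ht, rfl⟩ := mem_kType.1 hf
  have ht := isBiharmonic_of_mem_typePoly ht
  have hw : (l : ℂ) + 2 * s - k + (q - p) / 2 = m := by
    have h2 : ((4 * s + 2 * l + q : ℕ) : ℂ) = ((2 * m + 2 * k + p : ℕ) : ℂ) :=
      congrArg _ h.2
    push_cast at h2
    linear_combination h2 / 2
  exact mem_highestSub.2 ⟨hE, by rw [opH_mul_kFactor ht, hw], opXplus_mul_kFactor hp ht,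
    opXminus_pow_mul_kFactor_eq_zero hp ht hw h.1⟩

variable (p q) in
/-- The part of `M⁺_m` of the types `(k, l)` with `k + l ≤ N`. -/
def highestFil (m N : ℕ) : Submodule ℂ (FormalFn p q) := highestSub p q m ⊓ spaceEFil p q N

theorem highestFil_eq_iSup (hp : 3 ≤ p) (hq : 3 ≤ q) (m N : ℕ) : highestFil p q m N =
    ⨆ i : {i : ℕ × ℕ × ℕ // IsKIndex p q m i ∧ i.1 + i.2.1 ≤ N},
      kType p q i.1.1 i.1.2.1 i.1.2.2 := by
  refine le_antisymm ?_ (iSup_le ?_)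
  · rintro f ⟨hf, hfN⟩
    obtain ⟨_, h2, h3, h4⟩ := mem_highestSub.1 hf
    obtain ⟨v, hv, hsum⟩ := (Submodule.mem_iSup_iff_exists_finsupp _ _).1 hfN
    have hval : Function.Injective
        fun kl : {kl : ℕ × ℕ // kl.1 + kl.2 ≤ N} => casVal p q kl.1 :=
      (casVal_injective hp hq).comp Subtype.val_injective
    have hc : ∀ kl ∈ v.support, casXY p q (v kl) = casVal p q kl.1 • v kl := fun kl _ =>
      casXY_of_mem_typeSpace (hv kl)
    -- The conditions defining `M⁺_m` are kernels of operators commuting with `casXY`, so they pass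
    -- to each component of `f`.
    have key : ∀ S : Module.End ℂ (FormalFn p q), (∀ g, casXY p q (S g) = S (casXY p q g)) →
        S f = 0 → ∀ kl ∈ v.support, S (v kl) = 0 := fun S hS hSf =>
      apply_eq_zero_of_sum_eigenvectors hS hval hc (by
        rwa [show ∑ b ∈ v.support, v b = f from hsum])
    rw [← hsum]
    refine Submodule.sum_mem _ fun kl hkl => ?_
    have k1 := key (opH p q - (m : ℂ) • (1 : Module.End ℂ (FormalFn p q)))
      (fun g => by simp [casXY_opH]) (by simp [h2]) kl hkl
    rcases exists_kType_of_mem_typeSpace hp hq (hv kl)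
      (sub_eq_zero.1 (by simpa using k1)) (key _ casXY_opXplus h3 kl hkl)
      (key _ (casXY_opXminus_pow _) h4 kl hkl) with h0 | ⟨s, hs, hmem⟩
    · rw [h0]
      exact Submodule.zero_mem _
    · exact Submodule.mem_iSup_of_mem (⟨(kl.1.1, kl.1.2, s), hs, kl.2⟩ :
        {i : ℕ × ℕ × ℕ // IsKIndex p q m i ∧ i.1 + i.2.1 ≤ N}) hmem
  · rintro ⟨⟨k, l, s⟩, hi, hN⟩
    exact le_inf (kType_le_highestSub hp hi)
      ((kType_le_typeSpace hp k l s).trans (typeSpace_le_spaceEFil hN))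

end HighestSub

/-! ### Moving along a half-line by noncompact elements -/

section Generation

variable {p q : ℕ}

/-- The matrix `E_{i,p+j} + E_{p+j,i}`. -/
def noncompact (i : Fin p) (j : Fin q) : OrthLie p q :=
  ⟨Matrix.single (.inl i) (.inr j) 1 + Matrix.single (.inr j) (.inl i) 1, by
    rw [OrthLie, LieAlgebra.Orthogonal.so', mem_skewAdjointMatricesLieSubalgebra,
      mem_skewAdjointMatricesSubmodule, Matrix.IsSkewAdjoint, Matrix.IsAdjointPair]
    ext a b
    rcases a with a | a <;> rcases b with b | b <;>
      simp [LieAlgebra.Orthogonal.indefiniteDiagonal, Matrix.single_apply, Matrix.mul_diagonal,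
        Matrix.diagonal_mul, and_comm]
    all_goals split_ifs <;> simp⟩

theorem noncompact_lie (i : Fin p) (j : Fin q) (f : FormalFn p q) : ⁅noncompact i j, f⁆ =
    Complex.I • ((weylF p q).X (.inl i) * ((weylF p q).X (.inr j) * f) +
      (weylF p q).D (.inr j) ((weylF p q).D (.inl i) f)) := by
  rw [lie_eq_quadForm, quadForm_apply]
  congr 1
  have : ∀ a b, (Matrix.diagonal sgn * (noncompact i j).1 : Matrix _ _ ℂ) a b =
      (if Sum.inl i = a ∧ Sum.inr j = b then 1 else 0) +
        if Sum.inr j = a ∧ Sum.inl i = b then (-1) else 0 := fun a b => by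
    rw [Matrix.diagonal_mul]
    rcases a with a | a <;> rcases b with b | b <;> simp [noncompact, Matrix.single_apply, sgn]
  simp only [this, add_smul, Finset.sum_add_distrib, ite_and, ite_smul, zero_smul, one_smul]
  simp only [Finset.sum_ite_irrel, Finset.sum_const_zero, Finset.sum_ite_eq, Finset.mem_univ,
    if_true]
  simp only [xHat, yHat, mulOp_apply, derivOp_apply, LinearMap.smul_apply, Derivation.map_smul,
    smul_smul]
  congr 1
  rw [show (-1 * (-Complex.I * -Complex.I) : ℂ) = 1 by linear_combination -Complex.I_sq, one_smul]

theorem rsq_mul_rsq_mul_radial (c : ℕ → ℂ) :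
    (weylF p q).rsq (xVars p q) * (weylF p q).rsq (yVars p q) *
      radial p q (fun n => (n + 1) * c (n + 1)) = radial p q fun n => 4 * n * c n := by
  have h1 : (weylF p q).rsq (xVars p q) * (weylF p q).rsq (yVars p q) =
      (4 : ℂ) • radialVar p q := by
    rw [isSplit_xy.radialVar_eq, smul_smul]
    norm_num
  rw [h1, smul_mul_assoc, radialVar_mul_radial, ← radial_smul]
  congr 1
  ext n
  cases n with
  | zero => simp
  | succ n => simp; ring

/-- The term `r_y^{2(s+1)} u^n` has degree `s + 1 + n` in `r_y²`; differentiation lowers this by one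
and yields `2(s + 1 + n) y_j`. -/
theorem D_inr_rsq_pow_mul_radial (j : Fin q) (s : ℕ) (c : ℕ → ℂ) :
    (weylF p q).D (.inr j) ((weylF p q).rsq (yVars p q) ^ (s + 1) * radial p q c) =
      (weylF p q).X (.inr j) * ((weylF p q).rsq (yVars p q) ^ s *
        radial p q fun n => 2 * (s + 1 + n) * c n) := by
  have h1 : (radial p q fun n => 2 * (s + 1 + n) * c n) = (2 * (s + 1) : ℂ) • radial p q c +
      (1 / 2 : ℂ) • radial p q fun n => 4 * n * c n := by
    rw [← radial_smul, ← radial_smul, ← radial_add]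
    congr 1
    ext n
    simp
    ring
  rw [WeylData.D_mul, D_rsq_pow, if_pos (inr_mem_yVars j), isSplit_yx.D_radial (inr_mem_yVars j),
    h1, ← rsq_mul_rsq_mul_radial, Nat.add_sub_cancel]
  simp only [mul_add, mul_smul_comm, smul_mul_assoc]
  push_cast
  congr 2 <;> ring

theorem sum_X_mul_polyIn {n k : ℕ} (e : Fin n ↪ Fin p ⊕ Fin q) {h : MvPolynomial (Fin n) ℂ}
    (hh : h ∈ harmonicPoly n k) : ∑ i, (weylF p q).X (e i) * polyIn e (MvPolynomial.pderiv i h) =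
      (k : ℂ) • polyIn e h := by
  have := congrArg (polyIn e) (mem_harmonicPoly_iff.1 hh).1.eul
  rw [map_smul, WeylData.eul_apply, map_sum] at this
  rw [← this]
  refine Finset.sum_congr rfl fun i _ => ?_
  rw [map_mul, ← polyIn_X]
  rfl

theorem sum_D_polyIn {n k : ℕ} (e : Fin n ↪ Fin p ⊕ Fin q) {h : MvPolynomial (Fin n) ℂ}
    (hh : h ∈ harmonicPoly n k) :
    ∑ i, (weylF p q).D (e i) (polyIn e (MvPolynomial.pderiv i h)) = 0 := by
  have := congrArg (polyIn e) (mem_harmonicPoly_iff.1 hh).2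
  rw [map_zero, WeylData.lap_apply, map_sum] at this
  rw [← this]
  refine Finset.sum_congr rfl fun i _ => ?_
  rw [D_polyIn]
  rfl

/-- By the Bessel equation, `Ψ_α + u Ψ_α'' + (s + 1) Ψ_α' = (s + 1 - α) Ψ_α'`, and `Ψ_α' = -(1/α)
Ψ_{α+1}`. -/
theorem radial_bessel_shift (s : ℕ) {α : ℂ} (hα : ∀ n : ℕ, α ≠ -(n : ℂ)) :
    radial p q (besselCoeff α) + (1 / 2 : ℂ) • (radial p q fun n =>
      2 * (s + 1 + n) * ((n + 1) * besselCoeff α (n + 1))) =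
        ((α - s - 1) / α) • psi p q (α + 1) := by
  rw [psi_eq_radial, ← radial_smul, ← radial_smul, ← radial_add]
  congr 1
  ext n
  have h0 : α ≠ 0 := by simpa using hα 0
  have h2 : α + n ≠ 0 := fun h => hα n (by linear_combination h)
  have h3 := besselCoeff_succ hα n
  have h4 := besselCoeff_add_one hα n
  refine mul_left_cancel₀ h2 ?_
  simp only [Pi.add_apply, Pi.smul_apply, smul_eq_mul]
  have h5 : (α - s - 1) / α * α = α - s - 1 := by field_simp
  linear_combination (s + 1 + n : ℂ) * h3 - (α - s - 1) / α * h4 - besselCoeff α n * h5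

/-- The noncompact part of `𝔤` maps functions of type `(k, l)` onto those of type
`(k + 1, l + 1)`. -/
theorem sum_noncompact_lie (hp : 3 ≤ p) {k l : ℕ} (s : ℕ) {h₁ : MvPolynomial (Fin p) ℂ}
    (hh₁ : h₁ ∈ harmonicPoly p (k + 1)) {h₂ : MvPolynomial (Fin q) ℂ}
    (hh₂ : h₂ ∈ harmonicPoly q (l + 1)) :
    ∑ j, ∑ i, ⁅noncompact i j, inX p q (MvPolynomial.pderiv i h₁) *
        inY p q (MvPolynomial.pderiv j h₂) * kFactor p q k s⁆ =
      (Complex.I * ((k + 1) * (l + 1) * (((k + p / 2 : ℂ) - s - 1) / (k + p / 2)))) •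
        (inX p q h₁ * inY p q h₂ * kFactor p q (k + 1) s) := by
  set w := weylF p q
  set ry := w.rsq (yVars p q)
  have hα := add_half_ne_neg_natCast hp k
  set α : ℂ := k + p / 2 with hαdef
  set c := besselCoeff α
  set c' : ℕ → ℂ := fun n => (n + 1) * c (n + 1) with hc'
  have hF : kFactor p q k s = ry ^ s * radial p q c := rfl
  have hF' : kFactor p q (k + 1) s = ry ^ s * psi p q (α + 1) := by
    rw [kFactor, hαdef]
    push_cast
    rw [add_right_comm]
  have eX := sum_X_mul_polyIn (p := p) (q := q) Function.Embedding.inl hh₁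
  have eY := sum_X_mul_polyIn (p := p) (q := q) Function.Embedding.inr hh₂
  have eDX := sum_D_polyIn (p := p) (q := q) Function.Embedding.inl hh₁
  have eDY := sum_D_polyIn (p := p) (q := q) Function.Embedding.inr hh₂
  -- The second derivatives of `h₁` sum to zero by harmonicity. The derivative of the radial factor
  -- supplies `x_i`, and Euler's identity turns `∑ x_i ∂_i h₁` into `(k + 1) h₁`.
  have h1 : ∀ j, ∑ i, w.D (.inl i) (inX p q (MvPolynomial.pderiv i h₁) *
      inY p q (MvPolynomial.pderiv j h₂) * kFactor p q k s) = ((k + 1 : ℂ) / 2) •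
        (inX p q h₁ * (inY p q (MvPolynomial.pderiv j h₂) * (ry ^ (s + 1) * radial p q c'))) := by
    intro j
    have h2 : ∀ i, w.D (.inl i) (inX p q (MvPolynomial.pderiv i h₁) *
        inY p q (MvPolynomial.pderiv j h₂) * kFactor p q k s) =
        w.D (.inl i) (inX p q (MvPolynomial.pderiv i h₁)) *
          (inY p q (MvPolynomial.pderiv j h₂) * kFactor p q k s) +
        (1 / 2 : ℂ) • ((w.X (.inl i) * inX p q (MvPolynomial.pderiv i h₁)) *
          (inY p q (MvPolynomial.pderiv j h₂) * (ry ^ (s + 1) * radial p q c'))) := by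
      intro i
      have e2 : w.D (.inl i) (inY p q (MvPolynomial.pderiv j h₂)) = 0 :=
        D_polyIn_of_notMem _ (inl_notMem_yVars i) _
      rw [hF, mul_assoc, WeylData.D_mul, WeylData.D_mul, WeylData.D_mul, e2, D_rsq_pow,
        if_neg (inl_notMem_yVars i), isSplit_xy.D_radial (inl_mem_xVars i)]
      simp only [zero_mul, zero_add, mul_smul_comm]
      congr 2
      ring
    simp only [h2]
    rw [Finset.sum_add_distrib, ← Finset.sum_mul, ← Finset.smul_sum, ← Finset.sum_mul]
    erw [eDX, eX]
    rw [zero_mul, zero_add, smul_mul_assoc, smul_smul]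
    push_cast
    congr 1
    ring
  -- The same argument in `y`, now with the exponent `s + 1` of `r_y²` left by the `x`-derivative.
  have h3 : ∑ j, ∑ i, w.D (.inr j) (w.D (.inl i) (inX p q (MvPolynomial.pderiv i h₁) *
      inY p q (MvPolynomial.pderiv j h₂) * kFactor p q k s)) = ((k + 1 : ℂ) * (l + 1) / 2) •
        (inX p q h₁ * inY p q h₂ * (ry ^ s * radial p q fun n => 2 * (s + 1 + n) * c' n)) := by
    have h2 : ∀ j, ∑ i, w.D (.inr j) (w.D (.inl i) (inX p q (MvPolynomial.pderiv i h₁) *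
        inY p q (MvPolynomial.pderiv j h₂) * kFactor p q k s)) = ((k + 1 : ℂ) / 2) •
        (inX p q h₁ * (w.D (.inr j) (inY p q (MvPolynomial.pderiv j h₂)) *
            (ry ^ (s + 1) * radial p q c') +
          (w.X (.inr j) * inY p q (MvPolynomial.pderiv j h₂)) *
            (ry ^ s * radial p q fun n => 2 * (s + 1 + n) * c' n))) := by
      intro j
      have e2 : w.D (.inr j) (inX p q h₁) = 0 := D_polyIn_of_notMem _ (inr_notMem_xVars j) _
      rw [← map_sum, h1, Derivation.map_smul, WeylData.D_mul, WeylData.D_mul, e2,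
        D_inr_rsq_pow_mul_radial]
      congr 1
      ring
    simp only [h2]
    rw [← Finset.smul_sum, ← Finset.mul_sum, Finset.sum_add_distrib, ← Finset.sum_mul,
      ← Finset.sum_mul]
    erw [eDY, eY]
    rw [zero_mul, zero_add, smul_mul_assoc, mul_smul_comm, smul_smul, ← mul_assoc]
    push_cast
    congr 1
    ring
  have h4 : ∑ j, ∑ i, w.X (.inl i) * (w.X (.inr j) * (inX p q (MvPolynomial.pderiv i h₁) *
      inY p q (MvPolynomial.pderiv j h₂) * kFactor p q k s)) = ((k + 1 : ℂ) * (l + 1)) •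
        (inX p q h₁ * inY p q h₂ * (ry ^ s * radial p q c)) := by
    have h2 : ∑ j, ∑ i, w.X (.inl i) * (w.X (.inr j) * (inX p q (MvPolynomial.pderiv i h₁) *
        inY p q (MvPolynomial.pderiv j h₂) * kFactor p q k s)) =
        (∑ i, w.X (.inl i) * inX p q (MvPolynomial.pderiv i h₁)) *
          (∑ j, w.X (.inr j) * inY p q (MvPolynomial.pderiv j h₂)) * kFactor p q k s := by
      rw [Finset.sum_comm, Finset.sum_mul_sum, Finset.sum_mul]
      refine Finset.sum_congr rfl fun i _ => ?_
      rw [Finset.sum_mul]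
      exact Finset.sum_congr rfl fun j _ => by ring
    rw [h2]
    erw [eX, eY]
    rw [hF, smul_mul_smul_comm, smul_mul_assoc]
    push_cast
    rfl
  simp only [noncompact_lie, smul_add, Finset.sum_add_distrib, ← Finset.smul_sum]
  rw [h3, h4, hF', mul_smul Complex.I, ← smul_add]
  congr 1
  have h5 := congrArg (fun u => ((k + 1 : ℂ) * (l + 1)) • (inX p q h₁ * inY p q h₂ * (ry ^ s * u)))
    (radial_bessel_shift (p := p) (q := q) s hα)
  simp only [mul_add (ry ^ s), mul_add (inX p q h₁ * inY p q h₂), mul_smul_comm, smul_smul] at h5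
  rw [← h5]
  module

/-- The scalar in `sum_noncompact_lie` is invertible under `hne`, so each generator of the next type
is a sum of brackets. -/
theorem kType_succ_le_span (hp : 3 ≤ p) {k l s : ℕ} (hne : (k + p / 2 : ℂ) - s - 1 ≠ 0) :
    kType p q (k + 1) (l + 1) s ≤ Submodule.span ℂ
      {f | ∃ X : OrthLie p q, ∃ g ∈ kType p q k l s, f = ⁅X, g⁆} := by
  refine Submodule.map_le_iff_le_comap.2 (Submodule.span_le.2 ?_)
  rintro _ ⟨h₁, hh₁, h₂, hh₂, rfl⟩
  rw [SetLike.mem_coe, Submodule.mem_comap, LinearMap.mulRight_apply]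
  have hc : Complex.I * (((k : ℂ) + 1) * (l + 1) *
      (((k + p / 2 : ℂ) - s - 1) / (k + p / 2))) ≠ 0 := by
    refine mul_ne_zero Complex.I_ne_zero (mul_ne_zero (mul_ne_zero (Nat.cast_add_one_ne_zero k)
      (Nat.cast_add_one_ne_zero l)) (div_ne_zero hne ?_))
    simpa using add_half_ne_neg_natCast hp k 0
  rw [← Submodule.smul_mem_iff _ hc, ← sum_noncompact_lie hp s hh₁ hh₂]
  refine Submodule.sum_mem _ fun j _ => Submodule.sum_mem _ fun i _ => Submodule.subset_span
    ⟨_, _, ⟨_, Submodule.subset_span ⟨_, ?_, _, ?_, rfl⟩, rfl⟩, rfl⟩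
  · exact pderiv_mem_harmonicPoly hh₁ i
  · exact pderiv_mem_harmonicPoly hh₂ j

end Generation

/-! ### Dimension of the spaces of harmonic polynomials -/

section HarmonicDim

open MvPolynomial in
instance finiteDimensional_homogeneousSubmodule (n k : ℕ) :
    FiniteDimensional ℂ (homogeneousSubmodule (Fin n) ℂ k) :=
  Module.Finite.iff_fg.2 (homogeneousSubmodule_fg _ _ k)

open MvPolynomial in
theorem finrank_homogeneousSubmodule (n k : ℕ) :
    Module.finrank ℂ (homogeneousSubmodule (Fin n) ℂ k) = (n + k - 1).choose k := by
  have h1 : {d : Fin n →₀ ℕ | d.degree = k} =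
      ((Finset.univ : Finset (Fin n)).finsuppAntidiag k : Set (Fin n →₀ ℕ)) := by
    ext d
    simp [Finset.mem_finsuppAntidiag, Finsupp.degree_eq_sum]
  rw [homogeneousSubmodule_eq_finsupp_supported, h1,
    (AddMonoidAlgebra.supportedEquivFinsupp _).finrank_eq, Module.finrank_finsupp_self]
  simp [Finset.card_finsuppAntidiag_nat_eq_choose]

variable {n : ℕ}

theorem MvPolynomial.IsHomogeneous.lap {k : ℕ} {h : MvPolynomial (Fin n) ℂ}
    (hh : h.IsHomogeneous (k + 2)) : ((weylP n).lap Finset.univ h).IsHomogeneous k := by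
  rw [WeylData.lap_apply]
  exact MvPolynomial.IsHomogeneous.sum _ _ _ fun i _ => hh.pderiv.pderiv

/-- Iteration of `[Δ, r²] = 4E + 2 |s|`, using that `Δ^i f` has degree `k - 2i`. At `j = 0` the
coefficient vanishes, so the truncated exponent is harmless. -/
theorem lap_pow_rsq_mul {σ R : Type*} [DecidableEq σ] [CommRing R] [Algebra ℂ R]
    (w : WeylData σ R) (s : Finset σ) {f : R} {k : ℂ} (hk : w.eul s f = k • f) (j : ℕ) :
    (w.lap s ^ j) (w.rsq s * f) = w.rsq s * (w.lap s ^ j) f +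
      (j * (4 * k + 2 * s.card - 4 * (j - 1)) : ℂ) • (w.lap s ^ (j - 1)) f := by
  have he : ∀ i : ℕ, w.eul s ((w.lap s ^ i) f) = (k - 2 * i : ℂ) • (w.lap s ^ i) f := by
    intro i
    induction i with
    | zero => simp [hk]
    | succ i ih =>
      rw [pow_succ', Module.End.mul_apply, WeylData.eul_lap, ih, map_smul]
      push_cast
      module
  induction j with
  | zero => simp
  | succ j ih =>
    rw [pow_succ', Module.End.mul_apply, ih, map_add, map_smul, WeylData.lap_rsq_mul, he,
      Module.End.mul_apply, Nat.add_sub_cancel]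
    rcases j with _ | j
    · simp
      module
    · rw [Nat.add_sub_cancel, ← Module.End.mul_apply (w.lap s) (w.lap s ^ j), ← pow_succ']
      push_cast
      module

/-- The Laplacian is injective on the multiples of `r²`. -/
theorem eq_zero_of_lap_rsq_mul (hn : 3 ≤ n) {k : ℕ} {f : MvPolynomial (Fin n) ℂ}
    (hf : f.IsHomogeneous k)
    (h : (weylP n).lap Finset.univ ((weylP n).rsq Finset.univ * f) = 0) : f = 0 := by
  set w := weylP n
  by_contra h0
  have hhom : ∀ j, 2 * j ≤ k → ((w.lap Finset.univ ^ j) f).IsHomogeneous (k - 2 * j) := by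
    intro j
    induction j with
    | zero => intro _; simpa using hf
    | succ j ih =>
      intro hj
      rw [pow_succ', Module.End.mul_apply]
      refine MvPolynomial.IsHomogeneous.lap ?_
      rw [show k - 2 * (j + 1) + 2 = k - 2 * j by omega]
      exact ih (by omega)
  have hlow : ∀ (i : ℕ) (g : MvPolynomial (Fin n) ℂ), i < 2 → g.IsHomogeneous i →
      w.lap Finset.univ g = 0 := by
    intro i g hi hg
    rw [WeylData.lap_apply]
    refine Finset.sum_eq_zero fun a _ => ?_
    have h1 : (w.D a g).IsHomogeneous 0 := by
      have := hg.pderiv (i := a)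
      rwa [show i - 1 = 0 by omega] at this
    rw [MvPolynomial.totalDegree_eq_zero_iff_eq_C.1
      ((MvPolynomial.totalDegree_zero_iff_isHomogeneous _).2 h1)]
    exact MvPolynomial.pderiv_C
  have hex : ∃ j, (w.lap Finset.univ ^ j) f = 0 := by
    refine ⟨k / 2 + 1, ?_⟩
    rw [pow_succ', Module.End.mul_apply]
    exact hlow (k - 2 * (k / 2)) _ (by omega) (hhom _ (by omega))
  classical
  obtain ⟨j, hj⟩ : ∃ j, Nat.find hex = j + 1 := by
    refine Nat.exists_eq_succ_of_ne_zero fun h1 => h0 ?_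
    have := Nat.find_spec hex
    rw [h1] at this
    simpa using this
  have hj1 : (w.lap Finset.univ ^ (j + 1)) f = 0 := hj ▸ Nat.find_spec hex
  have hj2 : (w.lap Finset.univ ^ j) f ≠ 0 := Nat.find_min hex (by omega)
  have hjk : 2 * j ≤ k := by
    have : Nat.find hex ≤ k / 2 + 1 := Nat.find_le (by
      rw [pow_succ', Module.End.mul_apply]
      exact hlow (k - 2 * (k / 2)) _ (by omega) (hhom _ (by omega)))
    omega
  -- With `j + 1` the least power of `Δ` killing `f`, everything vanishes except a multiple of `Δ^j
  -- f ≠ 0`. Its coefficient is positive because `2j ≤ k`, a contradiction.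
  have h1 := lap_pow_rsq_mul w Finset.univ hf.eul (j + 1)
  rw [hj1, pow_succ, Module.End.mul_apply, h, map_zero, mul_zero, zero_add, Nat.add_sub_cancel]
    at h1
  refine (smul_eq_zero.1 h1.symm).elim (fun h2 => ?_) hj2
  have h3 : (((j + 1) * (4 * (k - 2 * j) + 2 * n + 4 * j) : ℕ) : ℂ) = 0 := by
    rw [← h2]
    push_cast [Finset.card_univ, Fintype.card_fin, Nat.cast_sub hjk]
    ring
  have h4 := Nat.cast_eq_zero.1 h3
  have h5 : 0 < (j + 1) * (4 * (k - 2 * j) + 2 * n + 4 * j) := by positivity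
  omega

variable (n) in
/-- The Laplacian on homogeneous polynomials of degree `k + 2`. -/
def homLap (k : ℕ) : MvPolynomial.homogeneousSubmodule (Fin n) ℂ (k + 2) →ₗ[ℂ]
    MvPolynomial.homogeneousSubmodule (Fin n) ℂ k :=
  ((weylP n).lap Finset.univ).restrict fun _ h => MvPolynomial.IsHomogeneous.lap h

/-- The endomorphism `f ↦ Δ(r² f)` of the finite-dimensional space of forms of degree `k` is
injective, hence surjective. -/
theorem homLap_surjective (hn : 3 ≤ n) (k : ℕ) : Function.Surjective (homLap n k) := by
  let r : MvPolynomial.homogeneousSubmodule (Fin n) ℂ k →ₗ[ℂ]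
      MvPolynomial.homogeneousSubmodule (Fin n) ℂ (k + 2) :=
    (LinearMap.mulLeft ℂ ((weylP n).rsq Finset.univ)).restrict
      fun _ h => MvPolynomial.IsHomogeneous.rsq_mul h
  have h1 : Function.Injective (homLap n k ∘ₗ r) := by
    rw [← LinearMap.ker_eq_bot, LinearMap.ker_eq_bot']
    intro f hf
    exact Subtype.ext (eq_zero_of_lap_rsq_mul hn f.2 (congrArg Subtype.val hf))
  have h2 := LinearMap.injective_iff_surjective.1 h1
  exact Function.Surjective.of_comp h2

instance finiteDimensional_harmonicPoly (k : ℕ) : FiniteDimensional ℂ (harmonicPoly n k) :=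
  Submodule.finiteDimensional_inf_left _ _

theorem finrank_harmonicPoly_add (hn : 3 ≤ n) (k : ℕ) :
    Module.finrank ℂ (harmonicPoly n (k + 2)) + (n + k - 1).choose k =
      (n + (k + 2) - 1).choose (k + 2) := by
  have h1 := (homLap n k).finrank_range_add_finrank_ker
  rw [LinearMap.range_eq_top.2 (homLap_surjective hn k), finrank_top,
    finrank_homogeneousSubmodule, finrank_homogeneousSubmodule] at h1
  have h2 : (LinearMap.ker (homLap n k)).map (Submodule.subtype _) = harmonicPoly n (k + 2) := by
    ext f
    rw [mem_harmonicPoly_iff, Submodule.mem_map]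
    constructor
    · rintro ⟨g, hg, rfl⟩
      exact ⟨g.2, congrArg Subtype.val hg⟩
    · rintro ⟨h3, h4⟩
      exact ⟨⟨f, h3⟩, Subtype.ext h4, rfl⟩
  have h3 := Submodule.finrank_map_subtype_eq _ (LinearMap.ker (homLap n k))
  rw [h2] at h3
  rw [h3, add_comm, h1]

/-- Both binomial coefficients, times `(r + 2)!`, contain `(k + 3) ⋯ (k + r + 2)`; the cofactors
satisfy `(k + r + 4)(k + r + 3) - (k + 1)(k + 2) = (r + 2)(2k + r + 5)`. -/
theorem factorial_mul_finrank_harmonicPoly (r k : ℕ) :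
    (r + 1).factorial * Module.finrank ℂ (harmonicPoly (r + 3) (k + 2)) =
      (2 * k + r + 5) * (k + 3).ascFactorial r := by
  have h1 := finrank_harmonicPoly_add (n := r + 3) (by omega) k
  rw [show r + 3 + k - 1 = k + (r + 2) by omega,
    show r + 3 + (k + 2) - 1 = (k + 2) + (r + 2) by omega,
    Nat.choose_symm_add, Nat.choose_symm_add] at h1
  have h2 := congrArg (fun x => (r + 2).factorial * x) h1
  simp only [mul_add ((r + 2).factorial)] at h2
  rw [← Nat.ascFactorial_eq_factorial_mul_choose, ← Nat.ascFactorial_eq_factorial_mul_choose] at h2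
  have h3 : (k + 1).ascFactorial (r + 2) = (k + 1) * (k + 2) * (k + 3).ascFactorial r := by
    have a1 := Nat.succ_ascFactorial (k + 1) (r + 1)
    have a2 := Nat.succ_ascFactorial (k + 2) r
    have a3 : (k + 1).ascFactorial (r + 2) = (k + 1 + (r + 1)) * (k + 1).ascFactorial (r + 1) :=
      Nat.ascFactorial_succ
    have a4 : (k + 2).ascFactorial (r + 1) = (k + 2 + r) * (k + 2).ascFactorial r :=
      Nat.ascFactorial_succ
    rw [a3, ← a1, a4, ← a2]
    ring
  have h4 : (k + 2 + 1).ascFactorial (r + 2) =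
      (k + r + 4) * (k + r + 3) * (k + 3).ascFactorial r := by
    rw [Nat.ascFactorial_succ, Nat.ascFactorial_succ]
    ring
  rw [h3, h4, Nat.factorial_succ] at h2
  refine Nat.eq_of_mul_eq_mul_left (Nat.succ_pos (r + 1)) ?_
  zify at h2 ⊢
  linear_combination h2

end HarmonicDim

/-! ### Dimension of the types and of their sums -/

section TypeDim

variable {p q : ℕ}

open scoped TensorProduct

theorem tensorEquivSum_tmul {σ ι : Type*} (f : MvPolynomial σ ℂ) (g : MvPolynomial ι ℂ) :
    MvPolynomial.tensorEquivSum ℂ σ ι ℂ (f ⊗ₜ g) =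
      MvPolynomial.rename Sum.inl f * MvPolynomial.rename Sum.inr g := by
  have h1 : (MvPolynomial.tensorEquivSum ℂ σ ι ℂ).toAlgHom.comp
      Algebra.TensorProduct.includeLeft = MvPolynomial.rename Sum.inl := by
    ext i
    simp
  have h2 : (MvPolynomial.tensorEquivSum ℂ σ ι ℂ).toAlgHom.comp
      Algebra.TensorProduct.includeRight = MvPolynomial.rename Sum.inr := by
    ext i
    simp
  rw [← h1, ← h2]
  simp [← map_mul]

variable (p q) in
/-- The map `h₁ ⊗ h₂ ↦ h₁(x) h₂(y)`. -/
def typeMap (k l : ℕ) : harmonicPoly p k ⊗[ℂ] harmonicPoly q l →ₗ[ℂ] FormalFn p q :=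
  { toFun f := f, map_add' := MvPolynomial.coe_add, map_smul' r f := MvPolynomial.coe_smul f r :
    MvPolynomial (Fin p ⊕ Fin q) ℂ →ₗ[ℂ] FormalFn p q } ∘ₗ
    (MvPolynomial.tensorEquivSum ℂ (Fin p) (Fin q) ℂ).toLinearMap ∘ₗ
      TensorProduct.map (Submodule.subtype _) (Submodule.subtype _)

theorem typeMap_tmul {k l : ℕ} (h₁ : harmonicPoly p k) (h₂ : harmonicPoly q l) :
    typeMap p q k l (h₁ ⊗ₜ h₂) = inX p q h₁.1 * inY p q h₂.1 := by
  change ((MvPolynomial.tensorEquivSum ℂ (Fin p) (Fin q) ℂ (h₁.1 ⊗ₜ h₂.1) :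
    MvPolynomial (Fin p ⊕ Fin q) ℂ) : FormalFn p q) = _
  rw [tensorEquivSum_tmul, MvPolynomial.coe_mul]
  rfl

/-- Over a field the tensor product of two inclusions is injective, and polynomials in disjoint
groups of variables form a tensor product. -/
theorem typeMap_injective (k l : ℕ) : Function.Injective (typeMap p q k l) := by
  have h1 : Function.Injective (MvPolynomial.toMvPowerSeries (σ := Fin p ⊕ Fin q) (R := ℂ)) :=
    MvPolynomial.coe_injective _ _
  have h2 := TensorProduct.map_injective_of_flat_flat (harmonicPoly p k).subtype
    (harmonicPoly q l).subtype (Submodule.subtype_injective _) (Submodule.subtype_injective _)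
  exact h1.comp ((MvPolynomial.tensorEquivSum ℂ (Fin p) (Fin q) ℂ).injective.comp h2)

theorem range_typeMap (k l : ℕ) : LinearMap.range (typeMap p q k l) = typePoly p q k l := by
  rw [LinearMap.range_eq_map, ← TensorProduct.span_tmul_eq_top, Submodule.map_span, typePoly]
  congr 1
  ext f
  constructor
  · rintro ⟨_, ⟨h₁, h₂, rfl⟩, rfl⟩
    exact ⟨h₁.1, h₁.2, h₂.1, h₂.2, typeMap_tmul _ _⟩
  · rintro ⟨h₁, hh₁, h₂, hh₂, rfl⟩
    exact ⟨_, ⟨⟨h₁, hh₁⟩, ⟨h₂, hh₂⟩, rfl⟩, typeMap_tmul _ _⟩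

theorem finrank_typePoly (k l : ℕ) : Module.finrank ℂ (typePoly p q k l) =
    Module.finrank ℂ (harmonicPoly p k) * Module.finrank ℂ (harmonicPoly q l) := by
  rw [← range_typeMap, LinearMap.finrank_range_of_inj (typeMap_injective k l),
    Module.finrank_tensorProduct]

instance finiteDimensional_typePoly (k l : ℕ) : FiniteDimensional ℂ (typePoly p q k l) := by
  rw [← range_typeMap]
  infer_instance

instance finiteDimensional_kType (k l s : ℕ) : FiniteDimensional ℂ (kType p q k l s) := by
  rw [kType]
  infer_instance

theorem psi_ne_zero (α : ℂ) : psi p q α ≠ 0 := by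
  intro h
  have h1 := psi_sub_one_mem_xOrd (p := p) (q := q) α 0 (by simp [xDeg])
  rw [h, zero_sub, map_neg] at h1
  simp at h1

theorem kFactor_ne_zero (hq : 3 ≤ q) (k s : ℕ) : kFactor p q k s ≠ 0 :=
  mul_ne_zero (pow_ne_zero _ (rsq_ne_zero hq)) (psi_ne_zero _)

theorem finrank_kType (hq : 3 ≤ q) (k l s : ℕ) : Module.finrank ℂ (kType p q k l s) =
    Module.finrank ℂ (harmonicPoly p k) * Module.finrank ℂ (harmonicPoly q l) := by
  rw [← finrank_typePoly, kType]
  exact (Submodule.equivMapOfInjective _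
    (mul_left_injective₀ (kFactor_ne_zero hq k s)) _).finrank_eq.symm

/-- The dimension of a sum of subspaces of eigenspaces. -/
theorem finrank_finset_sup_of_le_eigenspace {V ι : Type*} [AddCommGroup V] [Module ℂ V]
    (T : Module.End ℂ V) {μ : ι → ℂ} {W : ι → Submodule ℂ V}
    (hfin : ∀ i, FiniteDimensional ℂ (W i)) (F : Finset ι) (hμ : Set.InjOn μ F)
    (hW : ∀ i ∈ F, W i ≤ T.eigenspace (μ i)) :
    Module.finrank ℂ (F.sup W : Submodule ℂ V) = ∑ i ∈ F, Module.finrank ℂ (W i) := by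
  classical
  induction F using Finset.induction_on with
  | empty => simp
  | insert a F ha ih =>
    have hd : Disjoint (W a) (F.sup W) := by
      refine ((T.eigenspaces_iSupIndep (μ a)).mono_left (hW a 
        (Finset.mem_insert_self a F))).mono_right (Finset.sup_le fun i hi => ?_)
      refine (hW i (Finset.mem_insert_of_mem hi)).trans
        (le_iSup₂_of_le (μ i) (fun h => ha ?_) le_rfl)
      rwa [← hμ (Finset.mem_insert_of_mem hi) (Finset.mem_insert_self a F) h]
    have h1 := Submodule.finrank_sup_add_finrank_inf_eq (W a) (F.sup W)
    rw [hd.eq_bot, finrank_bot, add_zero, ih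
      (hμ.mono (Finset.coe_subset.2 (Finset.subset_insert a F)))
      fun i hi => hW i (Finset.mem_insert_of_mem hi)] at h1
    rw [Finset.sup_insert, Finset.sum_insert ha, h1]

end TypeDim

/-! ### Polynomial sequences and their sums -/

section PolynomialGrowth

open Polynomial in
/-- A sequence whose differences are given by a polynomial is given by a polynomial. -/
theorem Polynomial.exists_eval_eq_of_sub_eq {P : ℚ[X]} {d : ℕ} (hd : P.natDegree ≤ d) {g : ℕ → ℚ}
    (h : ∀ n : ℕ, g (n + 1) = g n + P.eval (n : ℚ)) : ∃ Q : ℚ[X], Q.natDegree ≤ d + 1 ∧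
      Q.coeff (d + 1) = P.coeff d / (d + 1) ∧ ∀ n : ℕ, g n = Q.eval (n : ℚ) := by
  have hB : ∀ i, (bernoulli i).natDegree ≤ i := fun i =>
    natDegree_le_iff_coeff_eq_zero.2 fun N hN => by
      rw [coeff_bernoulli, if_neg (by omega)]
  -- Since `B_{i+1}(x + 1) - B_{i+1}(x) = (i + 1) x^i` for Bernoulli polynomials, this is a discrete
  -- primitive of `P`.
  let B : ℚ[X] := ∑ i ∈ Finset.range (d + 1), C (P.coeff i / (i + 1)) * bernoulli (i + 1)
  have hdeg : B.natDegree ≤ d + 1 := natDegree_sum_le_of_forall_le _ _ fun i hi =>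
    (natDegree_C_mul_le _ _).trans ((hB _).trans (by
      have := Finset.mem_range.1 hi
      omega))
  have hcoeff : B.coeff (d + 1) = P.coeff d / (d + 1) := by
    rw [finsetSum_coeff, Finset.sum_range_succ, Finset.sum_eq_zero, zero_add, coeff_C_mul,
      coeff_bernoulli]
    · simp
    · intro i hi
      rw [coeff_C_mul, coeff_bernoulli, if_neg, mul_zero]
      have := Finset.mem_range.1 hi
      omega
  have hdiff : ∀ x : ℚ, B.eval (x + 1) = B.eval x + P.eval x := fun x => by
    rw [eval_eq_sum_range' (Nat.lt_succ_of_le hd), add_comm x 1]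
    simp only [B, eval_finsetSum, eval_mul, eval_C, bernoulli_eval_one_add, mul_add,
      Finset.sum_add_distrib]
    congr 1
    refine Finset.sum_congr rfl fun i _ => ?_
    have : (i : ℚ) + 1 ≠ 0 := by positivity
    push_cast
    field_simp
  refine ⟨B + C (g 0 - B.eval 0), ?_, ?_, fun n => ?_⟩
  · exact natDegree_add_le_of_degree_le hdeg (by simp)
  · rw [coeff_add, hcoeff, coeff_C_succ, add_zero]
  · induction n with
    | zero => simp
    | succ n ih =>
      rw [h, ih]
      simp only [eval_add, eval_C]
      push_cast
      rw [hdiff]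
      ring

open Polynomial in
/-- The dimensions of the spaces of harmonic polynomials are given by a polynomial. -/
theorem exists_eval_eq_finrank_harmonicPoly {n : ℕ} (hn : 3 ≤ n) {a : ℕ} (ha : 2 ≤ a) :
    ∃ Q : ℚ[X], Q.natDegree ≤ n - 2 ∧ Q.coeff (n - 2) = 2 / (n - 2).factorial ∧
      ∀ t : ℕ, (Module.finrank ℂ (harmonicPoly n (a + t)) : ℚ) = Q.eval (t : ℚ) := by
  obtain ⟨r, rfl⟩ := Nat.exists_eq_add_of_le' hn
  obtain ⟨b, rfl⟩ := Nat.exists_eq_add_of_le' ha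
  rw [show r + 3 - 2 = r + 1 by omega]
  have hf : ((r + 1).factorial : ℚ) ≠ 0 := by positivity
  set A : ℚ[X] := (ascPochhammer ℚ r).comp (X + C (b + 3 : ℚ))
  have hA : A.natDegree = r := by
    rw [natDegree_comp, ascPochhammer_natDegree, natDegree_X_add_C, mul_one]
  have hA1 : A.Monic := (monic_ascPochhammer ℚ r).comp_X_add_C _
  have hL : (C 2 * X + C (2 * b + r + 5 : ℚ)).natDegree ≤ 1 := natDegree_linear_le
  -- The closed dimension formula at degree `b + t + 2`, with `A` the rising factorial `(b + t +
  -- 3)_r`, monic of degree `r` in `t`.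
  refine ⟨C (1 / ((r + 1).factorial : ℚ)) * ((C 2 * X + C (2 * b + r + 5 : ℚ)) * A), ?_, ?_,
    fun t => ?_⟩
  · refine (natDegree_C_mul_le _ _).trans (natDegree_mul_le.trans ?_)
    omega
  · rw [coeff_C_mul, add_comm r 1, coeff_mul_add_eq_of_natDegree_le hL hA.le]
    have : A.coeff r = 1 := by rw [← hA]; exact hA1
    rw [this]
    simp
    ring
  · have h1 := factorial_mul_finrank_harmonicPoly r (b + t)
    rw [show b + 2 + t = b + t + 2 by omega]
    have h2 : A.eval (t : ℚ) = ((b + t + 3).ascFactorial r : ℚ) := by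
      rw [← ascPochhammer_nat_eq_natCast_ascFactorial, eval_comp]
      congr 1
      simp
      ring
    have h3 : ((r + 1).factorial : ℚ) * Module.finrank ℂ (harmonicPoly (r + 3) (b + t + 2)) =
        (2 * (b + t) + r + 5) * (b + t + 3).ascFactorial r := by exact_mod_cast h1
    simp only [eval_mul, eval_add, eval_C, eval_X, h2]
    field_simp
    linear_combination h3

end PolynomialGrowth

/-! ### Dimension of the filtration of `M⁺_m` -/

section HighestDim

variable {p q : ℕ}

variable (p q) in
/-- The types `(k, l)` with `k + l ≤ N` that occur in `M⁺_m`. -/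
def kIndices (m N : ℕ) : Finset (ℕ × ℕ × ℕ) :=
  {i ∈ Finset.range (N + 1) ×ˢ Finset.range (N + 1) ×ˢ Finset.range (m + 1) |
    (4 * i.2.2 + 2 * i.2.1 + q = 2 * m + 2 * i.1 + p) ∧ i.1 + i.2.1 ≤ N}

theorem mem_kIndices {m N : ℕ} {i : ℕ × ℕ × ℕ} :
    i ∈ kIndices p q m N ↔ IsKIndex p q m i ∧ i.1 + i.2.1 ≤ N := by
  simp only [kIndices, IsKIndex, Finset.mem_filter, Finset.mem_product, Finset.mem_range]
  constructor
  · rintro ⟨⟨_, _, h1⟩, h2, h3⟩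
    exact ⟨⟨by omega, h2⟩, h3⟩
  · rintro ⟨⟨h1, h2⟩, h3⟩
    exact ⟨⟨by omega, by omega, by omega⟩, h2, h3⟩

theorem highestFil_eq_sup (hp : 3 ≤ p) (hq : 3 ≤ q) (m N : ℕ) : highestFil p q m N =
    (kIndices p q m N).sup fun i => kType p q i.1 i.2.1 i.2.2 := by
  rw [highestFil_eq_iSup hp hq, Finset.sup_eq_iSup, iSup_subtype]
  simp only [mem_kIndices]

instance finiteDimensional_finset_sup {V ι : Type*} [AddCommGroup V] [Module ℂ V]
    {W : ι → Submodule ℂ V} [∀ i, FiniteDimensional ℂ (W i)] (F : Finset ι) :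
    FiniteDimensional ℂ (F.sup W : Submodule ℂ V) :=
  Submodule.finiteDimensional_finset_sup F W

theorem finiteDimensional_highestFil (hp : 3 ≤ p) (hq : 3 ≤ q) (m N : ℕ) :
    FiniteDimensional ℂ (highestFil p q m N) := by
  rw [highestFil_eq_sup hp hq]
  infer_instance

theorem finrank_highestFil (hp : 3 ≤ p) (hq : 3 ≤ q) (m N : ℕ) :
    Module.finrank ℂ (highestFil p q m N) = ∑ i ∈ kIndices p q m N,
      Module.finrank ℂ (harmonicPoly p i.1) * Module.finrank ℂ (harmonicPoly q i.2.1) := by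
  rw [highestFil_eq_sup hp hq, finrank_finset_sup_of_le_eigenspace (casXY p q)
    (μ := fun i => casVal p q (i.1, i.2.1)) (fun i => inferInstance)]
  · simp only [finrank_kType hq]
  -- The eigenvalue only sees `(k, l)`; the linear relation in `IsKIndex` then recovers `s`.
  · rintro ⟨k, l, s⟩ hi ⟨k', l', s'⟩ hi' h
    have h1 := (mem_kIndices.1 hi).1.2
    have h2 := (mem_kIndices.1 hi').1.2
    obtain ⟨rfl, rfl⟩ := Prod.mk.inj (casVal_injective hp hq h)
    simp only at h1 h2
    rw [show s = s' by omega]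
  · rintro ⟨k, l, s⟩ _ f hf
    exact Module.End.mem_eigenspace_iff.2 (casXY_of_mem_typeSpace (kType_le_typeSpace hp k l s hf))

/-- On the half-line `s` one has `l - k = p + m - e - 2s`, so `k + l` has the parity of `p + m + e`.
The types added are those with `k + l = p + m + e + 2n`, that is `(s + e + n, p + m - s + n)`, one
for each `s ≤ m`. The offset `p + m + e - 2` keeps both degrees at least `2`, where the dimension
polynomials apply. -/
theorem finrank_highestFil_add_two (hp : 3 ≤ p) (hq : 3 ≤ q) {e : ℕ} (he : p + q = 2 * e)
    (m n : ℕ) : Module.finrank ℂ (highestFil p q m (p + m + e - 2 + 2 * (n + 1))) =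
      Module.finrank ℂ (highestFil p q m (p + m + e - 2 + 2 * n)) +
        ∑ s ∈ Finset.range (m + 1), Module.finrank ℂ (harmonicPoly p (s + e + n)) *
          Module.finrank ℂ (harmonicPoly q (p + m - s + n)) := by
  rw [finrank_highestFil hp hq, finrank_highestFil hp hq]
  have hsub : kIndices p q m (p + m + e - 2 + 2 * n) ⊆
      kIndices p q m (p + m + e - 2 + 2 * (n + 1)) := fun i hi => by
    rw [mem_kIndices] at hi ⊢
    exact ⟨hi.1, hi.2.trans (by omega)⟩
  rw [← Finset.sum_sdiff hsub, add_comm]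
  congr 1
  symm
  refine Finset.sum_bij (fun s _ => (s + e + n, p + m - s + n, s)) ?_ ?_ ?_ fun _ _ => rfl
  · intro s hs
    have := Finset.mem_range.1 hs
    rw [Finset.mem_sdiff, mem_kIndices, mem_kIndices]
    simp only [IsKIndex]
    omega
  · intro s _ s' _ h
    exact (Prod.mk.inj (Prod.mk.inj h).2).2
  · rintro ⟨k, l, s⟩ hi
    rw [Finset.mem_sdiff, mem_kIndices, mem_kIndices] at hi
    simp only [IsKIndex] at hi
    refine ⟨s, Finset.mem_range.2 (by omega), ?_⟩
    rw [show k = s + e + n by omega, show l = p + m - s + n by omega]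

open Polynomial in
/-- The Hilbert polynomial of `M⁺_m`. -/
theorem exists_eval_eq_finrank_highestFil (hp : 3 ≤ p) (hq : 3 ≤ q) {e : ℕ} (he : p + q = 2 * e)
    (m : ℕ) : ∃ P : ℚ[X], P.natDegree = p + q - 3 ∧
      P.leadingCoeff = 4 * (m + 1) * (p + q - 4).factorial /
        ((p - 2).factorial * (q - 2).factorial) / (p + q - 3).factorial ∧
      ∀ n : ℕ, (Module.finrank ℂ (highestFil p q m (p + m + e - 2 + 2 * n)) : ℚ) =
        P.eval (n : ℚ) := by
  have h1 : ∀ s, ∃ Q : ℚ[X], Q.natDegree ≤ p - 2 ∧ Q.coeff (p - 2) = 2 / (p - 2).factorial ∧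
      ∀ t : ℕ, (Module.finrank ℂ (harmonicPoly p (s + e + t)) : ℚ) = Q.eval (t : ℚ) := fun s =>
    exists_eval_eq_finrank_harmonicPoly hp (by omega)
  -- The guard `s ≤ m` keeps the truncated difference `p + m - s` at least `p`.
  have h2 : ∀ s, ∃ Q : ℚ[X], s ≤ m → Q.natDegree ≤ q - 2 ∧
      Q.coeff (q - 2) = 2 / (q - 2).factorial ∧
      ∀ t : ℕ, (Module.finrank ℂ (harmonicPoly q (p + m - s + t)) : ℚ) = Q.eval (t : ℚ) := by
    intro s
    by_cases hs : s ≤ m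
    · obtain ⟨Q, hQ⟩ := exists_eval_eq_finrank_harmonicPoly hq (a := p + m - s) (by omega)
      exact ⟨Q, fun _ => hQ⟩
    · exact ⟨0, fun h => absurd h hs⟩
  choose A hA1 hA2 hA3 using h1
  choose B hB using h2
  have hs : ∀ {s}, s ∈ Finset.range (m + 1) → s ≤ m := fun hs =>
    Nat.lt_succ_iff.1 (Finset.mem_range.1 hs)
  let S : ℚ[X] := ∑ s ∈ Finset.range (m + 1), A s * B s
  have hSd : S.natDegree ≤ p + q - 4 := natDegree_sum_le_of_forall_le _ _ fun s h =>
    natDegree_mul_le.trans (by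
      have := hA1 s
      have := (hB s (hs h)).1
      omega)
  have hSc : S.coeff (p + q - 4) =
      (m + 1) * (2 / (p - 2).factorial * (2 / (q - 2).factorial)) := by
    rw [finsetSum_coeff, Finset.sum_congr rfl (g := fun _ =>
      (2 / (p - 2).factorial * (2 / (q - 2).factorial) : ℚ))]
    · rw [Finset.sum_const, Finset.card_range, nsmul_eq_mul]
      push_cast
      rfl
    · intro s h
      rw [show p + q - 4 = (p - 2) + (q - 2) by omega,
        coeff_mul_add_eq_of_natDegree_le (hA1 s) (hB s (hs h)).1, hA2, (hB s (hs h)).2.1]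
  obtain ⟨P, hP1, hP2, hP3⟩ := exists_eval_eq_of_sub_eq hSd
    (g := fun n => (Module.finrank ℂ (highestFil p q m (p + m + e - 2 + 2 * n)) : ℚ)) (by
      intro n
      rw [finrank_highestFil_add_two hp hq he]
      push_cast
      congr 1
      rw [eval_finsetSum]
      refine Finset.sum_congr rfl fun s h => ?_
      rw [eval_mul, hA3, (hB s (hs h)).2.2])
  rw [hSc] at hP2
  have hd : p + q - 4 + 1 = p + q - 3 := by omega
  have hne : P.coeff (p + q - 4 + 1) ≠ 0 := by
    rw [hP2]
    positivity
  have hdeg : P.natDegree = p + q - 3 := by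
    have := le_natDegree_of_ne_zero hne
    omega
  refine ⟨P, hdeg, ?_, hP3⟩
  rw [leadingCoeff, hdeg, ← hd, hP2, Nat.factorial_succ]
  have : ((p - 2).factorial : ℚ) ≠ 0 := by positivity
  have : ((q - 2).factorial : ℚ) ≠ 0 := by positivity
  have : ((p + q - 4).factorial : ℚ) ≠ 0 := by positivity
  push_cast
  field_simp
  norm_num

end HighestDim

/-! ### The Hilbert polynomial of `M⁺_m` -/

section HilbertPolynomial

variable {p q : ℕ}

theorem lie_mem_highestFil (hp : 3 ≤ p) (hq : 3 ≤ q) {m N : ℕ} (X : OrthLie p q) {f : FormalFn p q}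
    (hf : f ∈ highestFil p q m N) : ⁅X, f⁆ ∈ highestFil p q m (N + 2) :=
  ⟨lie_mem_highestSub hp hq X hf.1, lie_mem_spaceEFil hp hq X hf.2⟩

theorem highestFil_mono (m : ℕ) : Monotone (highestFil p q m) := fun _ _ h =>
  inf_le_inf_left _ (spaceEFil_mono h)

/-- The steps of the filtration of `M⁺_m` are obtained by the action of `𝔤`. -/
theorem highestFil_add_two_le (hp : 3 ≤ p) (hq : 3 ≤ q) {e : ℕ} (he : p + q = 2 * e) {m : ℕ}
    (hm : m + 3 ≤ e) (n : ℕ) : highestFil p q m (p + m + e - 2 + 2 * (n + 1)) ≤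
      highestFil p q m (p + m + e - 2 + 2 * n) ⊔ Submodule.span ℂ
        {f | ∃ X : OrthLie p q, ∃ g ∈ highestFil p q m (p + m + e - 2 + 2 * n), f = ⁅X, g⁆} := by
  rw [highestFil_eq_iSup hp hq m (p + m + e - 2 + 2 * (n + 1))]
  refine iSup_le ?_
  rintro ⟨⟨k, l, s⟩, hi, hN⟩
  rcases le_or_gt (k + l) (p + m + e - 2 + 2 * n) with h | h
  · refine le_sup_of_le_left ?_
    rw [highestFil_eq_iSup hp hq]
    exact le_iSup_of_le (⟨(k, l, s), hi, h⟩ : {i : ℕ × ℕ × ℕ // IsKIndex p q m i ∧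
      i.1 + i.2.1 ≤ p + m + e - 2 + 2 * n}) le_rfl
  · refine le_sup_of_le_right ?_
    have hi' := hi
    simp only [IsKIndex] at hi' hN
    -- A new type is `(s + e + n, p + m - s + n)`; both degrees are positive, so it has a
    -- predecessor on its half-line.
    obtain ⟨k, rfl⟩ : ∃ k', k = k' + 1 := Nat.exists_eq_succ_of_ne_zero (by omega)
    obtain ⟨l, rfl⟩ : ∃ l', l = l' + 1 := Nat.exists_eq_succ_of_ne_zero (by omega)
    -- Now `k + 1 = s + e + n`, so `2k + p` exceeds `2s + 2`.
    have hne : (k + p / 2 : ℂ) - s - 1 ≠ 0 := fun h0 => by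
      have h1 : ((2 * k + p : ℕ) : ℂ) = ((2 * s + 2 : ℕ) : ℂ) := by
        push_cast
        linear_combination 2 * h0
      have := Nat.cast_injective h1
      omega
    refine (kType_succ_le_span hp hne).trans (Submodule.span_mono ?_)
    rintro f ⟨X, g, hg, rfl⟩
    refine ⟨X, g, ?_, rfl⟩
    rw [highestFil_eq_iSup hp hq]
    exact Submodule.mem_iSup_of_mem (⟨(k, l, s), by simp only [IsKIndex]; omega, by
      simp only; omega⟩ : {i : ℕ × ℕ × ℕ // IsKIndex p q m i ∧
      i.1 + i.2.1 ≤ p + m + e - 2 + 2 * n}) hg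

theorem hasGKDim_and_hasBernsteinDegree_Mplus (hp : 3 ≤ p) (hq : 3 ≤ q) {e : ℕ}
    (he : p + q = 2 * e) {m : ℕ} (hm : m + 3 ≤ e) :
    HasGKDim (OrthLie p q) (Mplus p q m) (p + q - 3) ∧
      HasBernsteinDegree (OrthLie p q) (Mplus p q m)
        (4 * (m + 1) * (p + q - 4).factorial / ((p - 2).factorial * (q - 2).factorial)) := by
  obtain ⟨P, hP1, hP2, hP3⟩ := exists_eval_eq_finrank_highestFil hp hq he m
  let ι : Mplus p q m →ₗ[ℂ] FormalFn p q := (Mplus p q m).toSubmodule.subtype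
  have hι : Function.Injective ι := Subtype.val_injective
  -- A bracket raises `k + l` by at most two, hence the step `2n`; all low types go into the
  -- generating subspace `F 0`.
  let F : ℕ → Submodule ℂ (Mplus p q m) := fun n =>
    (highestFil p q m (p + m + e - 2 + 2 * n)).comap ι
  have hmap : ∀ n, (F n).map ι = highestFil p q m (p + m + e - 2 + 2 * n) := fun n => by
    refine Submodule.map_comap_eq_of_le fun f hf => ?_
    exact ⟨⟨f, (mem_Mplus_iff hp hq).2 hf.1⟩, rfl⟩
  have hequiv : ∀ n, F n ≃ₗ[ℂ] highestFil p q m (p + m + e - 2 + 2 * n) := fun n =>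
    (Submodule.equivMapOfInjective ι hι (F n)).trans (LinearEquiv.ofEq _ _ (hmap n))
  have hfin := finiteDimensional_highestFil (p := p) (q := q) hp hq m
  have key := hasGKDim_and_hasBernsteinDegree (L := OrthLie p q) (V := Mplus p q m) (F := F)
    (P := P) (c := 4 * (m + 1) * (p + q - 4).factorial / ((p - 2).factorial * (q - 2).factorial))
    (fun a b hab => Submodule.comap_mono (highestFil_mono m (by omega)))
    (fun v => by
      have hv := (mem_Mplus_iff hp hq).1 v.2
      obtain ⟨N, hN⟩ := exists_mem_spaceEFil (mem_highestSub.1 hv).1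
      exact ⟨N, hv, spaceEFil_mono (by omega) hN⟩)
    (fun n => Module.Finite.equiv (hequiv n).symm)
    (fun n x v hv => lie_mem_highestFil hp hq x hv)
    (fun n => by
      rw [← Submodule.map_le_map_iff_of_injective hι, Submodule.map_sup, hmap, hmap]
      refine (highestFil_add_two_le hp hq he hm n).trans (sup_le_sup_left ?_ _)
      rw [Submodule.map_span]
      refine Submodule.span_mono ?_
      rintro _ ⟨X, g, hg, rfl⟩
      exact ⟨⁅X, (⟨g, (mem_Mplus_iff hp hq).2 hg.1⟩ : Mplus p q m)⁆, ⟨X, _, hg, rfl⟩, rfl⟩)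
    (fun n => by rw [(hequiv n).finrank_eq, hP3])
    (by rw [hP1, hP2])
  rwa [hP1] at key

end HilbertPolynomial

end

theorem corollary4p7 (p q m : ℕ) (hp : 3 ≤ p) (hq : 3 ≤ q) (hpq : Even (p + q))
    (hm : (m : ℚ) + 3 ≤ ((p : ℚ) + q) / 2) :
    ((Mplus p q m : Set (FormalFn p q)) = insert 0 (plusVectors p q m) ∧
      HasGKDim (OrthLie p q) (Mplus p q m) (p + q - 3) ∧
      HasBernsteinDegree (OrthLie p q) (Mplus p q m)
        (4 * (m + 1) * (p + q - 4).factorial / ((p - 2).factorial * (q - 2).factorial)) ∧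
      ∀ c₀ : ℚ, HasBernsteinDegree (OrthLie p q) (Mplus p q 0) c₀ →
        HasBernsteinDegree (OrthLie p q) (Mplus p q m) ((m + 1) * c₀)) ∧
    ((Mminus p q m : Set (FormalFn p q)) = insert 0 (minusVectors p q m) ∧
      HasGKDim (OrthLie p q) (Mminus p q m) (p + q - 3) ∧
      HasBernsteinDegree (OrthLie p q) (Mminus p q m)
        (4 * (m + 1) * (p + q - 4).factorial / ((p - 2).factorial * (q - 2).factorial)) ∧
      ∀ c₀ : ℚ, HasBernsteinDegree (OrthLie p q) (Mminus p q 0) c₀ →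
        HasBernsteinDegree (OrthLie p q) (Mminus p q m) ((m + 1) * c₀)) := by
  obtain ⟨e, he⟩ := hpq
  have he' : p + q = 2 * e := by omega
  have hme : m + 3 ≤ e := by
    have h1 : (p : ℚ) + q = 2 * e := by exact_mod_cast he'
    rw [h1, mul_div_cancel_left₀ _ two_ne_zero] at hm
    exact_mod_cast hm
  obtain ⟨hG, hB⟩ := hasGKDim_and_hasBernsteinDegree_Mplus hp hq he' hme
  have hB0 := (hasGKDim_and_hasBernsteinDegree_Mplus hp hq he' (m := 0) (by omega)).2
  have hB' := (hasBernsteinDegree_congr (MplusEquivMminus hp hq m) _).1 hB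
  have hB0' := (hasBernsteinDegree_congr (MplusEquivMminus hp hq 0) _).1 hB0
  have hc : (4 * (m + 1) * (p + q - 4).factorial / ((p - 2).factorial * (q - 2).factorial) : ℚ) =
      (m + 1) * (4 * ((0 : ℕ) + 1) * (p + q - 4).factorial /
        ((p - 2).factorial * (q - 2).factorial)) := by
    push_cast
    ring
  refine ⟨⟨?_, hG, hB, fun c₀ h₀ => ?_⟩, ?_,
    (hasGKDim_congr (MplusEquivMminus hp hq m) _).1 hG, hB', fun c₀ h₀ => ?_⟩
  · rw [← coe_highestSub]
    exact Set.ext fun f => mem_Mplus_iff hp hq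
  -- Uniqueness of the Bernstein degree forces `c₀` to be the value computed for `m = 0`.
  · rwa [h₀.unique hB0, ← hc]
  · rw [← coe_lowestSub]
    exact Set.ext fun f => mem_Mminus_iff hp hq
  · rwa [h₀.unique hB0', ← hc]
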